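/- **Setting.** Let $n\ge 1$, $\lambda_1,\dots,\lambda_n\in\mathbb R$, and let $H_{n+1}=\mathbb C^n\times\mathbb R$ with points $x=(z,x_{2n+1})$, $y=(w,y_{2n+1})$, where $z_j=x_{2j-1}+ix_{2j}$. Equip it with the CR structure $T^{1,0}H_{n+1}$ spanned by $Z_j=\frac{\partial}{\partial z_j}-i\lambda_j\overline z_j\frac{\partial}{\partial x_{2n+1}}$ and with the Hermitian metric for which $Z_j,\overline Z_j$ $(1\le j\le n)$ and $T=-\frac{\partial}{\partial x_{2n+1}}$ are orthonormal, so that the volume form is $d\mu=2^n\,dx_1\cdots dx_{2n+1}$ and the forms $d\overline z^J=d\overline z_{j_1}\wedge\dots\wedge d\overline z_{j_q}$, $J=(j_1<\dots<j_q)$, form an orthonormal frame of the bundle of $(0,q)$-forms. Let $\Omega^{0,q}$ (resp. $\Omega^{0,q}_0$) be the space of smooth (resp. smooth compactly supported) $(0,q)$-forms and $L^2_{(0,q)}$ the corresponding space of square-integrable forms. Let $\overline\partial_b$ be the tangential Cauchy–Riemann operator, taken in the sense of distributions on $\{u\in L^2_{(0,q)}:\overline\partial_b u\in L^2_{(0,q+1)}\}$,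 let $\overline\partial_b^*$ be its Hilbert space adjoint, and let $\Box_b^{(q)}=\overline\partial_b\overline\partial_b^*+\overline\partial_b^*\overline\partial_b$ on the $s\in L^2_{(0,q)}$ with $s\in\mathrm{Dom}\,\overline\partial_b\cap\mathrm{Dom}\,\overline\partial_b^*$, $\overline\partial_bs\in\mathrm{Dom}\,\overline\partial_b^*$, $\overline\partial_b^*s\in\mathrm{Dom}\,\overline\partial_b$. The Szegő projection $S^{(q)}$ is the orthogonal projection of $L^2_{(0,q)}$ onto $\mathrm{Ker}\,\Box^{(q)}_b$. Put $$\varphi_-(x,y)=-x_{2n+1}+y_{2n+1}+i\sum_{j=1}^n|\lambda_j||z_j-w_j|^2+i\sum_{j=1}^n\lambda_j(\overline z_jw_j-z_j\overline w_j),$$ $$\varphi_+(x,y)=x_{2n+1}-y_{2n+1}+i\sum_{j=1}^n|\lambda_j||z_j-w_j|^2+i\sum_{j=1}^n\lambda_j(z_j\overline w_j-\overline z_jw_j).$$ Suppose that all $\lambda_j$ are nonzero, let $n_-$ be the number of negative $\lambda_j$ and $n_+=n-n_-$, and suppose that $n_->0$ and that the coordinates are numbered so that $\lambda_1<0,\dots,\lambda_{n_-}<0$.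 Put $J_{n_-}=(1,\dots,n_-)$ and $J_{n_+}=(n_-+1,\dots,n)$ (the empty multi-index if $n_-=n$), and for $u=\sum_J u_J\,d\overline z^J\in\bigoplus_{q=0}^n L^2_{(0,q)}$ put $\tau_\pm u=u_{J_{n_\pm}}d\overline z^{J_{n_\pm}}\in L^2_{(0,n_\pm)}$. **Theorem 1.3.** For each choice of sign, with $r=n_\pm$ and $\varphi=\varphi_\pm$, there is a unique bounded operator $I^{(r)}_{\varphi}:L^2_{(0,r)}\to L^2_{(0,r)}$ such that for every $f\in\Omega^{0,r}_0$ the limit $$(I^{(r)}_{\varphi}f)(x)=\lim_{\varepsilon\to0^+}\int_{H_{n+1}}\frac{1}{\bigl(-i(\varphi(x,y)+i\varepsilon)\bigr)^{n+1}}\,f(y)\,d\mu(y)$$ exists for every $x\in H_{n+1}$ and defines a form in $\Omega^{0,r}$ (forms being integrated componentwise in the frame $d\overline z^J$). Moreover, for $q\in\{n_-,n_+\}$, $$S^{(q)}=\frac{|\lambda_1|\cdots|\lambda_n|}{2\pi^{n+1}}\,n!\,I^{(n_-)}_{\varphi_-}\circ\tau_-+\frac{|\lambda_1|\cdots|\lambda_n|}{2\pi^{n+1}}\,n!\,I^{(n_+)}_{\varphi_+}\circ\tau_+\qquad\text{on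 }L^2_{(0,q)}.$$ -/

import Mathlib

open MeasureTheory Filter Topology
open scoped ENNReal ContDiff ComplexConjugate

namespace Heisenberg

/-- The Heisenberg group `H_{n+1} = ℂⁿ × ℝ`, with points `x = (z, x_{2n+1})`. -/
abbrev H (n : ℕ) : Type := (Fin n → ℂ) × ℝ

/-- The volume form `2ⁿ dx₁ ⋯ dx_{2n+1}` of the Hermitian metric for which `Z_j`, `Z̄_j`, `T` are
orthonormal. -/
noncomputable def vol (n : ℕ) : Measure (H n) := (2 : ℝ≥0∞) ^ n • volume

/-- The fibre of `⊕_q Λ^q T^{*0,1} H_{n+1}` in the global orthonormal frame `dz̄^J`, where `J` runs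
over the strictly increasing multi-indices, that is, over the subsets of `{1, …, n}`. -/
abbrev Fiber (n : ℕ) : Type := EuclideanSpace ℂ (Finset (Fin n))

/-- `⊕_q L²_{(0,q)}(H_{n+1})`. -/
abbrev L2Forms (n : ℕ) : Type := Lp (Fiber n) 2 (vol n)

/-- The fibrewise map `∑ u_J dz̄^J ↦ u_J dz̄^J` for a fixed multi-index `J`. -/
noncomputable def fiberComponent {n : ℕ} (J : Finset (Fin n)) : Fiber n →L[ℂ] Fiber n :=
  (ContinuousLinearMap.toSpanSingleton ℂ (EuclideanSpace.single J (1 : ℂ))).comp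
    (EuclideanSpace.proj J)

/-- The map `∑ u_J dz̄^J ↦ u_J dz̄^J` on square integrable forms. -/
noncomputable def component {n : ℕ} (J : Finset (Fin n)) : L2Forms n →L[ℂ] L2Forms n :=
  (fiberComponent J).compLpL 2 (vol n)

/-- `L²_{(0,q)}(H_{n+1})`: the forms all of whose components of degree other than `q` vanish. -/
def L2q (n q : ℕ) : Submodule ℂ (L2Forms n) where
  carrier := {u | ∀ J : Finset (Fin n), J.card ≠ q → component J u = 0}
  add_mem' := by
    intro u v hu hv J hJ
    rw [map_add, hu J hJ, hv J hJ, add_zero]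
  zero_mem' := by
    intro J _
    exact map_zero _
  smul_mem' := by
    intro c u hu J hJ
    rw [map_smul, hu J hJ, smul_zero]

/-- `C_0^∞(H_{n+1})`. -/
def IsTest {n : ℕ} (χ : H n → ℂ) : Prop := ContDiff ℝ ∞ χ ∧ HasCompactSupport χ

/-- The vector field `Z̄_j = ∂/∂z̄_j + i λ_j z_j ∂/∂x_{2n+1}`, with
`∂/∂z̄_j = (∂/∂x_{2j-1} + i ∂/∂x_{2j}) / 2`. -/
noncomputable def Zbar {n : ℕ} (lam : Fin n → ℝ) (j : Fin n) (f : H n → ℂ) (x : H n) : ℂ :=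
  (1 / 2 : ℂ) * (fderiv ℝ f x (Pi.single j 1, 0) +
      Complex.I * fderiv ℝ f x (Pi.single j Complex.I, 0)) +
    Complex.I * (lam j : ℂ) * x.1 j * fderiv ℝ f x (0, 1)

/-- The sign with `dz̄_j ∧ dz̄^{K \ {j}} = wedgeSign j K · dz̄^K` for `j ∈ K`. -/
def wedgeSign {n : ℕ} (j : Fin n) (K : Finset (Fin n)) : ℂ :=
  (-1) ^ (K.filter (fun k => k < j)).card

/-- The pairing `∫ u_J ψ dμ` of a component of `u` with a function. -/
noncomputable def pairing {n : ℕ} (u : L2Forms n) (J : Finset (Fin n)) (ψ : H n → ℂ) : ℂ :=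
  ∫ x, (u x) J * ψ x ∂(vol n)

/-- The graph of the tangential Cauchy-Riemann operator `∂̄_b` on
`Dom ∂̄_b = {u ∈ L² ; ∂̄_b u ∈ L²}`: one has `∂̄_b u = v` in the sense of distributions, where
`∂̄_b (∑_J u_J dz̄^J) = ∑_J ∑_j (Z̄_j u_J) dz̄_j ∧ dz̄^J`, so that the `K`-component of `∂̄_b u` is
`∑_{j ∈ K} wedgeSign j K · Z̄_j u_{K \ {j}}`. The formal transpose of `Z̄_j` is `-Z̄_j`. -/
def IsDbar {n : ℕ} (lam : Fin n → ℝ) (u v : L2Forms n) : Prop :=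
  ∀ (K : Finset (Fin n)) (χ : H n → ℂ), IsTest χ →
    pairing v K χ = -∑ j ∈ K, wedgeSign j K * pairing u (K.erase j) (Zbar lam j χ)

/-- The graph of the Hilbert space adjoint `∂̄_b^*` of `∂̄_b`. -/
def IsDbarStar {n : ℕ} (lam : Fin n → ℝ) (v w : L2Forms n) : Prop :=
  ∀ u f : L2Forms n, IsDbar lam u f → inner ℂ f v = inner ℂ u w

/-- The graph of the Gaffney extension of the Kohn Laplacian
`□_b = ∂̄_b ∂̄_b^* + ∂̄_b^* ∂̄_b`: `s` lies in `Dom □_b` and `□_b s = f`. -/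
def IsBox {n : ℕ} (lam : Fin n → ℝ) (s f : L2Forms n) : Prop :=
  ∃ d e a b : L2Forms n, IsDbar lam s d ∧ IsDbarStar lam s e ∧
    IsDbar lam e a ∧ IsDbarStar lam d b ∧ f = a + b

section Helpers

variable {n : ℕ}

instance instFiniteOnCompactsVol : IsFiniteMeasureOnCompacts (vol n) := by
  refine ⟨fun K hK => ?_⟩
  rw [vol, Measure.smul_apply, smul_eq_mul]
  exact ENNReal.mul_lt_top (ENNReal.pow_lt_top (by norm_num)) hK.measure_lt_top

/-- The form `conj ψ dz̄^J`. -/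
noncomputable def conjForm (J : Finset (Fin n)) (ψ : H n → ℂ) (x : H n) : Fiber n :=
  EuclideanSpace.single J (conj (ψ x))

theorem memLp_conjForm (J : Finset (Fin n)) {ψ : H n → ℂ} (hc : Continuous ψ)
    (hs : HasCompactSupport ψ) : MemLp (conjForm J ψ) 2 (vol n) := by
  have h : conjForm J ψ = fun x =>
      ContinuousLinearMap.toSpanSingleton ℂ (EuclideanSpace.single J (1 : ℂ) : Fiber n)
        (conj (ψ x)) := by
    funext x
    ext i
    simp [conjForm]
  refine Continuous.memLp_of_hasCompactSupport ?_ ?_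
  · rw [h]
    exact (ContinuousLinearMap.continuous _).comp (Complex.continuous_conj.comp hc)
  · rw [h]
    exact hs.comp_left (g := fun c => ContinuousLinearMap.toSpanSingleton ℂ
      (EuclideanSpace.single J (1 : ℂ) : Fiber n) (conj c)) (by simp)

theorem pairing_eq_inner (u : L2Forms n) (J : Finset (Fin n)) {ψ : H n → ℂ} (hc : Continuous ψ)
    (hs : HasCompactSupport ψ) :
    pairing u J ψ = inner ℂ ((memLp_conjForm J hc hs).toLp (conjForm J ψ)) u := by
  rw [L2.inner_def, pairing]
  refine integral_congr_ae ?_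
  filter_upwards [(memLp_conjForm J hc hs).coeFn_toLp] with x hx
  rw [hx, conjForm, EuclideanSpace.inner_single_left]
  simp [mul_comm]

theorem continuous_Zbar (lam : Fin n → ℝ) (j : Fin n) {χ : H n → ℂ} (h : IsTest χ) :
    Continuous (Zbar lam j χ) := by
  have hd : Continuous (fderiv ℝ χ) := h.1.continuous_fderiv (by simp)
  unfold Zbar
  fun_prop

theorem hasCompactSupport_Zbar (lam : Fin n → ℝ) (j : Fin n) {χ : H n → ℂ} (h : IsTest χ) :
    HasCompactSupport (Zbar lam j χ) := by
  refine (h.2.fderiv (𝕜 := ℝ)).mono ?_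
  intro x hx h0
  apply hx
  simp [Zbar, h0]

theorem pairing_add (u v : L2Forms n) (J : Finset (Fin n)) {ψ : H n → ℂ} (hc : Continuous ψ)
    (hs : HasCompactSupport ψ) : pairing (u + v) J ψ = pairing u J ψ + pairing v J ψ := by
  rw [pairing_eq_inner _ J hc hs, pairing_eq_inner _ J hc hs, pairing_eq_inner _ J hc hs,
    inner_add_right]

theorem pairing_smul (c : ℂ) (u : L2Forms n) (J : Finset (Fin n)) {ψ : H n → ℂ}
    (hc : Continuous ψ) (hs : HasCompactSupport ψ) :
    pairing (c • u) J ψ = c * pairing u J ψ := by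
  rw [pairing_eq_inner _ J hc hs, pairing_eq_inner _ J hc hs, inner_smul_right]

theorem pairing_zero (J : Finset (Fin n)) {ψ : H n → ℂ} (hc : Continuous ψ)
    (hs : HasCompactSupport ψ) : pairing (0 : L2Forms n) J ψ = 0 := by
  rw [pairing_eq_inner _ J hc hs, inner_zero_right]

theorem continuous_pairing (J : Finset (Fin n)) {ψ : H n → ℂ} (hc : Continuous ψ)
    (hs : HasCompactSupport ψ) : Continuous fun u : L2Forms n => pairing u J ψ := by
  simp_rw [pairing_eq_inner _ J hc hs]
  fun_prop

variable {lam : Fin n → ℝ}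

theorem IsDbar.add {u v u' v' : L2Forms n} (h : IsDbar lam u v) (h' : IsDbar lam u' v') :
    IsDbar lam (u + u') (v + v') := by
  intro K χ hχ
  rw [pairing_add _ _ _ hχ.1.continuous hχ.2, h K χ hχ, h' K χ hχ, ← neg_add,
    ← Finset.sum_add_distrib]
  congr 1
  refine Finset.sum_congr rfl fun j _ => ?_
  rw [pairing_add _ _ _ (continuous_Zbar lam j hχ) (hasCompactSupport_Zbar lam j hχ), mul_add]

theorem IsDbar.smul (c : ℂ) {u v : L2Forms n} (h : IsDbar lam u v) :
    IsDbar lam (c • u) (c • v) := by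
  intro K χ hχ
  rw [pairing_smul _ _ _ hχ.1.continuous hχ.2, h K χ hχ, mul_neg, Finset.mul_sum]
  congr 1
  refine Finset.sum_congr rfl fun j _ => ?_
  rw [pairing_smul _ _ _ (continuous_Zbar lam j hχ) (hasCompactSupport_Zbar lam j hχ)]
  ring

theorem isDbar_zero : IsDbar lam (0 : L2Forms n) 0 := by
  intro K χ hχ
  rw [pairing_zero _ hχ.1.continuous hχ.2]
  symm
  rw [neg_eq_zero]
  refine Finset.sum_eq_zero fun j _ => ?_
  rw [pairing_zero _ (continuous_Zbar lam j hχ) (hasCompactSupport_Zbar lam j hχ), mul_zero]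

theorem isDbarStar_zero : IsDbarStar lam (0 : L2Forms n) 0 := by
  intro u f _
  simp

theorem IsBox.of_closed {s : L2Forms n} (h : IsDbar lam s 0) (h' : IsDbarStar lam s 0) :
    IsBox lam s 0 :=
  ⟨0, 0, 0, 0, h, h', isDbar_zero, isDbarStar_zero, by simp⟩

theorem isBox_zero_iff {s : L2Forms n} :
    IsBox lam s 0 ↔ IsDbar lam s 0 ∧ IsDbarStar lam s 0 := by
  refine ⟨?_, fun h => IsBox.of_closed h.1 h.2⟩
  rintro ⟨d, e, a, b, hd, he, ha, hb, h0⟩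
  have h1 : inner ℂ d d = inner ℂ s b := hb s d hd
  have h2 : inner ℂ a s = inner ℂ e e := he e a ha
  have h3 : inner ℂ e e = inner ℂ s a := by
    rw [← inner_conj_symm s a, h2, inner_conj_symm]
  have h4 : inner ℂ d d + inner ℂ e e = (0 : ℂ) := by
    rw [h1, h3, add_comm, ← inner_add_right, ← h0, inner_zero_right]
  have h5 : ‖d‖ ^ 2 + ‖e‖ ^ 2 = 0 := by
    have := congrArg (RCLike.re : ℂ → ℝ) h4
    rwa [map_add, inner_self_eq_norm_sq, inner_self_eq_norm_sq, map_zero] at this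
  have hd0 : d = 0 := norm_eq_zero.1 (by nlinarith [sq_nonneg ‖d‖, sq_nonneg ‖e‖])
  have he0 : e = 0 := norm_eq_zero.1 (by nlinarith [sq_nonneg ‖d‖, sq_nonneg ‖e‖])
  rw [hd0] at hd
  rw [he0] at he
  exact ⟨hd, he⟩

end Helpers

/-- `Ker □_b^{(q)}`, a subspace of `L²_{(0,q)}(H_{n+1})`. -/
def kerBox {n : ℕ} (lam : Fin n → ℝ) (q : ℕ) : Submodule ℂ (L2Forms n) where
  carrier := {s | s ∈ L2q n q ∧ IsBox lam s 0}
  add_mem' := by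
    rintro s t ⟨hs, hs'⟩ ⟨ht, ht'⟩
    rw [isBox_zero_iff] at hs' ht'
    refine ⟨(L2q n q).add_mem hs ht, isBox_zero_iff.2 ⟨?_, ?_⟩⟩
    · simpa using hs'.1.add ht'.1
    · intro u f huf
      rw [inner_add_right, hs'.2 u f huf, ht'.2 u f huf]
      simp
  zero_mem' := ⟨(L2q n q).zero_mem, IsBox.of_closed isDbar_zero isDbarStar_zero⟩
  smul_mem' := by
    rintro c s ⟨hs, hs'⟩
    rw [isBox_zero_iff] at hs'
    refine ⟨(L2q n q).smul_mem c hs, isBox_zero_iff.2 ⟨?_, ?_⟩⟩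
    · simpa using hs'.1.smul c
    · intro u f huf
      rw [inner_smul_right, hs'.2 u f huf]
      simp

theorem isClosed_kerBox {n : ℕ} (lam : Fin n → ℝ) (q : ℕ) :
    IsClosed (kerBox lam q : Set (L2Forms n)) := by
  have h : (kerBox lam q : Set (L2Forms n)) =
      {s | ∀ J : Finset (Fin n), J.card ≠ q → component J s = 0} ∩
      ({s | IsDbar lam s 0} ∩ {s | IsDbarStar lam s 0}) := by
    ext s
    exact and_congr Iff.rfl isBox_zero_iff
  rw [h]
  refine IsClosed.inter ?_ (IsClosed.inter ?_ ?_)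
  · simp only [Set.ofPred_forall]
    refine isClosed_iInter fun J => isClosed_iInter fun _ => ?_
    exact isClosed_eq (component J).continuous continuous_const
  · simp only [IsDbar, Set.ofPred_forall]
    refine isClosed_iInter fun K => isClosed_iInter fun χ => isClosed_iInter fun hχ => ?_
    refine isClosed_eq continuous_const (Continuous.neg ?_)
    refine continuous_finsetSum _ fun j _ => continuous_const.mul ?_
    exact continuous_pairing _ (continuous_Zbar lam j hχ) (hasCompactSupport_Zbar lam j hχ)
  · simp only [IsDbarStar, Set.ofPred_forall]
    refine isClosed_iInter fun u => isClosed_iInter fun f => isClosed_iInter fun _ => ?_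
    exact isClosed_eq (by fun_prop) continuous_const

instance instHasOrthogonalProjectionKerBox {n : ℕ} (lam : Fin n → ℝ) (q : ℕ) :
    (kerBox lam q).HasOrthogonalProjection :=
  haveI : CompleteSpace (kerBox lam q) := (isClosed_kerBox lam q).completeSpace_coe
  inferInstance

/-- The Szegő projection `S^{(q)}`: the orthogonal projection of `L²_{(0,q)}(H_{n+1})` onto
`Ker □_b^{(q)}`. -/
noncomputable def szego {n : ℕ} (lam : Fin n → ℝ) (q : ℕ) : L2q n q →L[ℂ] L2Forms n :=
  (kerBox lam q).starProjection.comp (L2q n q).subtypeL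

/-- The phase `φ_-`. -/
noncomputable def phaseMinus {n : ℕ} (lam : Fin n → ℝ) (x y : H n) : ℂ :=
  -(x.2 : ℂ) + (y.2 : ℂ) + Complex.I * ∑ j, ((|lam j| * ‖x.1 j - y.1 j‖ ^ 2 : ℝ) : ℂ) +
    Complex.I * ∑ j, (lam j : ℂ) * (conj (x.1 j) * y.1 j - x.1 j * conj (y.1 j))

/-- The phase `φ_+`. -/
noncomputable def phasePlus {n : ℕ} (lam : Fin n → ℝ) (x y : H n) : ℂ :=
  (x.2 : ℂ) - (y.2 : ℂ) + Complex.I * ∑ j, ((|lam j| * ‖x.1 j - y.1 j‖ ^ 2 : ℝ) : ℂ) +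
    Complex.I * ∑ j, (lam j : ℂ) * (x.1 j * conj (y.1 j) - conj (x.1 j) * y.1 j)

/-- `Ω^{0,q}(H_{n+1})`: smooth forms of degree `q`. -/
def IsSmoothForm {n : ℕ} (q : ℕ) (f : H n → Fiber n) : Prop :=
  ContDiff ℝ ∞ f ∧ ∀ x, ∀ J : Finset (Fin n), J.card ≠ q → f x J = 0

/-- The bounded operator `A` on `L²_{(0,q)}(H_{n+1})` is `I^{(q)}_φ`: for every
`f ∈ Ω^{0,q}_0(H_{n+1})` the limit
`lim_{ε → 0+} ∫ (-i (φ(x, y) + i ε))^{-(n+1)} f(y) dμ(y)` exists at every point `x`, it is a form in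
`Ω^{0,q}(H_{n+1})`, and `A f` is this form. -/
def IsIOperator {n : ℕ} (φ : H n → H n → ℂ) (q : ℕ) (A : L2q n q →L[ℂ] L2q n q) : Prop :=
  ∀ (u : L2q n q) (f : H n → Fiber n), IsSmoothForm q f → HasCompactSupport f →
    ((u : L2Forms n) : H n → Fiber n) =ᵐ[vol n] f →
      ∃ g : H n → Fiber n, IsSmoothForm q g ∧
        (∀ x, Tendsto
          (fun ε : ℝ => ∫ y, (1 / (-Complex.I * (φ x y + Complex.I * (ε : ℂ))) ^ (n + 1)) • f y
            ∂(vol n))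
          (𝓝[>] 0) (𝓝 (g x))) ∧
        ((A u : L2Forms n) : H n → Fiber n) =ᵐ[vol n] g

/-- `n_-`, the number of negative `λ_j`. -/
noncomputable def nMinus {n : ℕ} (lam : Fin n → ℝ) : ℕ :=
  (Finset.univ.filter fun j => lam j < 0).card

/-- `n_+ = n - n_-`. -/
noncomputable def nPlus {n : ℕ} (lam : Fin n → ℝ) : ℕ := n - nMinus lam

/-- `J_{n_-} = (1, …, n_-)`. -/
noncomputable def JMinus {n : ℕ} (lam : Fin n → ℝ) : Finset (Fin n) :=
  Finset.univ.filter fun j => (j : ℕ) < nMinus lam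

/-- `J_{n_+} = (n_- + 1, …, n)`, which is empty if `n_- = n`. -/
noncomputable def JPlus {n : ℕ} (lam : Fin n → ℝ) : Finset (Fin n) :=
  Finset.univ.filter fun j => nMinus lam ≤ (j : ℕ)

theorem card_JMinus {n : ℕ} (lam : Fin n → ℝ) : (JMinus lam).card = nMinus lam := by
  have h : nMinus lam ≤ n := by
    simpa [nMinus] using Finset.card_filter_le (Finset.univ : Finset (Fin n)) (fun j => lam j < 0)
  rw [JMinus, Fin.card_filter_val_lt, min_eq_right h]

theorem card_JPlus {n : ℕ} (lam : Fin n → ℝ) : (JPlus lam).card = nPlus lam := by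
  have h : (JPlus lam) = (JMinus lam)ᶜ := by
    ext j
    simp [JPlus, JMinus]
  rw [h, Finset.card_compl, card_JMinus, Fintype.card_fin, nPlus]

theorem component_mem {n : ℕ} {J : Finset (Fin n)} {q : ℕ} (hJ : J.card = q) (u : L2Forms n) :
    component J u ∈ L2q n q := by
  intro K hK
  have hne : K ≠ J := by
    rintro rfl
    exact hK hJ
  refine (Lp.eq_zero_iff_ae_eq_zero).2 ?_
  filter_upwards [(fiberComponent K).coeFn_compLpL (p := 2) (μ := vol n) (component J u),
    (fiberComponent J).coeFn_compLpL (p := 2) (μ := vol n) u] with x h1 h2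
  rw [component, h1]
  change fiberComponent K ((component J u) x) = 0
  rw [component, h2]
  ext i
  simp [fiberComponent, hne]

/-- The map `u = ∑ u_K dz̄^K ↦ u_J dz̄^J` into `L²_{(0,q)}(H_{n+1})`, where `J` has length `q`. -/
noncomputable def tau {n : ℕ} (J : Finset (Fin n)) {q : ℕ} (hJ : J.card = q) :
    L2Forms n →L[ℂ] L2q n q :=
  (component J).codRestrict (L2q n q) (component_mem hJ)

/-- `τ_- : ⊕_q L²_{(0,q)} → L²_{(0,n_-)}`, `u ↦ u_{J_{n_-}} dz̄^{J_{n_-}}`. -/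
noncomputable def tauMinus {n : ℕ} (lam : Fin n → ℝ) : L2Forms n →L[ℂ] L2q n (nMinus lam) :=
  tau (JMinus lam) (card_JMinus lam)

/-- `τ_+ : ⊕_q L²_{(0,q)} → L²_{(0,n_+)}`, `u ↦ u_{J_{n_+}} dz̄^{J_{n_+}}`; for `n_- = n` this is
`u ↦ u_0`. -/
noncomputable def tauPlus {n : ℕ} (lam : Fin n → ℝ) : L2Forms n →L[ℂ] L2q n (nPlus lam) :=
  tau (JPlus lam) (card_JPlus lam)

end Heisenberg

/-! ### Left-invariant vector fields: derivation rules and integration by parts -/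

namespace Heisenberg

variable {n : ℕ}

/-! Harmonic forms. On smooth compactly supported forms the energy ‖∂̄_b v‖² + ‖∂̄_b^* v‖² is
diagonal in the frame dz̄^J: it is the sum over J and j of ‖W_j v_J‖², where W_j is Z_j for j ∈ J
and Z̄_j for j ∉ J (`energy_identity`). Cross terms cancel, since fields with different indices
commute while the wedge signs anticommute. An L² harmonic form may be regularized by left
convolution, which commutes with left-invariant fields, and truncated by dilated cutoffs whose
derivatives along these fields tend uniformly to 0. Hence W_j u_J = 0 for all J and j
(`WeakHarmonic.weakNull`).

The commutator of Z_j and Z̄_j is a multiple of λ_j ∂/∂t, with t = x_{2n+1}, so W_j u_J = 0 confines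
the t-frequencies of u_J to a half line given by the sign of `sgn J j * lam j`. If both signs occur
then u_J = 0 (`eq_zero_of_mixed_signs`), and the signs are constant in j only for J_{n_-} and
J_{n_+} (`exists_sign_change`). For these two J every L² solution of the equations does give a
harmonic form (`embed_mem_kerBox`), so the Szegő projection is a sum of two scalar projections onto
spaces `solSpace` (`szego_eq`).

Scalar projections. Put a = ε + Σ|λ_j||z_j|² + iσt. Then -i(φ + iε) is a evaluated at y⁻¹x, with σ =
1 for φ_- and σ = -1 for φ_+. The kernel a^{-(n+1)} is square integrable and annihilated by the
relevant W_j; modulo derivatives along the conjugate fields it equals 2ε a^{-(n+1)} ā^{-1}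
(`szegoKer_eq`). Paired with an element of `solSpace` those derivatives integrate to 0, and the
remaining kernel is an approximate identity of mass 2π^{n+1}/(n! ∏|λ_j|), the reciprocal of the
constant in the theorem. So the limit operator is this mass times the projection
(`exists_szego_limit`), which yields its boundedness without any singular integral estimate.

The pointwise limit exists and is smooth because a^{-(n+1)} is, up to a constant, the (n+2)-nd
t-derivative of a log a - a. This function is bounded on compact sets uniformly in ε, and the
derivatives can be moved to f (`exists_tendsto_szegoInt`). -/

instance instIsAddHaarMeasureVol : (vol n).IsAddHaarMeasure :=
  haveI : (volume : Measure (H n)).IsAddHaarMeasure :=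
    Measure.prod.instIsAddHaarMeasure (volume : Measure (Fin n → ℂ)) (volume : Measure ℝ)
  Measure.IsAddHaarMeasure.smul _ (by simp) (by simp)

/-- The pairing of a real-linear functional with the complex vector field `W lam τ j` at `x`. -/
noncomputable def wsym (lam : Fin n → ℝ) (τ : ℝ) (j : Fin n) (x : H n) (L : H n →L[ℝ] ℂ) : ℂ :=
  (1 / 2 : ℂ) * (L (Pi.single j 1, 0) + Complex.I * τ * L (Pi.single j Complex.I, 0)) +
    Complex.I * τ * lam j * ((x.1 j).re + Complex.I * τ * (x.1 j).im) * L (0, 1)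

/-- The left invariant vector field that is `Z̄_j` for `τ = 1` and `Z_j` for `τ = -1`. -/
noncomputable def W (lam : Fin n → ℝ) (τ : ℝ) (j : Fin n) (f : H n → ℂ) (x : H n) : ℂ :=
  wsym lam τ j x (fderiv ℝ f x)

/-- `∂/∂x_{2n+1}`. -/
noncomputable def Dt (f : H n → ℂ) (x : H n) : ℂ := fderiv ℝ f x (0, 1)

theorem Zbar_eq_W (lam : Fin n → ℝ) (j : Fin n) : Zbar lam j = W lam 1 j := by
  funext f x
  have h : (x.1 j) = (x.1 j).re + Complex.I * (x.1 j).im := by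
    rw [mul_comm]; exact (Complex.re_add_im _).symm
  rw [Zbar, W, wsym]
  conv_lhs => rw [h]
  push_cast
  ring

section Derivation

variable {lam : Fin n → ℝ} {τ : ℝ} {j : Fin n} {f g : H n → ℂ} {x : H n}

theorem W_mul (hf : DifferentiableAt ℝ f x) (hg : DifferentiableAt ℝ g x) :
    W lam τ j (fun y => f y * g y) x = f x * W lam τ j g x + g x * W lam τ j f x := by
  simp only [W, wsym, fderiv_fun_mul hf hg, add_apply, smul_apply,
    smul_eq_mul]
  ring

theorem Dt_mul (hf : DifferentiableAt ℝ f x) (hg : DifferentiableAt ℝ g x) :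
    Dt (fun y => f y * g y) x = f x * Dt g x + g x * Dt f x := by
  simp only [Dt, fderiv_fun_mul hf hg, add_apply, smul_apply,
    smul_eq_mul]

theorem W_add (hf : DifferentiableAt ℝ f x) (hg : DifferentiableAt ℝ g x) :
    W lam τ j (fun y => f y + g y) x = W lam τ j f x + W lam τ j g x := by
  simp only [W, wsym, fderiv_fun_add hf hg, add_apply]
  ring

theorem W_const (c : ℂ) : W lam τ j (fun _ => c) x = 0 := by
  simp [W, wsym]

theorem W_const_mul (c : ℂ) (hf : DifferentiableAt ℝ f x) :
    W lam τ j (fun y => c * f y) x = c * W lam τ j f x := by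
  rw [W_mul (differentiableAt_const c) hf, W_const]
  ring

theorem W_inv (hf : DifferentiableAt ℝ f x) (h0 : f x ≠ 0) :
    W lam τ j (fun y => (f y)⁻¹) x = -((f x)⁻¹ ^ 2 * W lam τ j f x) := by
  have hi : DifferentiableAt ℝ (fun y => (f y)⁻¹) x := hf.fun_inv h0
  have h := W_mul (lam := lam) (τ := τ) (j := j) hf hi
  have h1 : W lam τ j (fun y => f y * (f y)⁻¹) x = 0 := by
    have he : (fun y => f y * (f y)⁻¹) =ᶠ[𝓝 x] fun _ => 1 := by
      filter_upwards [hf.continuousAt.eventually_ne h0] with y hy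
      exact mul_inv_cancel₀ hy
    rw [W, he.fderiv_eq]
    simp [wsym]
  rw [h1] at h
  field_simp at h ⊢
  linear_combination -h

theorem W_pow (hf : DifferentiableAt ℝ f x) (m : ℕ) :
    W lam τ j (fun y => f y ^ m) x = m * f x ^ (m - 1) * W lam τ j f x := by
  induction m with
  | zero => simpa using W_const (lam := lam) (τ := τ) (j := j) (x := x) 1
  | succ m ih =>
    have h := W_mul (lam := lam) (τ := τ) (j := j) (hf.fun_pow m) hf
    have he : (fun y => f y ^ (m + 1)) = fun y => f y ^ m * f y := by
      funext y
      rw [pow_succ]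
    rw [he, h, ih]
    rcases m with _ | m
    · simp
    · push_cast
      ring

theorem fderiv_conj_comp (f : H n → ℂ) (x : H n) (v : H n) :
    fderiv ℝ (fun y => conj (f y)) x v = conj (fderiv ℝ f x v) := by
  have := (Complex.conjCLE).comp_fderiv (f := f) (x := x)
  have h2 : (Complex.conjCLE : ℂ → ℂ) ∘ f = fun y => conj (f y) := by
    funext y; simp
  rw [h2] at this
  rw [this]
  simp

/-- Used to turn Hermitian L² pairings into bilinear ones, where integration by parts applies. -/
theorem W_conj (f : H n → ℂ) (x : H n) :
    W lam τ j (fun y => conj (f y)) x = conj (W lam (-τ) j f x) := by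
  simp only [W, wsym, fderiv_conj_comp, map_add, map_mul, map_neg, Complex.conj_I,
    Complex.conj_ofReal, map_div₀, map_one, map_ofNat, Complex.ofReal_neg]
  ring

theorem continuous_W (lam : Fin n → ℝ) (τ : ℝ) (j : Fin n) (h : ContDiff ℝ 1 f) :
    Continuous (W lam τ j f) := by
  have hd : Continuous (fderiv ℝ f) := h.continuous_fderiv (by simp)
  unfold W wsym
  fun_prop

theorem contDiff_wsym_comp {m : ℕ∞} {L : H n → (H n →L[ℝ] ℂ)} (hL : ContDiff ℝ m L) :
    ContDiff ℝ m (fun x => wsym lam τ j x (L x)) := by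
  have h1 : ∀ v : H n, ContDiff ℝ m (fun x => L x v) := fun v => hL.clm_apply contDiff_const
  have h2 : ContDiff ℝ m (fun x : H n => ((x.1 j).re : ℂ)) :=
    (Complex.ofRealCLM.comp (Complex.reCLM.comp ((ContinuousLinearMap.proj j).comp
      (ContinuousLinearMap.fst ℝ (Fin n → ℂ) ℝ)))).contDiff
  have h3 : ContDiff ℝ m (fun x : H n => ((x.1 j).im : ℂ)) :=
    (Complex.ofRealCLM.comp (Complex.imCLM.comp ((ContinuousLinearMap.proj j).comp
      (ContinuousLinearMap.fst ℝ (Fin n → ℂ) ℝ)))).contDiff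
  unfold wsym
  exact (contDiff_const.mul ((h1 _).add (contDiff_const.mul (h1 _)))).add
    ((contDiff_const.mul (h2.add (contDiff_const.mul h3))).mul (h1 _))

theorem contDiff_W (lam : Fin n → ℝ) (τ : ℝ) (j : Fin n) (h : ContDiff ℝ ∞ f) :
    ContDiff ℝ ∞ (W lam τ j f) :=
  contDiff_wsym_comp (h.fderiv_right (m := ∞) (by simp))

theorem contDiff_Dt (h : ContDiff ℝ ∞ f) : ContDiff ℝ ∞ (Dt f) :=
  (h.fderiv_right (m := ∞) (by simp)).clm_apply contDiff_const

theorem W_eq_zero_of_notMem_tsupport (hx : x ∉ tsupport f) : W lam τ j f x = 0 := by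
  have : fderiv ℝ f x = 0 := by
    by_contra h
    exact hx (support_fderiv_subset ℝ h)
  simp [W, wsym, this]

end Derivation

section Test

variable {f g : H n → ℂ}

theorem IsTest.W (h : IsTest f) (lam : Fin n → ℝ) (τ : ℝ) (j : Fin n) :
    IsTest (W lam τ j f) :=
  ⟨contDiff_W lam τ j h.1, h.2.mono' fun x hx => by
    by_contra h'
    exact hx (W_eq_zero_of_notMem_tsupport h')⟩

theorem IsTest.Dt (h : IsTest f) : IsTest (Dt f) :=
  ⟨contDiff_Dt h.1, h.2.fderiv_apply (𝕜 := ℝ) _⟩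

theorem IsTest.mul_left (h : IsTest f) (hg : ContDiff ℝ ∞ g) : IsTest (fun x => g x * f x) :=
  ⟨hg.mul h.1, h.2.mul_left⟩

theorem IsTest.mul_right (h : IsTest f) (hg : ContDiff ℝ ∞ g) : IsTest (fun x => f x * g x) :=
  ⟨h.1.mul hg, h.2.mul_right⟩

theorem IsTest.conj (h : IsTest f) : IsTest (fun x => conj (f x)) :=
  ⟨Complex.conjCLE.contDiff.comp h.1, h.2.comp_left (g := fun c => conj c) (by simp)⟩

theorem IsTest.memLp (h : IsTest f) (p : ℝ≥0∞) : MemLp f p (vol n) :=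
  h.1.continuous.memLp_of_hasCompactSupport h.2

theorem IsTest.integrable (h : IsTest f) : Integrable f (vol n) :=
  h.1.continuous.integrable_of_hasCompactSupport h.2

theorem IsTest.bounded (h : IsTest f) : ∃ C, ∀ x, ‖f x‖ ≤ C :=
  h.1.continuous.bounded_above_of_compact_support h.2

/-- Integration by parts against a bump function that is 1 near the support of f: the bump is
invisible in one integral and its derivative kills the other. -/
theorem integral_fderiv_eq_zero (h : ContDiff ℝ 1 f) (hc : HasCompactSupport f) (v : H n) :
    ∫ x, fderiv ℝ f x v ∂(vol n) = 0 := by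
  obtain ⟨b, hb1, hbc, hb⟩ : ∃ b : H n → ℂ, ContDiff ℝ 1 b ∧ HasCompactSupport b ∧
      ∀ x ∈ tsupport f, b =ᶠ[𝓝 x] fun _ => 1 := by
    obtain ⟨R, hR⟩ := hc.isCompact.isBounded.subset_ball (0 : H n)
    let B : ContDiffBump (0 : H n) := ⟨|R| + 1, |R| + 2, by positivity, by linarith⟩
    refine ⟨fun x => (B x : ℂ), Complex.ofRealCLM.contDiff.comp B.contDiff,
      B.hasCompactSupport.comp_left (g := fun r : ℝ => (r : ℂ)) (by simp), fun x hx => ?_⟩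
    have hx' : x ∈ Metric.ball (0 : H n) (|R| + 1) :=
      Metric.ball_subset_ball (by linarith [le_abs_self R]) (hR hx)
    filter_upwards [Metric.isOpen_ball.mem_nhds hx'] with y hy
    rw [B.one_of_mem_closedBall (Metric.ball_subset_closedBall hy)]
    simp
  have hd : Continuous (fun x => fderiv ℝ f x v) :=
    (h.continuous_fderiv (by simp)).clm_apply continuous_const
  have hdb : Continuous (fun x => fderiv ℝ b x v) :=
    (hb1.continuous_fderiv (by simp)).clm_apply continuous_const
  have key := integral_mul_fderiv_eq_neg_fderiv_mul_of_integrable (μ := vol n) (f := b) (g := f)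
    (v := v) ((hdb.mul h.continuous).integrable_of_hasCompactSupport hc.mul_left)
    ((hb1.continuous.mul hd).integrable_of_hasCompactSupport hbc.mul_right)
    ((hb1.continuous.mul h.continuous).integrable_of_hasCompactSupport hc.mul_left)
    (fun x _ => hb1.differentiable (by simp) x) (fun x _ => h.differentiable (by simp) x)
  have e1 : ∀ x, b x * fderiv ℝ f x v = fderiv ℝ f x v := by
    intro x
    by_cases hx : x ∈ tsupport f
    · rw [(hb x hx).eq_of_nhds, one_mul]
    · have : fderiv ℝ f x = 0 := by
        by_contra h
        exact hx (support_fderiv_subset ℝ h)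
      simp [this]
  have e2 : ∀ x, fderiv ℝ b x v * f x = 0 := by
    intro x
    by_cases hx : x ∈ tsupport f
    · rw [(hb x hx).fderiv_eq]
      simp
    · simp [image_eq_zero_of_notMem_tsupport hx]
  simp only [e1, e2, integral_zero, neg_zero] at key
  exact key

theorem integral_W_eq_zero (lam : Fin n → ℝ) (τ : ℝ) (j : Fin n) (h : ContDiff ℝ 1 f)
    (hc : HasCompactSupport f) : ∫ x, W lam τ j f x ∂(vol n) = 0 := by
  have hd : Continuous (fderiv ℝ f) := h.continuous_fderiv (by simp)
  have hi : ∀ (v : H n) (φ : H n → ℂ), Continuous φ →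
      Integrable (fun x => φ x * fderiv ℝ f x v) (vol n) := fun v φ hφ =>
    (hφ.mul (hd.clm_apply continuous_const)).integrable_of_hasCompactSupport
      (hc.fderiv_apply (𝕜 := ℝ) v).mul_left
  let A : H n →L[ℝ] ℂ := Complex.ofRealCLM.comp (Complex.reCLM.comp
    ((ContinuousLinearMap.proj j).comp (ContinuousLinearMap.fst ℝ (Fin n → ℂ) ℝ)))
  let B : H n →L[ℝ] ℂ := Complex.ofRealCLM.comp (Complex.imCLM.comp
    ((ContinuousLinearMap.proj j).comp (ContinuousLinearMap.fst ℝ (Fin n → ℂ) ℝ)))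
  let p : H n → ℂ := fun x => A x + Complex.I * τ * B x
  have hp : ContDiff ℝ 1 p := A.contDiff.add (contDiff_const.mul B.contDiff)
  -- The coefficient of ∂/∂t depends on z only, so the field is divergence free.
  have hpt : ∀ x, p x * fderiv ℝ f x (0, 1) = fderiv ℝ (fun y => p y * f y) x (0, 1) := by
    intro x
    have hp0 : fderiv ℝ p x (0, 1) = 0 := by
      have hl : HasFDerivAt p (A + (Complex.I * τ) • B) x :=
        A.hasFDerivAt.fun_add (B.hasFDerivAt.const_mul _)
      rw [hl.fderiv]
      simp [A, B]
    rw [fderiv_fun_mul (hp.differentiable (by simp) x) (h.differentiable (by simp) x)]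
    simp [hp0]
  have hz : ∫ x, p x * fderiv ℝ f x (0, 1) ∂(vol n) = 0 := by
    simp_rw [hpt]
    exact integral_fderiv_eq_zero (hp.mul h) hc.mul_left _
  have h1 := integral_fderiv_eq_zero h hc (Pi.single j 1, 0)
  have h2 := integral_fderiv_eq_zero h hc (Pi.single j Complex.I, 0)
  have hi1 := hi (Pi.single j 1, 0) (fun _ => (1 / 2 : ℂ)) continuous_const
  have hi2 := hi (Pi.single j Complex.I, 0) (fun _ => (1 / 2 : ℂ) * (Complex.I * τ))
    continuous_const
  have hi3 : Integrable (fun x => (Complex.I * τ * lam j) * (p x * fderiv ℝ f x (0, 1)))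
      (vol n) := (hi (0, 1) p hp.continuous).const_mul _
  have hW : W lam τ j f = fun x => ((1 / 2 : ℂ) * fderiv ℝ f x (Pi.single j 1, 0) +
      (1 / 2 : ℂ) * (Complex.I * τ) * fderiv ℝ f x (Pi.single j Complex.I, 0)) +
      (Complex.I * τ * lam j) * (p x * fderiv ℝ f x (0, 1)) := by
    funext x
    simp only [W, wsym, p, A, B, ContinuousLinearMap.comp_apply, Complex.ofRealCLM_apply,
      Complex.reCLM_apply, Complex.imCLM_apply, ContinuousLinearMap.proj_apply,
      ContinuousLinearMap.coe_fst']
    ring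
  have hi12 : Integrable (fun x => (1 / 2 : ℂ) * fderiv ℝ f x (Pi.single j 1, 0) +
      (1 / 2 : ℂ) * (Complex.I * τ) * fderiv ℝ f x (Pi.single j Complex.I, 0)) (vol n) :=
    hi1.add hi2
  rw [hW]
  beta_reduce
  rw [integral_add hi12 hi3, integral_add hi1 hi2, integral_const_mul,
    integral_const_mul, integral_const_mul, hz, h1, h2]
  simp

/-- Integration by parts: the transpose of `W` is `-W`. -/
theorem integral_W_mul (lam : Fin n → ℝ) (τ : ℝ) (j : Fin n) (hf : IsTest f)
    (hg : ContDiff ℝ ∞ g) :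
    ∫ x, W lam τ j f x * g x ∂(vol n) = -∫ x, f x * W lam τ j g x ∂(vol n) := by
  have h := integral_W_eq_zero lam τ j ((hf.mul_right hg).1.of_le (by exact_mod_cast le_top))
    (hf.mul_right hg).2
  have hW : W lam τ j (fun x => f x * g x) = fun x => f x * W lam τ j g x + W lam τ j f x * g x := by
    funext x
    rw [W_mul (hf.1.differentiable (by simp) x) (hg.differentiable (by simp) x)]
    ring
  rw [hW, integral_add (hf.mul_right (contDiff_W lam τ j hg)).integrable
    ((hf.W lam τ j).mul_right hg).integrable] at h
  linear_combination h

theorem integral_Dt_mul (hf : IsTest f) (hg : ContDiff ℝ ∞ g) :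
    ∫ x, Dt f x * g x ∂(vol n) = -∫ x, f x * Dt g x ∂(vol n) := by
  have h := integral_fderiv_eq_zero ((hf.mul_right hg).1.of_le (by exact_mod_cast le_top))
    (hf.mul_right hg).2 (0, 1)
  have hW : (fun x => fderiv ℝ (fun x => f x * g x) x (0, 1)) =
      fun x => f x * Dt g x + Dt f x * g x := by
    funext x
    have := Dt_mul (hf.1.differentiable (by simp) x) (hg.differentiable (by simp) x)
    rw [Dt] at this
    rw [this]
    ring
  rw [hW, integral_add (hf.mul_right (contDiff_Dt hg)).integrable
    (hf.Dt.mul_right hg).integrable] at h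
  linear_combination h

end Test

/-! ### The Heisenberg group law and its invariant measure -/

section Group

/-- The linear functional `z ↦ 2 ∑ λ_j Im (conj w_j z_j)`. -/
noncomputable def twist (lam : Fin n → ℝ) (w : Fin n → ℂ) : (Fin n → ℂ) →L[ℝ] ℝ :=
  ∑ j, (2 * lam j) • ((w j).re • Complex.imCLM.comp (ContinuousLinearMap.proj j) -
    (w j).im • Complex.reCLM.comp (ContinuousLinearMap.proj j))

theorem twist_apply (lam : Fin n → ℝ) (w z : Fin n → ℂ) :
    twist lam w z = ∑ j, 2 * lam j * ((w j).re * (z j).im - (w j).im * (z j).re) := by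
  simp [twist]

theorem twist_self (lam : Fin n → ℝ) (w : Fin n → ℂ) : twist lam w w = 0 := by
  rw [twist_apply]
  exact Finset.sum_eq_zero fun j _ => by ring

theorem twist_add_left (lam : Fin n → ℝ) (w w' z : Fin n → ℂ) :
    twist lam (w + w') z = twist lam w z + twist lam w' z := by
  simp only [twist_apply, ← Finset.sum_add_distrib]
  exact Finset.sum_congr rfl fun j _ => by simp; ring

theorem twist_neg_left (lam : Fin n → ℝ) (w z : Fin n → ℂ) :
    twist lam (-w) z = -twist lam w z := by
  simp only [twist_apply, ← Finset.sum_neg_distrib]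
  exact Finset.sum_congr rfl fun j _ => by simp; ring

/-- The group law of `H_{n+1}` for which the vector fields `Z_j` are left invariant. The inverse
of `x` is `-x`. -/
noncomputable def gmul (lam : Fin n → ℝ) (x y : H n) : H n :=
  (x.1 + y.1, x.2 + y.2 + twist lam x.1 y.1)

variable {lam : Fin n → ℝ}

theorem gmul_assoc (x y z : H n) : gmul lam (gmul lam x y) z = gmul lam x (gmul lam y z) := by
  simp only [gmul, twist_add_left, map_add, Prod.mk.injEq]
  exact ⟨add_assoc _ _ _, by ring⟩

theorem gmul_zero (x : H n) : gmul lam x 0 = x := by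
  simp [gmul]

theorem zero_gmul (x : H n) : gmul lam 0 x = x := by
  simp [gmul, twist_apply]

theorem gmul_neg_self (x : H n) : gmul lam x (-x) = 0 := by
  simp [gmul, twist_self]

theorem neg_gmul_self (x : H n) : gmul lam (-x) x = 0 := by
  simp [gmul, twist_self, twist_neg_left]

theorem neg_gmul_gmul (x y : H n) : gmul lam (-x) (gmul lam x y) = y := by
  rw [← gmul_assoc, neg_gmul_self, zero_gmul]

theorem gmul_neg_gmul (x y : H n) : gmul lam x (gmul lam (-x) y) = y := by
  rw [← gmul_assoc, gmul_neg_self, zero_gmul]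

theorem gmul_gmul_neg (x y : H n) : gmul lam (gmul lam x y) (-y) = x := by
  rw [gmul_assoc, gmul_neg_self, gmul_zero]

theorem neg_gmul (x y : H n) : -gmul lam x y = gmul lam (-y) (-x) := by
  have h : twist lam x.1 y.1 = -twist lam y.1 x.1 := by
    simp only [twist_apply, ← Finset.sum_neg_distrib]
    exact Finset.sum_congr rfl fun j _ => by ring
  simp only [gmul, Prod.fst_neg, Prod.snd_neg, map_neg, twist_neg_left, h, Prod.neg_mk,
    Prod.mk.injEq]
  exact ⟨by abel, by ring⟩

theorem contDiff_gmul {m : WithTop ℕ∞} : ContDiff ℝ m (fun p : H n × H n => gmul lam p.1 p.2) := by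
  have hre : ∀ j, ContDiff ℝ m (fun z : Fin n → ℂ => (z j).re) := fun j =>
    (Complex.reCLM.comp (ContinuousLinearMap.proj (R := ℝ) (φ := fun _ : Fin n => ℂ) j)).contDiff
  have him : ∀ j, ContDiff ℝ m (fun z : Fin n → ℂ => (z j).im) := fun j =>
    (Complex.imCLM.comp (ContinuousLinearMap.proj (R := ℝ) (φ := fun _ : Fin n => ℂ) j)).contDiff
  have h11 : ContDiff ℝ m (fun p : H n × H n => p.1.1) := contDiff_fst.comp contDiff_fst
  have h21 : ContDiff ℝ m (fun p : H n × H n => p.2.1) := contDiff_fst.comp contDiff_snd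
  have h12 : ContDiff ℝ m (fun p : H n × H n => p.1.2) := contDiff_snd.comp contDiff_fst
  have h22 : ContDiff ℝ m (fun p : H n × H n => p.2.2) := contDiff_snd.comp contDiff_snd
  unfold gmul
  simp only [twist_apply]
  refine (h11.add h21).prodMk ((h12.add h22).add (ContDiff.sum fun j _ => ?_))
  exact contDiff_const.mul ((((hre j).comp h11).mul ((him j).comp h21)).sub
    (((him j).comp h11).mul ((hre j).comp h21)))

theorem ContDiff.gmul {E : Type*} [NormedAddCommGroup E] [NormedSpace ℝ E] {m : WithTop ℕ∞}
    {a b : E → H n} (ha : ContDiff ℝ m a) (hb : ContDiff ℝ m b) :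
    ContDiff ℝ m (fun e => gmul lam (a e) (b e)) :=
  contDiff_gmul.comp (ha.prodMk hb)

theorem Continuous.gmul {E : Type*} [TopologicalSpace E] {a b : E → H n} (ha : Continuous a)
    (hb : Continuous b) : Continuous (fun e => gmul lam (a e) (b e)) :=
  (contDiff_gmul (m := 0)).continuous.comp (ha.prodMk hb)

theorem hasFDerivAt_gmul_left (g x : H n) :
    HasFDerivAt (fun y => gmul lam g y)
      ((ContinuousLinearMap.fst ℝ (Fin n → ℂ) ℝ).prod (ContinuousLinearMap.snd ℝ (Fin n → ℂ) ℝ +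
        (twist lam g.1).comp (ContinuousLinearMap.fst ℝ (Fin n → ℂ) ℝ))) x := by
  unfold gmul
  refine HasFDerivAt.prodMk ?_ ?_
  · exact (ContinuousLinearMap.hasFDerivAt (ContinuousLinearMap.fst ℝ (Fin n → ℂ) ℝ)).const_add _
  · exact ((ContinuousLinearMap.hasFDerivAt
      (ContinuousLinearMap.snd ℝ (Fin n → ℂ) ℝ)).const_add _).fun_add
      (ContinuousLinearMap.hasFDerivAt ((twist lam g.1).comp
      (ContinuousLinearMap.fst ℝ (Fin n → ℂ) ℝ)))

/-- The derivative of the twist along z_j compensates the change of the coefficient of ∂/∂t under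
translation. That coefficient contains τ² Im z_j, which is why τ² = 1 is required. -/
theorem W_gmul_left {τ : ℝ} (hτ : τ ^ 2 = 1) (j : Fin n) {f : H n → ℂ} (g x : H n)
    (hf : DifferentiableAt ℝ f (gmul lam g x)) :
    W lam τ j (fun y => f (gmul lam g y)) x = W lam τ j f (gmul lam g x) := by
  have hd := hasFDerivAt_gmul_left (lam := lam) g x
  have hc := (hf.hasFDerivAt.comp x hd).fderiv
  have hc' : fderiv ℝ (fun y => f (gmul lam g y)) x = _ := hc
  have hL : ∀ (L : H n →L[ℝ] ℂ) (z : Fin n → ℂ) (t : ℝ), L (z, t) = L (z, 0) + t * L (0, 1) := by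
    intro L z t
    have : ((z, t) : H n) = (z, 0) + t • (0, 1) := by simp
    rw [this, map_add, map_smul, Complex.real_smul]
  have t1 : twist lam g.1 (Pi.single j 1) = -(2 * lam j * (g.1 j).im) := by
    rw [twist_apply, Finset.sum_eq_single j]
    · simp
    · intro b _ hb; simp [hb]
    · simp
  have t2 : twist lam g.1 (Pi.single j Complex.I) = 2 * lam j * (g.1 j).re := by
    rw [twist_apply, Finset.sum_eq_single j]
    · simp
    · intro b _ hb; simp [hb]
    · simp
  have hτ' : (τ : ℂ) ^ 2 = 1 := by exact_mod_cast hτ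
  simp only [W, wsym, hc', ContinuousLinearMap.comp_apply, ContinuousLinearMap.prod_apply,
    ContinuousLinearMap.coe_fst', ContinuousLinearMap.coe_snd', add_apply, t1, t2, map_zero,
    zero_add, add_zero]
  rw [hL _ (Pi.single j 1), hL _ (Pi.single j Complex.I)]
  simp only [gmul, Pi.add_apply, Complex.add_re, Complex.add_im]
  push_cast
  linear_combination (lam j * fderiv ℝ f (g.1 + x.1, g.2 + x.2 + twist lam g.1 x.1) (0, 1) *
    (g.1 j).im) * (hτ' - (τ : ℂ) ^ 2 * Complex.I_sq)

theorem Dt_gmul_left {f : H n → ℂ} (g x : H n) (hf : DifferentiableAt ℝ f (gmul lam g x)) :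
    Dt (fun y => f (gmul lam g y)) x = Dt f (gmul lam g x) := by
  have hd := hasFDerivAt_gmul_left (lam := lam) g x
  have hc' : fderiv ℝ (fun y => f (gmul lam g y)) x = _ := (hf.hasFDerivAt.comp x hd).fderiv
  simp [Dt, hc']

/-- Translations of the group, on either side, are additive translations composed with such shears;
hence Lebesgue measure is bi-invariant. -/
theorem measurePreserving_shear {ℓ : (Fin n → ℂ) → ℝ} (hℓ : Continuous ℓ) :
    MeasurePreserving (fun x : H n => (x.1, x.2 + ℓ x.1)) (vol n) (vol n) := by
  have h : MeasurePreserving (fun x : H n => (x.1, x.2 + ℓ x.1))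
      ((volume : Measure (Fin n → ℂ)).prod (volume : Measure ℝ))
      ((volume : Measure (Fin n → ℂ)).prod (volume : Measure ℝ)) := by
    refine (MeasurePreserving.id (volume : Measure (Fin n → ℂ))).skew_product
      (g := fun z t => t + ℓ z) ?_ ?_
    · exact (measurable_snd.add (hℓ.measurable.comp measurable_fst))
    · exact Eventually.of_forall fun z => (measurePreserving_add_right volume (ℓ z)).map_eq
  exact h.smul_measure _

theorem measurePreserving_gmul_left (g : H n) :
    MeasurePreserving (gmul lam g) (vol n) (vol n) := by
  have h := (measurePreserving_add_left (vol n) g).comp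
    (measurePreserving_shear (n := n) (twist lam g.1).continuous)
  convert h using 1
  funext x
  simp only [gmul, Function.comp, Prod.ext_iff, Prod.fst_add, Prod.snd_add]
  exact ⟨trivial, by ring⟩

theorem measurePreserving_gmul_right (g : H n) :
    MeasurePreserving (fun x => gmul lam x g) (vol n) (vol n) := by
  have hc : Continuous (fun z => twist lam z g.1) := by
    simp only [twist_apply]
    fun_prop
  have h := (measurePreserving_add_right (vol n) g).comp (measurePreserving_shear (n := n) hc)
  convert h using 1
  funext x
  simp only [gmul, Function.comp, Prod.ext_iff, Prod.fst_add, Prod.snd_add]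
  exact ⟨trivial, by ring⟩

theorem measurableEmbedding_gmul_left (g : H n) : MeasurableEmbedding (gmul lam g) :=
  (⟨⟨gmul lam g, gmul lam (-g), neg_gmul_gmul g, gmul_neg_gmul g⟩,
    Continuous.gmul continuous_const continuous_id,
    Continuous.gmul continuous_const continuous_id⟩ : H n ≃ₜ H n).measurableEmbedding

theorem measurableEmbedding_gmul_right (g : H n) : MeasurableEmbedding (fun x => gmul lam x g) :=
  (⟨⟨fun x => gmul lam x g, fun x => gmul lam x (-g), fun x => gmul_gmul_neg x g, fun x => by
    simpa using gmul_gmul_neg x (-g)⟩,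
    Continuous.gmul continuous_id continuous_const,
    Continuous.gmul continuous_id continuous_const⟩ : H n ≃ₜ H n).measurableEmbedding

theorem integral_gmul_left {E : Type*} [NormedAddCommGroup E] [NormedSpace ℝ E] (g : H n)
    (F : H n → E) : ∫ x, F (gmul lam g x) ∂(vol n) = ∫ x, F x ∂(vol n) :=
  (measurePreserving_gmul_left g).integral_comp (measurableEmbedding_gmul_left g) F

theorem integral_gmul_right {E : Type*} [NormedAddCommGroup E] [NormedSpace ℝ E] (g : H n)
    (F : H n → E) : ∫ x, F (gmul lam x g) ∂(vol n) = ∫ x, F x ∂(vol n) :=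
  (measurePreserving_gmul_right g).integral_comp (measurableEmbedding_gmul_right g) F

theorem IsTest.gmul_left {f : H n → ℂ} (h : IsTest f) (g : H n) :
    IsTest (fun x => f (gmul lam g x)) := by
  refine ⟨h.1.comp (ContDiff.gmul contDiff_const contDiff_id), ?_⟩
  exact h.2.comp_homeomorph (⟨⟨gmul lam g, gmul lam (-g), neg_gmul_gmul g, gmul_neg_gmul g⟩,
    Continuous.gmul continuous_const continuous_id,
    Continuous.gmul continuous_const continuous_id⟩ : H n ≃ₜ H n)

end Group

end Heisenberg

namespace Heisenberg

variable {n : ℕ}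

/-! ### Smoothness of integrals depending on a parameter -/

section Smoothing

/-- The integral is an additive convolution, with the second factor depending on a parameter,
evaluated at 0. Locally in the parameter the supports lie in one compact set. -/
theorem contDiff_integral_mul {k : H n → ℂ} (hk : LocallyIntegrable k (vol n))
    {G : H n × H n → ℂ} (hG : ContDiff ℝ ∞ G)
    (hs : ∀ R : ℝ, ∃ K : Set (H n), IsCompact K ∧ ∀ x, ‖x‖ < R → ∀ y, y ∉ K → G (x, y) = 0) :
    ContDiff ℝ ∞ (fun x => ∫ y, k y * G (x, y) ∂(vol n)) := by
  rw [contDiff_iff_contDiffAt]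
  intro x₀
  obtain ⟨K, hK, hKG⟩ := hs (‖x₀‖ + 1)
  have h := contDiffOn_convolution_right_with_param (μ := vol n) (n := ⊤) (𝕜 := ℝ) (f := k)
    (ContinuousLinearMap.mul ℝ ℂ) (g := fun p s => G (p, -s))
    (s := Metric.ball 0 (‖x₀‖ + 1)) Metric.isOpen_ball hK.neg
    (fun p x hp hx => hKG p (by simpa using hp) _ (by simpa using hx)) hk
    (hG.comp (contDiff_fst.prodMk contDiff_snd.neg)).contDiffOn
  have h2 := h.comp (t := Metric.ball 0 (‖x₀‖ + 1) ×ˢ Set.univ) (s := Metric.ball 0 (‖x₀‖ + 1))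
    (f := fun x : H n => (x, (0 : H n)))
    (contDiff_id.prodMk contDiff_const).contDiffOn (fun x hx => ⟨hx, trivial⟩)
  have h3 : ((fun q : H n × H n => convolution k (fun s => G (q.1, -s))
      (ContinuousLinearMap.mul ℝ ℂ) (vol n) q.2) ∘ fun x => (x, (0 : H n))) =
      fun x => ∫ y, k y * G (x, y) ∂(vol n) := by
    funext x
    simp [convolution]
  rw [h3] at h2
  exact h2.contDiffAt (Metric.isOpen_ball.mem_nhds (by simp))

variable {lam : Fin n → ℝ}

theorem contDiff_integral_gmul {k : H n → ℂ} (hk : LocallyIntegrable k (vol n))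
    {f : H n → ℂ} (hf : IsTest f) :
    ContDiff ℝ ∞ (fun x => ∫ y, k y * f (gmul lam x y) ∂(vol n)) := by
  refine contDiff_integral_mul hk (G := fun p => f (gmul lam p.1 p.2))
    (hf.1.comp contDiff_gmul) fun R => ?_
  refine ⟨(fun p : H n × H n => gmul lam (-p.1) p.2) '' (Metric.closedBall 0 R ×ˢ tsupport f),
    ((isCompact_closedBall _ _).prod hf.2.isCompact).image
      (Continuous.gmul continuous_fst.neg continuous_snd), fun x hx y hy => ?_⟩
  by_contra h
  exact hy ⟨(x, gmul lam x y), ⟨by simpa using hx.le, subset_tsupport _ h⟩,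
    neg_gmul_gmul x y⟩

theorem contDiff_integral_gmul_neg {k : H n → ℂ} (hk : LocallyIntegrable k (vol n))
    {f : H n → ℂ} (hf : IsTest f) :
    ContDiff ℝ ∞ (fun x => ∫ y, k y * f (gmul lam y (-x)) ∂(vol n)) := by
  refine contDiff_integral_mul hk (G := fun p => f (gmul lam p.2 (-p.1)))
    (hf.1.comp (ContDiff.gmul contDiff_snd contDiff_fst.neg)) fun R => ?_
  refine ⟨(fun p : H n × H n => gmul lam p.2 p.1) '' (Metric.closedBall 0 R ×ˢ tsupport f),
    ((isCompact_closedBall _ _).prod hf.2.isCompact).image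
      (Continuous.gmul continuous_snd continuous_fst), fun x hx y hy => ?_⟩
  by_contra h
  refine hy ⟨(x, gmul lam y (-x)), ⟨by simpa using hx.le, subset_tsupport _ h⟩, ?_⟩
  simpa using gmul_gmul_neg y (-x)

end Smoothing

/-! ### Anisotropic dilations and cutoff functions -/

section Cutoff

/-- The dilation `(z, t) ↦ (r z, r² t)`. -/
noncomputable def dil (r : ℝ) : H n →L[ℝ] H n :=
  (r • ContinuousLinearMap.fst ℝ (Fin n → ℂ) ℝ).prod
    (r ^ 2 • ContinuousLinearMap.snd ℝ (Fin n → ℂ) ℝ)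

theorem dil_apply (r : ℝ) (x : H n) : dil r x = (r • x.1, r ^ 2 * x.2) := by
  simp [dil]

/-- The fields are homogeneous of degree one: the coefficient of ∂/∂t is linear in z, which fits the
weight two of t. -/
theorem W_dil (lam : Fin n → ℝ) (τ : ℝ) (j : Fin n) {f : H n → ℂ} (r : ℝ) (x : H n)
    (hf : DifferentiableAt ℝ f (dil r x)) :
    W lam τ j (fun y => f (dil r y)) x = r * W lam τ j f (dil r x) := by
  have hc : fderiv ℝ (fun y => f (dil r y)) x = (fderiv ℝ f (dil r x)).comp (dil r) :=
    (hf.hasFDerivAt.comp x (dil r).hasFDerivAt).fderiv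
  have e1 : ∀ z : Fin n → ℂ, dil r (z, 0) = r • ((z, 0) : H n) := by
    intro z; simp [dil_apply]
  have e2 : dil r ((0, 1) : H n) = (r ^ 2) • ((0, 1) : H n) := by
    simp [dil_apply]
  simp only [W, wsym, hc, ContinuousLinearMap.comp_apply, e1, e2, map_smul, Complex.real_smul]
  simp only [dil_apply, Pi.smul_apply, Complex.real_smul, Complex.re_ofReal_mul,
    Complex.im_ofReal_mul]
  push_cast
  ring

/-- A cutoff function on `H_{n+1}`. -/
noncomputable def bump : ContDiffBump (0 : H n) := ⟨1, 2, one_pos, one_lt_two⟩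

/-- The dilated cutoff functions. -/
noncomputable def cut (m : ℕ) (x : H n) : ℂ := (bump (dil (1 / ((m : ℝ) + 1)) x) : ℝ)

theorem isTest_bump : IsTest (fun x : H n => ((bump x : ℝ) : ℂ)) :=
  ⟨Complex.ofRealCLM.contDiff.comp bump.contDiff,
    bump.hasCompactSupport.comp_left (g := fun r : ℝ => (r : ℂ)) (by simp)⟩

theorem isTest_cut (m : ℕ) : IsTest (cut m : H n → ℂ) := by
  refine ⟨isTest_bump.1.comp (dil _).contDiff, ?_⟩
  have hr : (1 / ((m : ℝ) + 1)) ≠ 0 := by positivity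
  have hinj : ∀ (r : ℝ), r ≠ 0 → ∀ x : H n, dil r⁻¹ (dil r x) = x := by
    intro r hr x
    ext1
    · simp [dil_apply, smul_smul, inv_mul_cancel₀ hr]
    · simp only [dil_apply]
      field_simp
  exact isTest_bump.2.comp_homeomorph (⟨⟨dil (1 / ((m : ℝ) + 1)), dil (1 / ((m : ℝ) + 1))⁻¹,
    hinj _ hr, fun x => by simpa using hinj _ (inv_ne_zero hr) x⟩, (dil _).continuous,
    (dil _).continuous⟩ : H n ≃ₜ H n)

theorem norm_cut_le (m : ℕ) (x : H n) : ‖cut m x‖ ≤ 1 := by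
  rw [cut, Complex.norm_real, Real.norm_of_nonneg bump.nonneg]
  exact bump.le_one

theorem tendsto_inv_nat : Tendsto (fun m : ℕ => 1 / ((m : ℝ) + 1)) atTop (𝓝 0) :=
  tendsto_one_div_add_atTop_nhds_zero_nat

theorem tendsto_cut (x : H n) : Tendsto (fun m => cut m x) atTop (𝓝 1) := by
  have h : Tendsto (fun m : ℕ => dil (1 / ((m : ℝ) + 1)) x) atTop (𝓝 (0 : H n)) := by
    simp only [dil_apply]
    have h1 : Tendsto (fun m : ℕ => (1 / ((m : ℝ) + 1)) • x.1) atTop (𝓝 0) := by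
      simpa using tendsto_inv_nat.smul_const x.1
    have h2 : Tendsto (fun m : ℕ => (1 / ((m : ℝ) + 1)) ^ 2 * x.2) atTop (𝓝 0) := by
      simpa using (tendsto_inv_nat.pow 2).mul_const x.2
    exact h1.prodMk_nhds h2
  have h2 := (isTest_bump (n := n)).1.continuous.tendsto 0 |>.comp h
  simpa [cut, Function.comp_def, bump.one_of_mem_closedBall
    (Metric.mem_closedBall_self (by simp [bump]) : (0 : H n) ∈ _)] using h2

theorem W_cut (lam : Fin n → ℝ) (τ : ℝ) (j : Fin n) (m : ℕ) (x : H n) :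
    W lam τ j (cut m) x = ((1 / ((m : ℝ) + 1) : ℝ) : ℂ) *
      W lam τ j (fun x : H n => ((bump x : ℝ) : ℂ)) (dil (1 / ((m : ℝ) + 1)) x) :=
  W_dil lam τ j (f := fun x : H n => ((bump x : ℝ) : ℂ)) _ x
    (isTest_bump.1.differentiable (by simp) _)

/-- The decay comes from homogeneity. Isotropic scaling would give only a bounded derivative, since
the coefficient of ∂/∂t grows with z. -/
theorem exists_norm_W_cut_le (lam : Fin n → ℝ) (τ : ℝ) (j : Fin n) :
    ∃ C, 0 ≤ C ∧ ∀ (m : ℕ) (x : H n), ‖W lam τ j (cut m) x‖ ≤ C / ((m : ℝ) + 1) := by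
  obtain ⟨C, hC⟩ := (isTest_bump.W lam τ j).bounded
  refine ⟨C, (norm_nonneg _).trans (hC 0), fun m x => ?_⟩
  rw [W_cut, norm_mul, Complex.norm_real, Real.norm_of_nonneg (by positivity), div_mul_eq_mul_div,
    one_mul]
  have := hC (dil (1 / ((m : ℝ) + 1)) x)
  gcongr

end Cutoff

/-! ### Weak solutions -/

section Weak

/-- The distributional equation `W k = 0`. -/
def WeakNull (lam : Fin n → ℝ) (τ : ℝ) (j : Fin n) (k : H n → ℂ) : Prop :=
  ∀ χ, IsTest χ → ∫ x, k x * W lam τ j χ x ∂(vol n) = 0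

variable {lam : Fin n → ℝ} {τ : ℝ} {j : Fin n}

theorem weakNull_of_forall_eq_zero {k : H n → ℂ} (hk : ContDiff ℝ ∞ k)
    (h : ∀ x, W lam τ j k x = 0) : WeakNull lam τ j k := by
  intro χ hχ
  have h1 := integral_W_mul lam τ j hχ hk
  simp only [h, mul_zero, integral_zero, neg_zero] at h1
  rw [← h1]
  exact integral_congr_ae (Eventually.of_forall fun x => mul_comm _ _)

/-- A weak equation can be tested against square integrable smooth functions. -/
theorem WeakNull.integral_eq_zero {k h : H n → ℂ} (hw : WeakNull lam τ j k)
    (hk : MemLp k 2 (vol n)) (hh : ContDiff ℝ ∞ h) (hh2 : MemLp h 2 (vol n))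
    (hW : MemLp (W lam τ j h) 2 (vol n)) : ∫ x, k x * W lam τ j h x ∂(vol n) = 0 := by
  obtain ⟨C, hC0, hC⟩ := exists_norm_W_cut_le lam τ j
  have hi1 : Integrable (fun x => k x * W lam τ j h x) (vol n) := hk.integrable_mul hW
  have hi2 : Integrable (fun x => k x * h x) (vol n) := hk.integrable_mul hh2
  have hF : ∀ m : ℕ, ∫ x, k x * (cut m x * W lam τ j h x + h x * W lam τ j (cut m) x) ∂(vol n)
      = 0 := by
    intro m
    rw [← hw _ ((isTest_cut m).mul_right hh)]
    refine integral_congr_ae (Eventually.of_forall fun x => ?_)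
    beta_reduce
    rw [W_mul ((isTest_cut m).1.differentiable (by simp) x) (hh.differentiable (by simp) x)]
  -- Truncating h produces an extra term bounded by C |k h| / (m + 1), and k h is integrable; this
  -- gives both the majorant and the limit.
  have hlim := tendsto_integral_of_dominated_convergence (μ := vol n)
    (F := fun (m : ℕ) x => k x * (cut m x * W lam τ j h x + h x * W lam τ j (cut m) x))
    (f := fun x => k x * W lam τ j h x)
    (fun x => ‖k x * W lam τ j h x‖ + C * ‖k x * h x‖) (fun m => by
      exact hk.1.mul ((((isTest_cut m).1.continuous.mul (continuous_W lam τ j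
        (hh.of_le (by exact_mod_cast le_top)))).add (hh.continuous.mul
        ((isTest_cut m).W lam τ j).1.continuous)).aestronglyMeasurable))
    (hi1.norm.add (hi2.norm.const_mul C)) (fun m => Eventually.of_forall fun x => by
      rw [mul_add]
      refine (norm_add_le _ _).trans (add_le_add ?_ ?_)
      · rw [← mul_assoc, mul_comm (k x), mul_assoc, norm_mul]
        exact mul_le_of_le_one_left (norm_nonneg _) (norm_cut_le m x)
      · rw [← mul_assoc, mul_comm, norm_mul]
        refine mul_le_mul_of_nonneg_right ((hC m x).trans ?_) (norm_nonneg _)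
        exact div_le_self hC0 (by linarith [(Nat.cast_nonneg m : (0 : ℝ) ≤ m)]))
    (Eventually.of_forall fun x => by
      have h0 : Tendsto (fun m : ℕ => W lam τ j (cut m) x) atTop (𝓝 0) := by
        refine squeeze_zero_norm (fun m => hC m x) ?_
        have := tendsto_inv_nat.const_mul C
        simpa [div_eq_mul_inv] using this
      have h1 := (((tendsto_cut x).mul_const (W lam τ j h x)).add
        (h0.const_mul (h x))).const_mul (k x)
      simpa using h1)
  simp only [hF] at hlim
  exact (tendsto_nhds_unique hlim tendsto_const_nhds)

theorem ae_eq_zero_of_forall_test {k : H n → ℂ} (hk : LocallyIntegrable k (vol n))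
    (h : ∀ χ, IsTest χ → ∫ x, k x * χ x ∂(vol n) = 0) : ∀ᵐ x ∂(vol n), k x = 0 := by
  refine ae_eq_zero_of_integral_contDiff_smul_eq_zero hk fun g hg hgc => ?_
  have hg' : IsTest (fun x => (g x : ℂ)) :=
    ⟨Complex.ofRealCLM.contDiff.comp hg, hgc.comp_left (g := fun r : ℝ => (r : ℂ)) (by simp)⟩
  rw [← h _ hg']
  refine integral_congr_ae (Eventually.of_forall fun x => ?_)
  simp [mul_comm]

theorem eq_zero_of_forall_test {k : H n → ℂ} (hk : Continuous k)
    (h : ∀ χ, IsTest χ → ∫ x, k x * χ x ∂(vol n) = 0) (x : H n) : k x = 0 := by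
  have h1 : k =ᵐ[vol n] fun _ => 0 := ae_eq_zero_of_forall_test hk.locallyIntegrable h
  exact congrFun (Continuous.ae_eq_iff_eq (vol n) hk continuous_const |>.1 h1) x

end Weak

/-! ### Fubini on the group and left regularization -/

section Fubini

variable {lam : Fin n → ℝ}

theorem MemLp.gmul_left {k : H n → ℂ} (hk : MemLp k 2 (vol n)) (g : H n) :
    MemLp (fun x => k (gmul lam g x)) 2 (vol n) :=
  hk.comp_measurePreserving (measurePreserving_gmul_left g)

theorem integrable_sq_norm {k : H n → ℂ} (hk : MemLp k 2 (vol n)) :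
    Integrable (fun x => ‖k x‖ ^ 2) (vol n) := by
  simpa using hk.integrable_norm_rpow (by simp) (by simp)

theorem integral_norm_mul_le {k d : H n → ℂ} (hk : MemLp k 2 (vol n)) (hd : MemLp d 2 (vol n)) :
    ∫ x, ‖k x * d x‖ ∂(vol n) ≤ ∫ x, ‖k x‖ ^ 2 ∂(vol n) + ∫ x, ‖d x‖ ^ 2 ∂(vol n) := by
  rw [← integral_add (integrable_sq_norm hk) (integrable_sq_norm hd)]
  refine integral_mono (hk.integrable_mul hd).norm
    ((integrable_sq_norm hk).add (integrable_sq_norm hd)) fun x => ?_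
  simp only [norm_mul]
  nlinarith [sq_nonneg (‖k x‖ - ‖d x‖), norm_nonneg (k x), norm_nonneg (d x)]

theorem stronglyMeasurable_comp_gmul {k : H n → ℂ} (hm : StronglyMeasurable k) :
    StronglyMeasurable (fun p : H n × H n => k (gmul lam p.1 p.2)) :=
  hm.comp_measurable (Continuous.gmul continuous_fst continuous_snd).measurable

/-- By left invariance the inner L¹ norm is at most ‖k‖² + ‖d‖², independently of the translation,
so integrability of f suffices. -/
theorem integrable_prod_gmul {f k d : H n → ℂ} (hf : Integrable f (vol n))
    (hk : MemLp k 2 (vol n)) (hkm : StronglyMeasurable k) (hd : MemLp d 2 (vol n)) :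
    Integrable (fun p : H n × H n => f p.1 * (k (gmul lam p.1 p.2) * d p.2))
      ((vol n).prod (vol n)) := by
  have hm : AEStronglyMeasurable (fun p : H n × H n => f p.1 * (k (gmul lam p.1 p.2) * d p.2))
      ((vol n).prod (vol n)) :=
    hf.1.comp_fst.mul ((stronglyMeasurable_comp_gmul hkm).aestronglyMeasurable.mul hd.1.comp_snd)
  rw [integrable_prod_iff hm]
  have hsec : ∀ x, Integrable (fun y => k (gmul lam x y) * d y) (vol n) := fun x =>
    (MemLp.gmul_left hk x).integrable_mul hd
  refine ⟨Eventually.of_forall fun x => (hsec x).const_mul (f x), ?_⟩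
  refine (hf.norm.mul_const (∫ x, ‖k x‖ ^ 2 ∂(vol n) + ∫ x, ‖d x‖ ^ 2 ∂(vol n))).mono'
    hm.norm.integral_prod_right' (Eventually.of_forall fun x => ?_)
  rw [Real.norm_of_nonneg (integral_nonneg fun _ => norm_nonneg _)]
  simp only [norm_mul (f x)]
  rw [integral_const_mul]
  refine mul_le_mul_of_nonneg_left ?_ (norm_nonneg _)
  refine (integral_norm_mul_le (MemLp.gmul_left hk x) hd).trans_eq ?_
  rw [integral_gmul_left x (fun y => ‖k y‖ ^ 2)]

theorem integral_prod_gmul_swap {f k d : H n → ℂ} (hf : Integrable f (vol n))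
    (hk : MemLp k 2 (vol n)) (hkm : StronglyMeasurable k) (hd : MemLp d 2 (vol n)) :
    ∫ x, (∫ g, f g * k (gmul lam g x) ∂(vol n)) * d x ∂(vol n) =
      ∫ g, f g * ∫ x, k (gmul lam g x) * d x ∂(vol n) ∂(vol n) := by
  have h := integral_integral_swap (f := fun g x => f g * (k (gmul lam g x) * d x))
    (integrable_prod_gmul (lam := lam) hf hk hkm hd)
  simp_rw [integral_const_mul] at h
  rw [h]
  refine integral_congr_ae (Eventually.of_forall fun x => ?_)
  beta_reduce
  rw [← integral_mul_const]
  simp_rw [mul_assoc]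

end Fubini

section Regularization

/-- The left convolution of `k` with `ρ`. -/
noncomputable def reg (lam : Fin n → ℝ) (ρ k : H n → ℂ) (x : H n) : ℂ :=
  ∫ g, ρ g * k (gmul lam g x) ∂(vol n)

variable {lam : Fin n → ℝ} {ρ k : H n → ℂ}

/-- Right invariance of the measure moves x from k to the smooth factor ρ. -/
theorem contDiff_reg (hρ : IsTest ρ) (hk : LocallyIntegrable k (vol n)) :
    ContDiff ℝ ∞ (reg lam ρ k) := by
  have h : reg lam ρ k = fun x => ∫ y, k y * ρ (gmul lam y (-x)) ∂(vol n) := by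
    funext x
    rw [← integral_gmul_right (lam := lam) x]
    simp only [gmul_gmul_neg, reg, mul_comm]
  rw [h]
  exact contDiff_integral_gmul_neg hk hρ

/-- Cauchy–Schwarz on the support K of ρ bounds the squared value by ‖ρ‖² ∫_K |k(gx)|² dg; Tonelli
and left invariance then give a finite integral in x. -/
theorem memLp_reg (hρ : IsTest ρ) (hk : MemLp k 2 (vol n)) (hkm : StronglyMeasurable k) :
    MemLp (reg lam ρ k) 2 (vol n) := by
  have hc := contDiff_reg (lam := lam) hρ (hk.locallyIntegrable (by norm_num))
  refine ⟨hc.continuous.aestronglyMeasurable, ?_⟩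
  rw [eLpNorm_lt_top_iff_lintegral_rpow_enorm_lt_top (by simp) (by simp)]
  simp only [ENNReal.toReal_ofNat]
  set K := tsupport ρ
  have hKm : MeasurableSet K := (isClosed_tsupport ρ).measurableSet
  have hmk : Measurable fun p : H n × H n => ‖k (gmul lam p.1 p.2)‖ₑ ^ (2 : ℝ) :=
    (stronglyMeasurable_comp_gmul hkm).measurable.enorm.pow_const _
  have hpt : ∀ x, ‖reg lam ρ k x‖ₑ ^ (2 : ℝ) ≤ (∫⁻ g, ‖ρ g‖ₑ ^ (2 : ℝ) ∂(vol n)) *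
      ∫⁻ g in K, ‖k (gmul lam g x)‖ₑ ^ (2 : ℝ) ∂(vol n) := by
    intro x
    have hkx : Measurable fun g => ‖k (gmul lam g x)‖ₑ :=
      ((stronglyMeasurable_comp_gmul hkm).measurable.comp
        (measurable_id.prodMk measurable_const)).enorm
    have h1 : ‖reg lam ρ k x‖ₑ ≤ ∫⁻ g, ‖ρ g‖ₑ * K.indicator (fun g => ‖k (gmul lam g x)‖ₑ) g
        ∂(vol n) := by
      refine (enorm_integral_le_lintegral_enorm _).trans (lintegral_mono fun g => ?_)
      rw [enorm_mul]
      by_cases hg : g ∈ K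
      · rw [Set.indicator_of_mem hg]
      · rw [image_eq_zero_of_notMem_tsupport hg]
        simp
    have h2 := ENNReal.lintegral_mul_le_Lp_mul_Lq (vol n) (p := 2) (q := 2)
      Real.HolderConjugate.two_two
      (f := fun g => ‖ρ g‖ₑ) (g := K.indicator (fun g => ‖k (gmul lam g x)‖ₑ))
      hρ.1.continuous.enorm.measurable.aemeasurable (hkx.indicator hKm).aemeasurable
    have h3 := ENNReal.rpow_le_rpow (h1.trans h2) (by norm_num : (0 : ℝ) ≤ 2)
    rw [ENNReal.mul_rpow_of_nonneg _ _ (by norm_num), ← ENNReal.rpow_mul, ← ENNReal.rpow_mul]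
      at h3
    rw [show (1 / 2 : ℝ) * 2 = 1 by norm_num, ENNReal.rpow_one, ENNReal.rpow_one] at h3
    refine h3.trans_eq ?_
    congr 1
    rw [← lintegral_indicator hKm]
    refine lintegral_congr fun g => ?_
    by_cases hg : g ∈ K <;> simp [hg]
  refine (lintegral_mono hpt).trans_lt ?_
  rw [lintegral_const_mul _ (hmk.lintegral_prod_left' (μ := (vol n).restrict K)),
    lintegral_lintegral_swap (by
      exact (hmk.comp measurable_swap).aemeasurable)]
  have e : ∀ g : H n, ∫⁻ x, ‖k (gmul lam g x)‖ₑ ^ (2 : ℝ) ∂(vol n) =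
      ∫⁻ x, ‖k x‖ₑ ^ (2 : ℝ) ∂(vol n) := fun g =>
    (measurePreserving_gmul_left g).lintegral_comp_emb (measurableEmbedding_gmul_left g)
      (fun x => ‖k x‖ₑ ^ (2 : ℝ))
  simp_rw [e]
  have f1 := lintegral_rpow_enorm_lt_top_of_eLpNorm_lt_top (by simp) (by simp) (hρ.memLp 2).2
  have f2 := lintegral_rpow_enorm_lt_top_of_eLpNorm_lt_top (by simp) (by simp) hk.2
  simp only [ENNReal.toReal_ofNat] at f1 f2
  refine ENNReal.mul_lt_top f1 ?_
  rw [lintegral_const]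
  refine ENNReal.mul_lt_top f2 ?_
  rw [Measure.restrict_apply_univ]
  exact hρ.2.isCompact.measure_lt_top

theorem integral_reg_mul (hρ : IsTest ρ) (hk : MemLp k 2 (vol n)) (hkm : StronglyMeasurable k)
    {ψ : H n → ℂ} (hψ : IsTest ψ) :
    ∫ x, reg lam ρ k x * ψ x ∂(vol n) =
      ∫ g, ρ g * ∫ y, k y * ψ (gmul lam (-g) y) ∂(vol n) ∂(vol n) := by
  have h := integral_prod_gmul_swap (lam := lam) hρ.integrable hk hkm (hψ.memLp 2)
  refine h.trans (integral_congr_ae (Eventually.of_forall fun g => ?_))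
  beta_reduce
  rw [← integral_gmul_left (lam := lam) g (fun y => k y * ψ (gmul lam (-g) y))]
  simp only [neg_gmul_gmul]

/-- This plays the role of an approximate identity: the pairing with the translates of ψ is
continuous in g, and being orthogonal to every ρ it vanishes, in particular at the identity. -/
theorem integral_mul_eq_zero_of_reg (hk : LocallyIntegrable k (vol n)) {ψ : H n → ℂ}
    (hψ : IsTest ψ)
    (h : ∀ ρ, IsTest ρ → ∫ g, ρ g * ∫ y, k y * ψ (gmul lam (-g) y) ∂(vol n) ∂(vol n) = 0) :
    ∫ y, k y * ψ y ∂(vol n) = 0 := by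
  have hc : Continuous fun g => ∫ y, k y * ψ (gmul lam (-g) y) ∂(vol n) :=
    (contDiff_integral_gmul (lam := lam) hk hψ).continuous.comp continuous_neg
  have := eq_zero_of_forall_test hc (fun ρ hρ => by
    rw [← h ρ hρ]
    exact integral_congr_ae (Eventually.of_forall fun x => mul_comm _ _)) 0
  simpa [zero_gmul] using this

end Regularization

end Heisenberg

namespace Heisenberg

variable {n : ℕ}

/-! ### Commutation relations -/

section Commutator

/-- The linear function `z_j` (for `τ = 1`) or `conj z_j` (for `τ = -1`). -/
noncomputable def coord (τ : ℝ) (j : Fin n) : H n →L[ℝ] ℂ :=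
  Complex.ofRealCLM.comp (Complex.reCLM.comp
    ((ContinuousLinearMap.proj j).comp (ContinuousLinearMap.fst ℝ (Fin n → ℂ) ℝ))) +
  (Complex.I * τ) • Complex.ofRealCLM.comp (Complex.imCLM.comp
    ((ContinuousLinearMap.proj j).comp (ContinuousLinearMap.fst ℝ (Fin n → ℂ) ℝ)))

theorem coord_apply (τ : ℝ) (j : Fin n) (x : H n) :
    coord τ j x = (x.1 j).re + Complex.I * τ * (x.1 j).im := by
  simp [coord]

variable {lam : Fin n → ℝ} {τ τ' : ℝ} {j l : Fin n} {f : H n → ℂ}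

theorem W_coord (x : H n) : W lam τ j (coord τ' l) x =
    if j = l then ((1 - τ * τ') / 2 : ℂ) else 0 := by
  rw [W, ContinuousLinearMap.fderiv]
  simp only [wsym, coord_apply, Pi.zero_apply]
  by_cases h : j = l
  · subst h
    simp
    linear_combination (τ * τ' / 2 : ℂ) * Complex.I_sq
  · simp [h]

theorem contDiff_fderiv_apply (hf : ContDiff ℝ ∞ f) (v : H n) :
    ContDiff ℝ ∞ (fun x => fderiv ℝ f x v) :=
  (hf.fderiv_right (m := ∞) (by simp)).clm_apply contDiff_const

theorem fderiv_fderiv_apply_comm (hf : ContDiff ℝ ∞ f) (v w : H n) (x : H n) :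
    fderiv ℝ (fun y => fderiv ℝ f y v) x w = fderiv ℝ (fun y => fderiv ℝ f y w) x v := by
  have hd : DifferentiableAt ℝ (fderiv ℝ f) x :=
    (hf.fderiv_right (m := ∞) (by simp)).differentiable (by simp) x
  have h : ∀ u : H n, fderiv ℝ (fun y => fderiv ℝ f y u) x = (fderiv ℝ (fderiv ℝ f) x).flip u := by
    intro u
    rw [fderiv_clm_apply hd (differentiableAt_const u)]
    simp
  rw [h, h, ContinuousLinearMap.flip_apply, ContinuousLinearMap.flip_apply]
  exact second_derivative_symmetric (fun y => (hf.differentiable (by simp) y).hasFDerivAt)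
    hd.hasFDerivAt w v

theorem W_W_apply (hf : ContDiff ℝ ∞ f) (x : H n) :
    W lam τ j (W lam τ' l f) x =
      (1 / 2 : ℂ) * (W lam τ j (fun y => fderiv ℝ f y (Pi.single l 1, 0)) x +
        Complex.I * τ' * W lam τ j (fun y => fderiv ℝ f y (Pi.single l Complex.I, 0)) x) +
      Complex.I * τ' * lam l * (coord τ' l x * W lam τ j (Dt f) x +
        Dt f x * W lam τ j (coord τ' l) x) := by
  have hd : ∀ v : H n, Differentiable ℝ (fun x => fderiv ℝ f x v) := fun v =>
    (contDiff_fderiv_apply hf v).differentiable (by simp)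
  have hc : Differentiable ℝ (coord τ' l) := (coord τ' l).differentiable
  have e : W lam τ' l f = fun y => (1 / 2 : ℂ) * (fderiv ℝ f y (Pi.single l 1, 0) +
      (Complex.I * τ') * fderiv ℝ f y (Pi.single l Complex.I, 0)) +
      (Complex.I * τ' * lam l) * (coord τ' l y * Dt f y) := by
    funext y
    rw [W, wsym, coord_apply, Dt]
    ring
  have hD : Differentiable ℝ (Dt f) := hd _
  have h1 := (hd (Pi.single l Complex.I, 0) x).const_mul (Complex.I * τ')
  have h2 := (hd (Pi.single l 1, 0) x).fun_add h1
  have h3 := (hc x).fun_mul (hD x)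
  rw [e, W_add (h2.const_mul _) (h3.const_mul _), W_const_mul _ h2, W_const_mul _ h3,
    W_add (hd _ x) h1, W_const_mul _ (hd _ x), W_mul (hc x) (hD x)]

/-- Second derivatives commute, so only derivatives of the coefficients of ∂/∂t survive. These are
multiples of `coord`, and `W_coord` evaluates them. -/
theorem W_W_sub (hf : ContDiff ℝ ∞ f) (x : H n) :
    W lam τ j (W lam τ' l f) x - W lam τ' l (W lam τ j f) x =
      if j = l then Complex.I * lam j * (τ' - τ) * ((1 - τ * τ') / 2) * Dt f x else 0 := by
  rw [W_W_apply hf, W_W_apply hf, W_coord, W_coord]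
  simp only [W, wsym, ← coord_apply]
  have hs := fun v w => fderiv_fderiv_apply_comm hf v w x
  have hDt : Dt f = fun y => fderiv ℝ f y (0, 1) := rfl
  rw [hDt]
  rw [hs (Pi.single l 1, 0) (Pi.single j 1, 0), hs (Pi.single l 1, 0) (Pi.single j Complex.I, 0),
    hs (Pi.single l 1, 0) (0, 1), hs (Pi.single l Complex.I, 0) (Pi.single j 1, 0),
    hs (Pi.single l Complex.I, 0) (Pi.single j Complex.I, 0),
    hs (Pi.single l Complex.I, 0) (0, 1), hs (0, 1) (Pi.single j 1, 0),
    hs (0, 1) (Pi.single j Complex.I, 0)]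
  by_cases h : j = l
  · subst h
    simp
    ring
  · simp [h, Ne.symm h]
    ring

theorem W_W_comm (hjl : j ≠ l) (hf : ContDiff ℝ ∞ f) (x : H n) :
    W lam τ j (W lam τ' l f) x = W lam τ' l (W lam τ j f) x := by
  have := W_W_sub (lam := lam) (τ := τ) (τ' := τ') (j := j) (l := l) hf x
  rw [if_neg hjl] at this
  exact sub_eq_zero.1 this

theorem W_W_neg (hτ : τ ^ 2 = 1) (hf : ContDiff ℝ ∞ f) (x : H n) :
    W lam τ j (W lam (-τ) j f) x = W lam (-τ) j (W lam τ j f) x -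
      2 * Complex.I * τ * lam j * Dt f x := by
  have h := W_W_sub (lam := lam) (τ := τ) (τ' := -τ) (j := j) (l := j) hf x
  have hτ' : (τ : ℂ) ^ 2 = 1 := by exact_mod_cast hτ
  rw [if_pos rfl] at h
  push_cast at h
  linear_combination h - Complex.I * lam j * τ * Dt f x * hτ'

end Commutator

/-! ### The energy identity -/

section Energy

variable {lam : Fin n → ℝ} {τ τ' : ℝ} {j l : Fin n} {u v : H n → ℂ}

/-- Two integrations by parts, with the commuting fields interchanged in between. -/
theorem integral_W_mul_conj_swap (hjl : j ≠ l) (hu : IsTest u) (hv : IsTest v) :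
    ∫ x, W lam τ j u x * conj (W lam τ' l v x) ∂(vol n) =
      ∫ x, W lam (-τ') l u x * conj (W lam (-τ) j v x) ∂(vol n) := by
  have e : ∀ (s : ℝ) (i : Fin n) x, conj (W lam s i v x) = W lam (-s) i (fun y => conj (v y)) x := by
    intro s i x
    rw [W_conj, neg_neg]
  simp only [e, neg_neg]
  rw [integral_W_mul lam τ j hu (hv.conj.W lam _ l).1,
    integral_W_mul lam (-τ') l hu (hv.conj.W lam _ j).1]
  simp only [W_W_comm hjl hv.conj.1]

/-- The same argument for equal indices, where the commutator leaves a term in ∂/∂t. It is this term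
that ties the sign of τ λ_j to the sign of the t-frequency. -/
theorem integral_W_mul_conj_self (hτ : τ ^ 2 = 1) (hv : IsTest v) :
    ∫ x, W lam τ j v x * conj (W lam τ j v x) ∂(vol n) =
      ∫ x, W lam (-τ) j v x * conj (W lam (-τ) j v x) ∂(vol n) +
        2 * Complex.I * τ * lam j * ∫ x, v x * conj (Dt v x) ∂(vol n) := by
  have e : ∀ (s : ℝ) (i : Fin n) x, conj (W lam s i v x) = W lam (-s) i (fun y => conj (v y)) x := by
    intro s i x
    rw [W_conj, neg_neg]
  have eD : ∀ x, conj (Dt v x) = Dt (fun y => conj (v y)) x := by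
    intro x
    rw [Dt, Dt, fderiv_conj_comp]
  simp only [e, eD, neg_neg]
  rw [integral_W_mul lam τ j hv (hv.conj.W lam _ j).1,
    integral_W_mul lam (-τ) j hv (hv.conj.W lam _ j).1]
  simp only [W_W_neg hτ hv.conj.1]
  rw [← integral_const_mul, ← integral_neg, ← integral_neg, ← integral_add]
  · refine integral_congr_ae (Eventually.of_forall fun x => ?_)
    beta_reduce
    ring
  · exact (hv.mul_right ((hv.conj.W lam _ j).W lam _ j).1).integrable.neg
  · exact (hv.mul_right hv.conj.Dt.1).integrable.const_mul _

theorem wedgeSign_insert_self (j : Fin n) (K : Finset (Fin n)) :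
    wedgeSign j (insert j K) = wedgeSign j K := by
  rw [wedgeSign, wedgeSign, Finset.filter_insert, if_neg (lt_irrefl j)]

theorem wedgeSign_insert {l : Fin n} {K : Finset (Fin n)} (hl : l ∉ K) (j : Fin n) :
    wedgeSign j (insert l K) = if l < j then -wedgeSign j K else wedgeSign j K := by
  rw [wedgeSign, wedgeSign, Finset.filter_insert]
  split_ifs with h
  · rw [Finset.card_insert_of_notMem (by simp [hl]), pow_succ]
    ring
  · rfl

theorem wedgeSign_mul_self (j : Fin n) (K : Finset (Fin n)) :
    wedgeSign j K * wedgeSign j K = 1 := by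
  rw [wedgeSign, ← mul_pow]
  simp

theorem conj_wedgeSign (j : Fin n) (K : Finset (Fin n)) : conj (wedgeSign j K) = wedgeSign j K := by
  simp [wedgeSign]

theorem norm_wedgeSign (j : Fin n) (K : Finset (Fin n)) : ‖wedgeSign j K‖ = 1 := by
  simp [wedgeSign]

/-- Exterior multiplications by dz̄_j and dz̄_l anticommute: exactly one of the two signs on the
left counts an additional smaller index. -/
theorem wedgeSign_mul_insert_insert {I : Finset (Fin n)} (hjl : j ≠ l) (hj : j ∉ I) (hl : l ∉ I) :
    wedgeSign j (insert j (insert l I)) * wedgeSign l (insert j (insert l I)) =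
      -(wedgeSign j (insert j I) * wedgeSign l (insert l I)) := by
  rw [Finset.insert_comm j l, wedgeSign_insert_self l, Finset.insert_comm l j,
    wedgeSign_insert_self j, wedgeSign_insert_self j, wedgeSign_insert_self l, wedgeSign_insert hl,
    wedgeSign_insert hj]
  rcases lt_or_gt_of_ne hjl with h | h
  · rw [if_neg (not_lt.2 h.le), if_pos h]
    ring
  · rw [if_pos h, if_neg (not_lt.2 h.le)]
    ring

/-- The coefficients of `∂̄_b v` for a smooth form `v`. -/
noncomputable def dbar (lam : Fin n → ℝ) (v : Finset (Fin n) → H n → ℂ) (K : Finset (Fin n))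
    (x : H n) : ℂ :=
  ∑ j ∈ K, wedgeSign j K * W lam 1 j (v (K.erase j)) x

/-- The coefficients of the negative of the formal adjoint of `∂̄_b`, for a smooth form `v`. -/
noncomputable def dbarAdj (lam : Fin n → ℝ) (v : Finset (Fin n) → H n → ℂ) (J : Finset (Fin n))
    (x : H n) : ℂ :=
  ∑ j ∈ Jᶜ, wedgeSign j (insert j J) * W lam (-1) j (v (insert j J)) x

/-- The sign for which `W (sgn J j) j` annihilates the `J`-components of harmonic forms. -/
def sgn (J : Finset (Fin n)) (j : Fin n) : ℝ := if j ∈ J then -1 else 1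

theorem sgn_sq (J : Finset (Fin n)) (j : Fin n) : sgn J j ^ 2 = 1 := by
  unfold sgn; split_ifs <;> norm_num

variable {v : Finset (Fin n) → H n → ℂ}

theorem integral_dbar_mul_conj (hv : ∀ J, IsTest (v J)) (K : Finset (Fin n)) :
    ∫ x, dbar lam v K x * conj (dbar lam v K x) ∂(vol n) =
      ∑ j ∈ K, ∑ l ∈ K, wedgeSign j K * wedgeSign l K *
        ∫ x, W lam 1 j (v (K.erase j)) x * conj (W lam 1 l (v (K.erase l)) x) ∂(vol n) := by
  have hi : ∀ j l, Integrable (fun x => wedgeSign j K * wedgeSign l K *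
      (W lam 1 j (v (K.erase j)) x * conj (W lam 1 l (v (K.erase l)) x))) (vol n) := fun j l =>
    (((hv _).W lam 1 j).mul_right ((hv _).W lam 1 l).conj.1).integrable.const_mul _
  simp_rw [← integral_const_mul]
  have h1 : ∀ j, ∑ l ∈ K, ∫ x, wedgeSign j K * wedgeSign l K *
      (W lam 1 j (v (K.erase j)) x * conj (W lam 1 l (v (K.erase l)) x)) ∂(vol n) =
      ∫ x, ∑ l ∈ K, wedgeSign j K * wedgeSign l K *
      (W lam 1 j (v (K.erase j)) x * conj (W lam 1 l (v (K.erase l)) x)) ∂(vol n) := fun j =>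
    (integral_finsetSum _ fun l _ => hi j l).symm
  simp_rw [h1]
  rw [← integral_finsetSum _ fun j _ => integrable_finsetSum _ fun l _ => hi j l]
  refine integral_congr_ae (Eventually.of_forall fun x => ?_)
  simp only [dbar, map_sum, map_mul, conj_wedgeSign, Finset.sum_mul_sum]
  exact Finset.sum_congr rfl fun j _ => Finset.sum_congr rfl fun l _ => by ring

theorem integral_dbarAdj_mul_conj (hv : ∀ J, IsTest (v J)) (J : Finset (Fin n)) :
    ∫ x, dbarAdj lam v J x * conj (dbarAdj lam v J x) ∂(vol n) =
      ∑ j ∈ Jᶜ, ∑ l ∈ Jᶜ, wedgeSign j (insert j J) * wedgeSign l (insert l J) *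
        ∫ x, W lam (-1) j (v (insert j J)) x * conj (W lam (-1) l (v (insert l J)) x) ∂(vol n) := by
  have hi : ∀ j l, Integrable (fun x => wedgeSign j (insert j J) * wedgeSign l (insert l J) *
      (W lam (-1) j (v (insert j J)) x * conj (W lam (-1) l (v (insert l J)) x))) (vol n) :=
    fun j l => (((hv _).W lam (-1) j).mul_right ((hv _).W lam (-1) l).conj.1).integrable.const_mul _
  simp_rw [← integral_const_mul]
  have h1 : ∀ j, ∑ l ∈ Jᶜ, ∫ x, wedgeSign j (insert j J) * wedgeSign l (insert l J) *
      (W lam (-1) j (v (insert j J)) x * conj (W lam (-1) l (v (insert l J)) x)) ∂(vol n) =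
      ∫ x, ∑ l ∈ Jᶜ, wedgeSign j (insert j J) * wedgeSign l (insert l J) *
      (W lam (-1) j (v (insert j J)) x * conj (W lam (-1) l (v (insert l J)) x)) ∂(vol n) :=
    fun j => (integral_finsetSum _ fun l _ => hi j l).symm
  simp_rw [h1]
  rw [← integral_finsetSum _ fun j _ => integrable_finsetSum _ fun l _ => hi j l]
  refine integral_congr_ae (Eventually.of_forall fun x => ?_)
  simp only [dbarAdj, map_sum, map_mul, conj_wedgeSign, Finset.sum_mul_sum]
  exact Finset.sum_congr rfl fun j _ => Finset.sum_congr rfl fun l _ => by ring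

theorem sum_filter_erase {j : Fin n} (F : Finset (Fin n) → ℂ) :
    ∑ K : Finset (Fin n) with j ∈ K, F (K.erase j) = ∑ J : Finset (Fin n) with j ∉ J, F J := by
  refine Finset.sum_bij' (fun K _ => K.erase j) (fun J _ => insert j J) ?_ ?_ ?_ ?_ ?_
  · intro K _; simp
  · intro J _; simp
  · intro K hK; exact Finset.insert_erase (by simpa using hK)
  · intro J hJ; exact Finset.erase_insert (by simpa using hJ)
  · intro K _; rfl

theorem sum_filter_insert {j : Fin n} (F : Finset (Fin n) → ℂ) :
    ∑ J : Finset (Fin n) with j ∉ J, F (insert j J) = ∑ K : Finset (Fin n) with j ∈ K, F K := by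
  refine Finset.sum_bij' (fun J _ => insert j J) (fun K _ => K.erase j) ?_ ?_ ?_ ?_ ?_
  · intro J _; simp
  · intro K _; simp
  · intro J hJ; exact Finset.erase_insert (by simpa using hJ)
  · intro K hK; exact Finset.insert_erase (by simpa using hK)
  · intro K _; rfl

theorem sum_filter_insert_insert {j l : Fin n} (hjl : j ≠ l) (F : Finset (Fin n) → ℂ) :
    ∑ K : Finset (Fin n) with j ∈ K ∧ l ∈ K, F K = ∑ I : Finset (Fin n) with j ∉ I ∧ l ∉ I, F (insert j (insert l I)) := by
  refine Finset.sum_bij' (fun K _ => (K.erase j).erase l) (fun I _ => insert j (insert l I))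
    ?_ ?_ ?_ ?_ ?_
  · intro K _; simp
  · intro J _; simp
  · intro K hK
    simp only [Finset.mem_filter, Finset.mem_univ, true_and] at hK
    rw [Finset.insert_erase (Finset.mem_erase.2 ⟨hjl.symm, hK.2⟩), Finset.insert_erase hK.1]
  · intro I hI
    simp only [Finset.mem_filter, Finset.mem_univ, true_and] at hI
    rw [Finset.erase_insert (by simp [hjl, hI.1]), Finset.erase_insert hI.2]
  · intro K hK
    simp only [Finset.mem_filter, Finset.mem_univ, true_and] at hK
    rw [Finset.insert_erase (Finset.mem_erase.2 ⟨hjl.symm, hK.2⟩), Finset.insert_erase hK.1]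

theorem sum_sum_sum_mem (S : Finset (Fin n) → Finset (Fin n))
    (F : Finset (Fin n) → Fin n → Fin n → ℂ) :
    ∑ K, ∑ j ∈ S K, ∑ l ∈ S K, F K j l =
      ∑ j, ∑ l, ∑ K : Finset (Fin n) with j ∈ S K ∧ l ∈ S K, F K j l := by
  rw [Finset.sum_comm' (t' := Finset.univ) (s' := fun j => {K | j ∈ S K}) (by simp)]
  refine Finset.sum_congr rfl fun j _ => ?_
  rw [Finset.sum_comm' (t' := Finset.univ) (s' := fun l => {K | j ∈ S K ∧ l ∈ S K}) (by simp)]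

/-- The `L²` energy identity for `∂̄_b` on compactly supported smooth forms. -/
theorem energy_identity (hv : ∀ J, IsTest (v J)) :
    ∑ K, ∫ x, dbar lam v K x * conj (dbar lam v K x) ∂(vol n) +
      ∑ J, ∫ x, dbarAdj lam v J x * conj (dbarAdj lam v J x) ∂(vol n) =
    ∑ J, ∑ j, ∫ x, W lam (sgn J j) j (v J) x * conj (W lam (sgn J j) j (v J) x) ∂(vol n) := by
  simp_rw [integral_dbar_mul_conj hv, integral_dbarAdj_mul_conj hv]
  rw [sum_sum_sum_mem (fun K => K), sum_sum_sum_mem (fun J => Jᶜ)]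
  -- Only the double sum of the adjoint is transposed, so that its (l, j) term meets the (j, l) term
  -- of ∂̄_b.
  rw [Finset.sum_comm (s := Finset.univ) (t := Finset.univ) (f := fun j l =>
    ∑ J : Finset (Fin n) with j ∈ Jᶜ ∧ l ∈ Jᶜ,
      wedgeSign j (insert j J) * wedgeSign l (insert l J) *
        ∫ x, W lam (-1) j (v (insert j J)) x * conj (W lam (-1) l (v (insert l J)) x) ∂(vol n)),
    ← Finset.sum_add_distrib, Finset.sum_comm (s := (Finset.univ : Finset (Finset (Fin n))))]
  refine Finset.sum_congr rfl fun j _ => ?_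
  rw [← Finset.sum_add_distrib, Finset.sum_eq_single j]
  -- Diagonal terms: ∂̄_b contributes Z̄_j on the J without j, the adjoint contributes Z_j on the J
  -- containing j. Together they give `sgn J j`.
  · simp only [and_self, wedgeSign_mul_self, one_mul, Finset.mem_compl]
    rw [sum_filter_erase (fun J => ∫ x, W lam 1 j (v J) x * conj (W lam 1 j (v J) x) ∂(vol n)),
      sum_filter_insert (fun K =>
        ∫ x, W lam (-1) j (v K) x * conj (W lam (-1) j (v K) x) ∂(vol n)),
      ← Finset.sum_filter_add_sum_filter_not (s := Finset.univ) (p := fun J => j ∈ J), add_comm]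
    congr 1
    · refine Finset.sum_congr rfl fun J hJ => ?_
      rw [sgn, if_pos (by simpa using hJ)]
    · refine Finset.sum_congr rfl fun J hJ => ?_
      rw [sgn, if_neg (by simpa using hJ)]
  -- Off-diagonal terms: indexed by I avoiding j and l, the two contributions have equal integrals
  -- and opposite wedge signs.
  · intro l _ hlj
    simp only [Finset.mem_compl]
    rw [sum_filter_insert_insert hlj.symm, Finset.filter_congr (q := fun J => j ∉ J ∧ l ∉ J)
      (fun J _ => and_comm), ← Finset.sum_add_distrib]
    refine Finset.sum_eq_zero fun I hI => ?_
    simp only [Finset.mem_filter, Finset.mem_univ, true_and] at hI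
    have e1 : (insert j (insert l I)).erase j = insert l I :=
      Finset.erase_insert (by simp [hlj.symm, hI.1])
    have e2 : (insert j (insert l I)).erase l = insert j I := by
      rw [Finset.insert_comm]
      exact Finset.erase_insert (by simp [hlj, hI.2])
    rw [e1, e2, wedgeSign_mul_insert_insert hlj.symm hI.1 hI.2,
      integral_W_mul_conj_swap hlj.symm (hv _) (hv _)]
    ring
  · simp

end Energy

end Heisenberg

namespace Heisenberg

variable {n : ℕ}

/-! ### Truncation, and vanishing for mixed signs -/

section Localization

variable {lam : Fin n → ℝ} {τ : ℝ} {j : Fin n} {f g k : H n → ℂ}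

/-- The square of the `L²` norm. -/
noncomputable def normSq (f : H n → ℂ) : ℝ := ∫ x, ‖f x‖ ^ 2 ∂(vol n)

theorem normSq_nonneg (f : H n → ℂ) : 0 ≤ normSq f := integral_nonneg fun _ => by positivity

theorem integral_mul_conj_self (f : H n → ℂ) :
    ∫ x, f x * conj (f x) ∂(vol n) = (normSq f : ℂ) := by
  rw [normSq, ← integral_complex_ofReal]
  refine integral_congr_ae (Eventually.of_forall fun x => ?_)
  simp [Complex.mul_conj']

theorem norm_integral_mul_le (hf : MemLp f 2 (vol n)) (hg : MemLp g 2 (vol n)) :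
    ‖∫ x, f x * g x ∂(vol n)‖ ≤ √(normSq f) * √(normSq g) := by
  refine (norm_integral_le_integral_norm _).trans ?_
  simp only [norm_mul]
  have h := integral_mul_norm_le_Lp_mul_Lq (μ := vol n) (f := f) (g := g)
    Real.HolderConjugate.two_two (by simpa using hf) (by simpa using hg)
  simpa [normSq, Real.sqrt_eq_rpow] using h

theorem tendsto_normSq_of_le {F : ℕ → H n → ℂ} {G : H n → ℝ} (hG : MemLp G 2 (vol n))
    (h : ∀ m x, ‖F m x‖ ≤ G x / ((m : ℝ) + 1)) :
    Tendsto (fun m => normSq (F m)) atTop (𝓝 0) := by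
  have hi : Integrable (fun x => G x ^ 2) (vol n) := by
    simpa using hG.integrable_norm_rpow (by simp) (by simp)
  have hle : ∀ m, normSq (F m) ≤ (∫ x, G x ^ 2 ∂(vol n)) * (1 / ((m : ℝ) + 1)) ^ 2 := by
    intro m
    rw [← integral_mul_const]
    refine integral_mono_of_nonneg (Eventually.of_forall fun x => by positivity)
      (hi.mul_const _) (Eventually.of_forall fun x => ?_)
    beta_reduce
    rw [← mul_pow, mul_one_div]
    exact pow_le_pow_left₀ (norm_nonneg _) (h m x) 2
  refine squeeze_zero (fun m => normSq_nonneg _) hle ?_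
  simpa using (tendsto_inv_nat.pow 2).const_mul (∫ x, G x ^ 2 ∂(vol n))

theorem isTest_cut_mul (hk : ContDiff ℝ ∞ k) (m : ℕ) : IsTest (fun x => cut m x * k x) :=
  (isTest_cut m).mul_right hk

theorem W_cut_mul (hk : ContDiff ℝ ∞ k) (m : ℕ) (x : H n) :
    W lam τ j (fun x => cut m x * k x) x =
      cut m x * W lam τ j k x + k x * W lam τ j (cut m) x :=
  W_mul ((isTest_cut m).1.differentiable (by simp) x) (hk.differentiable (by simp) x)

theorem tendsto_integral_cut_mul {h : H n → ℂ} (hi : Integrable h (vol n)) :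
    Tendsto (fun m => ∫ x, cut m x * h x ∂(vol n)) atTop (𝓝 (∫ x, h x ∂(vol n))) := by
  refine tendsto_integral_of_dominated_convergence (fun x => ‖h x‖)
    (fun m => (isTest_cut m).1.continuous.aestronglyMeasurable.mul hi.1) hi.norm
    (fun m => Eventually.of_forall fun x => ?_) (Eventually.of_forall fun x => ?_)
  · rw [norm_mul]
    exact mul_le_of_le_one_left (norm_nonneg _) (norm_cut_le m x)
  · simpa using (tendsto_cut x).mul_const (h x)

/-- Integration by parts puts W on the truncation of k, and Cauchy–Schwarz against χ makes the
pairing tend to 0. -/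
theorem weakNull_of_tendsto (hk : ContDiff ℝ ∞ k) (hk2 : MemLp k 2 (vol n))
    (h : Tendsto (fun m => normSq (W lam τ j (fun x => cut m x * k x))) atTop (𝓝 0)) :
    WeakNull lam τ j k := by
  intro χ hχ
  have h1 := tendsto_integral_cut_mul (hk2.integrable_mul ((hχ.W lam τ j).memLp 2))
  have h2 : Tendsto (fun m => ∫ x, cut m x * (k * W lam τ j χ) x ∂(vol n)) atTop (𝓝 0) := by
    have e : ∀ m, ∫ x, cut m x * (k * W lam τ j χ) x ∂(vol n) =
        -∫ x, W lam τ j (fun x => cut m x * k x) x * χ x ∂(vol n) := by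
      intro m
      rw [integral_W_mul lam τ j (isTest_cut_mul hk m) hχ.1, neg_neg]
      simp only [Pi.mul_apply, mul_assoc]
    simp only [e]
    refine squeeze_zero_norm (fun m => ?_) (a := fun m =>
      √(normSq (W lam τ j (fun x => cut m x * k x))) * √(normSq χ)) ?_
    · rw [norm_neg]
      exact norm_integral_mul_le (((isTest_cut_mul hk m).W lam τ j).memLp 2) (hχ.memLp 2)
    · simpa using (h.sqrt).mul_const (√(normSq χ))
  exact tendsto_nhds_unique h1 h2

theorem normSq_W_eq (hτ : τ ^ 2 = 1) {v : H n → ℂ} (hv : IsTest v) :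
    normSq (W lam τ j v) = normSq (W lam (-τ) j v) -
      2 * τ * lam j * (∫ x, v x * conj (Dt v x) ∂(vol n)).im := by
  have h := integral_W_mul_conj_self (lam := lam) (j := j) hτ hv
  rw [integral_mul_conj_self, integral_mul_conj_self] at h
  have h2 := congrArg Complex.re h
  simp only [Complex.add_re, Complex.ofReal_re, Complex.mul_re, Complex.mul_im, Complex.I_re,
    Complex.I_im, Complex.ofReal_im, Complex.re_ofNat, Complex.im_ofNat] at h2
  rw [h2]
  ring

/-- A nonzero constant is not square integrable on a line, so Fubini gives vanishing on almost every
vertical line and continuity on all of them. -/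
theorem eq_zero_of_Dt_eq_zero (hk : ContDiff ℝ ∞ k) (hk2 : MemLp k 2 (vol n))
    (h : ∀ x, Dt k x = 0) (x : H n) : k x = 0 := by
  have hc : ∀ z t, k (z, t) = k (z, 0) := by
    intro z t
    have hd : ∀ s : ℝ, HasDerivAt (fun s : ℝ => k (z, s)) 0 s := by
      intro s
      have h1 : HasDerivAt (fun s : ℝ => ((z, s) : H n)) ((0 : Fin n → ℂ), (1 : ℝ)) s :=
        (hasDerivAt_const s z).prodMk (hasDerivAt_id s)
      have h2 := (hk.differentiable (by simp) (z, s)).hasFDerivAt.comp_hasDerivAt s h1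
      have h3 : fderiv ℝ k (z, s) (0, 1) = 0 := h (z, s)
      rwa [h3] at h2
    exact is_const_of_deriv_eq_zero (fun s => (hd s).differentiableAt)
      (fun s => (hd s).deriv) t 0
  have hi : Integrable (fun x : H n => ‖k x‖ ^ 2)
      ((volume : Measure (Fin n → ℂ)).prod (volume : Measure ℝ)) := by
    have := integrable_sq_norm hk2
    rw [vol] at this
    exact (integrable_smul_measure (by simp) (by simp)).1 this
  have hae := hi.prod_right_ae
  have hz : ∀ᵐ z : Fin n → ℂ, k (z, 0) = 0 := by
    filter_upwards [hae] with z hz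
    simp only [hc z] at hz
    rw [integrable_const_iff] at hz
    rcases hz with hz | hz
    · simpa using hz
    · have := hz.measure_univ_lt_top
      simp at this
  have hz' : ∀ z : Fin n → ℂ, k (z, 0) = 0 := by
    have hcont : Continuous fun z : Fin n → ℂ => k (z, 0) :=
      hk.continuous.comp (continuous_id.prodMk continuous_const)
    have hz2 : (fun z : Fin n → ℂ => k (z, 0)) =ᵐ[volume] fun _ => 0 := hz
    exact fun z => congrFun ((hcont.ae_eq_iff_eq volume continuous_const).1 hz2) z
  rw [← Prod.mk.eta (p := x), hc, hz']

theorem WeakNull.eq_zero (hw : WeakNull lam τ j k) (hk : ContDiff ℝ ∞ k) (x : H n) :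
    W lam τ j k x = 0 := by
  refine eq_zero_of_forall_test (contDiff_W lam τ j hk).continuous (fun χ hχ => ?_) x
  have h1 := integral_W_mul lam τ j hχ hk
  have h2 := hw χ hχ
  rw [show ∫ x, W lam τ j k x * χ x ∂(vol n) = ∫ x, χ x * W lam τ j k x ∂(vol n) from
    integral_congr_ae (Eventually.of_forall fun x => mul_comm _ _), ← neg_eq_zero, ← h1, ← h2]
  exact integral_congr_ae (Eventually.of_forall fun x => mul_comm _ _)

/-- A square integrable smooth function whose `W`-derivatives have signs that force the spectrum
in `x_{2n+1}` into both half lines vanishes. -/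
theorem eq_zero_of_mixed_signs {l : Fin n} {s s' : ℝ} (hs : s ^ 2 = 1) (hs' : s' ^ 2 = 1)
    (hj : 0 < s * lam j) (hl : s' * lam l < 0) (hk : ContDiff ℝ ∞ k) (hk2 : MemLp k 2 (vol n))
    (h : Tendsto (fun m => normSq (W lam s j (fun x => cut m x * k x))) atTop (𝓝 0))
    (h' : Tendsto (fun m => normSq (W lam s' l (fun x => cut m x * k x))) atTop (𝓝 0))
    (x : H n) : k x = 0 := by
  -- Up to sign and scale, E m is the mean t-frequency of the truncation. The norms for the opposite
  -- fields are nonnegative, so index j bounds E m from below and index l from above, both bounds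
  -- tending to 0.
  set E : ℕ → ℝ := fun m =>
    (∫ x, (cut m x * k x) * conj (Dt (fun x => cut m x * k x) x) ∂(vol n)).im with hE
  have e1 : ∀ m, normSq (W lam (-s) j (fun x => cut m x * k x)) =
      normSq (W lam s j (fun x => cut m x * k x)) + 2 * (s * lam j) * E m := by
    intro m
    rw [normSq_W_eq (τ := s) hs (isTest_cut_mul hk m)]
    ring
  have e2 : ∀ m, normSq (W lam (-s') l (fun x => cut m x * k x)) =
      normSq (W lam s' l (fun x => cut m x * k x)) + 2 * (s' * lam l) * E m := by
    intro m
    rw [normSq_W_eq (τ := s') hs' (isTest_cut_mul hk m)]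
    ring
  have hlow : ∀ m, -(normSq (W lam s j (fun x => cut m x * k x)) / (2 * (s * lam j))) ≤ E m := by
    intro m
    have h1 := normSq_nonneg (W lam (-s) j (fun x => cut m x * k x))
    rw [e1 m] at h1
    rw [← neg_div, div_le_iff₀ (by positivity)]
    linarith
  have hup : ∀ m, E m ≤ normSq (W lam s' l (fun x => cut m x * k x)) / (-2 * (s' * lam l)) := by
    intro m
    have h1 := normSq_nonneg (W lam (-s') l (fun x => cut m x * k x))
    rw [e2 m] at h1
    rw [le_div_iff₀ (by linarith)]
    linarith
  have hE0 : Tendsto E atTop (𝓝 0) := by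
    refine tendsto_of_tendsto_of_tendsto_of_le_of_le ?_ ?_ hlow hup
    · simpa using (h.div_const (2 * (s * lam j))).neg
    · simpa using h'.div_const (-2 * (s' * lam l))
  have h2 : Tendsto (fun m => normSq (W lam (-s) j (fun x => cut m x * k x))) atTop (𝓝 0) := by
    simp only [e1]
    simpa using h.add (hE0.const_mul (2 * (s * lam j)))
  -- Now both conjugate fields of index j annihilate k; so does their commutator, a nonzero multiple
  -- of ∂/∂t.
  have w1 : ∀ x, W lam s j k x = 0 := (weakNull_of_tendsto hk hk2 h).eq_zero hk
  have w2 : ∀ x, W lam (-s) j k x = 0 := (weakNull_of_tendsto hk hk2 h2).eq_zero hk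
  refine eq_zero_of_Dt_eq_zero hk hk2 (fun x => ?_) x
  have hc := W_W_neg (lam := lam) (j := j) hs hk x
  rw [show W lam s j k = fun _ => 0 from funext w1, show W lam (-s) j k = fun _ => 0 from funext w2,
    W_const, W_const, zero_sub, eq_comm, neg_eq_zero] at hc
  have hne : (s * lam j : ℂ) ≠ 0 := by exact_mod_cast hj.ne'
  rw [mul_eq_zero] at hc
  rcases hc with hc | hc
  · exfalso
    apply hne
    have hI := Complex.I_ne_zero
    have : (2 * Complex.I) * (s * lam j : ℂ) = 0 := by rw [← hc]; ring
    simpa [hI] using this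
  · exact hc

end Localization

/-! ### The equations satisfied by the coefficients of harmonic forms -/

section Harmonic

variable {lam : Fin n → ℝ} {k : Finset (Fin n) → H n → ℂ}

theorem tendsto_normSq_sum_W_cut {ι : Type*} (S : Finset ι) (c : ι → ℂ) (hc : ∀ i, ‖c i‖ = 1)
    (τ : ℝ) (j : ι → Fin n) {f : ι → H n → ℂ} (hf : ∀ i, MemLp (f i) 2 (vol n)) :
    Tendsto (fun m => normSq (fun x => ∑ i ∈ S, c i * (f i x * W lam τ (j i) (cut m) x)))
      atTop (𝓝 0) := by
  choose C hC0 hC using fun i => exists_norm_W_cut_le lam τ (j i)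
  refine tendsto_normSq_of_le (G := fun x => ∑ i ∈ S, C i * ‖f i x‖)
    (memLp_finsetSum S fun i _ => (hf i).norm.const_mul (C i)) fun m x => ?_
  rw [Finset.sum_div]
  refine (norm_sum_le _ _).trans (Finset.sum_le_sum fun i _ => ?_)
  rw [norm_mul, norm_mul, hc, one_mul]
  calc ‖f i x‖ * ‖W lam τ (j i) (cut m) x‖ ≤ ‖f i x‖ * (C i / ((m : ℝ) + 1)) := by
        gcongr; exact hC i m x
    _ = C i * ‖f i x‖ / ((m : ℝ) + 1) := by ring

/-- For a smooth square integrable harmonic form, `W` of the truncated components tends to `0`. -/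
theorem tendsto_normSq_W_cut_mul (hk : ∀ J, ContDiff ℝ ∞ (k J)) (hk2 : ∀ J, MemLp (k J) 2 (vol n))
    (hd : ∀ K x, dbar lam k K x = 0) (ha : ∀ J x, dbarAdj lam k J x = 0) (J : Finset (Fin n))
    (j : Fin n) :
    Tendsto (fun m => normSq (W lam (sgn J j) j (fun x => cut m x * k J x))) atTop (𝓝 0) := by
  -- The equations for k leave only the terms in which the cutoff is differentiated.
  have e1 : ∀ m K, dbar lam (fun J x => cut m x * k J x) K = fun x =>
      ∑ j ∈ K, wedgeSign j K * (k (K.erase j) x * W lam 1 j (cut m) x) := by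
    intro m K
    funext x
    have h := hd K x
    rw [dbar] at h ⊢
    simp only [W_cut_mul (hk _), mul_add, Finset.sum_add_distrib]
    rw [add_eq_right, ← mul_zero (cut m x), ← h, Finset.mul_sum]
    exact Finset.sum_congr rfl fun j _ => by ring
  have e2 : ∀ m K, dbarAdj lam (fun J x => cut m x * k J x) K = fun x =>
      ∑ j ∈ Kᶜ, wedgeSign j (insert j K) * (k (insert j K) x * W lam (-1) j (cut m) x) := by
    intro m K
    funext x
    have h := ha K x
    rw [dbarAdj] at h ⊢
    simp only [W_cut_mul (hk _), mul_add, Finset.sum_add_distrib]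
    rw [add_eq_right, ← mul_zero (cut m x), ← h, Finset.mul_sum]
    exact Finset.sum_congr rfl fun j _ => by ring
  have hid : ∀ m, ∑ K, normSq (dbar lam (fun J x => cut m x * k J x) K) +
      ∑ J, normSq (dbarAdj lam (fun J x => cut m x * k J x) J) =
      ∑ J, ∑ j, normSq (W lam (sgn J j) j (fun x => cut m x * k J x)) := by
    intro m
    have h := energy_identity (lam := lam) (v := fun J x => cut m x * k J x)
      (fun J => isTest_cut_mul (hk J) m)
    simp only [integral_mul_conj_self] at h
    exact_mod_cast h
  have hlim : Tendsto (fun m => ∑ J, ∑ j, normSq (W lam (sgn J j) j (fun x => cut m x * k J x)))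
      atTop (𝓝 0) := by
    simp only [← hid, e1, e2]
    have t1 : Tendsto (fun m : ℕ => ∑ K : Finset (Fin n), normSq (fun x =>
        ∑ j ∈ K, wedgeSign j K * (k (K.erase j) x * W lam 1 j (cut m) x))) atTop
        (𝓝 (∑ K : Finset (Fin n), 0)) := tendsto_finsetSum _ fun K _ =>
      tendsto_normSq_sum_W_cut K _ (fun j => norm_wedgeSign j K) 1 _ fun j => hk2 _
    have t2 : Tendsto (fun m : ℕ => ∑ K : Finset (Fin n), normSq (fun x =>
        ∑ j ∈ Kᶜ, wedgeSign j (insert j K) * (k (insert j K) x * W lam (-1) j (cut m) x))) atTop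
        (𝓝 (∑ K : Finset (Fin n), 0)) := tendsto_finsetSum _ fun K _ =>
      tendsto_normSq_sum_W_cut Kᶜ _ (fun j => norm_wedgeSign j _) (-1) _ fun j => hk2 _
    simpa using t1.add t2
  -- All terms of the energy are nonnegative, so each is dominated by the total.
  refine squeeze_zero (fun m => normSq_nonneg _) (fun m => ?_) hlim
  refine le_trans ?_ (Finset.single_le_sum
    (f := fun J => ∑ j, normSq (W lam (sgn J j) j (fun x => cut m x * k J x)))
    (fun J _ => Finset.sum_nonneg fun j _ => normSq_nonneg _) (Finset.mem_univ J))
  exact Finset.single_le_sum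
    (f := fun j => normSq (W lam (sgn J j) j (fun x => cut m x * k J x)))
    (fun j _ => normSq_nonneg _) (Finset.mem_univ j)

/-- Weak form of the equations `∂̄_b u = 0` and `∂̄_b^* u = 0`. -/
structure WeakHarmonic (lam : Fin n → ℝ) (u : Finset (Fin n) → H n → ℂ) : Prop where
  dbar : ∀ K χ, IsTest χ →
    ∑ j ∈ K, wedgeSign j K * ∫ x, u (K.erase j) x * W lam 1 j χ x ∂(vol n) = 0
  dbarAdj : ∀ J χ, IsTest χ →
    ∑ j ∈ Jᶜ, wedgeSign j (insert j J) * ∫ x, u (insert j J) x * W lam (-1) j χ x ∂(vol n) = 0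

theorem sum_W_eq_zero_of_weak {ι : Type*} (S : Finset ι) (c : ι → ℂ) (τ : ℝ) (j : ι → Fin n)
    {f : ι → H n → ℂ} (hf : ∀ i, ContDiff ℝ ∞ (f i))
    (h : ∀ χ, IsTest χ → ∑ i ∈ S, c i * ∫ x, f i x * W lam τ (j i) χ x ∂(vol n) = 0) (x : H n) :
    ∑ i ∈ S, c i * W lam τ (j i) (f i) x = 0 := by
  refine eq_zero_of_forall_test (k := fun x => ∑ i ∈ S, c i * W lam τ (j i) (f i) x)
    (continuous_finsetSum _ fun i _ => continuous_const.mul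
      (contDiff_W lam τ (j i) (hf i)).continuous) (fun χ hχ => ?_) x
  have hi : ∀ i ∈ S, Integrable (fun x => c i * (χ x * W lam τ (j i) (f i) x)) (vol n) :=
    fun i _ => (hχ.mul_right (contDiff_W lam τ (j i) (hf i))).integrable.const_mul _
  have e : ∀ x, (∑ i ∈ S, c i * W lam τ (j i) (f i) x) * χ x =
      ∑ i ∈ S, c i * (χ x * W lam τ (j i) (f i) x) := by
    intro x
    rw [Finset.sum_mul]
    exact Finset.sum_congr rfl fun i _ => by ring
  simp only [e]
  rw [integral_finsetSum _ hi, ← neg_eq_zero, ← Finset.sum_neg_distrib, ← h χ hχ]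
  refine Finset.sum_congr rfl fun i _ => ?_
  have e2 : ∫ x, f i x * W lam τ (j i) χ x ∂(vol n) = ∫ x, W lam τ (j i) χ x * f i x ∂(vol n) :=
    integral_congr_ae (Eventually.of_forall fun x => mul_comm _ _)
  rw [integral_const_mul, e2, integral_W_mul lam τ (j i) hχ (hf i)]
  ring

/-- Regularization averages left translates, and these can be shifted to the test function without
disturbing left-invariant fields; hence it preserves weak equations. -/
theorem sum_reg_eq_zero {ι : Type*} (S : Finset ι) (c : ι → ℂ) {τ : ℝ} (hτ : τ ^ 2 = 1)
    (j : ι → Fin n) {f : ι → H n → ℂ} (hf : ∀ i, MemLp (f i) 2 (vol n))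
    (hfm : ∀ i, StronglyMeasurable (f i)) {ρ : H n → ℂ} (hρ : IsTest ρ)
    (h : ∀ χ, IsTest χ → ∑ i ∈ S, c i * ∫ x, f i x * W lam τ (j i) χ x ∂(vol n) = 0)
    {χ : H n → ℂ} (hχ : IsTest χ) :
    ∑ i ∈ S, c i * ∫ x, reg lam ρ (f i) x * W lam τ (j i) χ x ∂(vol n) = 0 := by
  have e : ∀ i, ∫ x, reg lam ρ (f i) x * W lam τ (j i) χ x ∂(vol n) = ∫ g, ρ g * ∫ y, f i y *
      W lam τ (j i) (fun y => χ (gmul lam (-g) y)) y ∂(vol n) ∂(vol n) := by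
    intro i
    rw [integral_reg_mul hρ (hf i) (hfm i) (hχ.W lam τ (j i))]
    simp only [W_gmul_left hτ _ _ _ (hχ.1.differentiable (by simp) _)]
  have hi : ∀ i ∈ S, Integrable (fun g => c i * (ρ g * ∫ y, f i y *
      W lam τ (j i) (fun y => χ (gmul lam (-g) y)) y ∂(vol n))) (vol n) := by
    intro i _
    have hc : ContDiff ℝ ∞ (fun g => ∫ y, f i y * W lam τ (j i) χ (gmul lam (-g) y) ∂(vol n)) :=
      (contDiff_integral_gmul (lam := lam) ((hf i).locallyIntegrable (by norm_num))
        (hχ.W lam τ (j i))).comp contDiff_neg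
    simp only [W_gmul_left hτ _ _ _ (hχ.1.differentiable (by simp) _)]
    exact (hρ.mul_right hc).integrable.const_mul _
  simp only [e, ← integral_const_mul (c _)]
  rw [← integral_finsetSum _ hi]
  refine (integral_congr_ae (Eventually.of_forall fun g => ?_)).trans (integral_zero' _ _)
  have h1 := h _ (hχ.gmul_left (lam := lam) (-g))
  simp only [Pi.zero_apply]
  rw [← mul_zero (ρ g), ← h1, Finset.mul_sum]
  exact Finset.sum_congr rfl fun i _ => by ring

variable {u : Finset (Fin n) → H n → ℂ}

theorem WeakHarmonic.tendsto (hu : WeakHarmonic lam u) (hu2 : ∀ J, MemLp (u J) 2 (vol n))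
    (hum : ∀ J, StronglyMeasurable (u J)) {ρ : H n → ℂ} (hρ : IsTest ρ) (J : Finset (Fin n))
    (j : Fin n) :
    Tendsto (fun m => normSq (W lam (sgn J j) j (fun x => cut m x * reg lam ρ (u J) x))) atTop
      (𝓝 0) := by
  have hc : ∀ J, ContDiff ℝ ∞ (reg lam ρ (u J)) := fun J =>
    contDiff_reg hρ ((hu2 J).locallyIntegrable (by norm_num))
  refine tendsto_normSq_W_cut_mul (k := fun J => reg lam ρ (u J)) hc
    (fun J => memLp_reg hρ (hu2 J) (hum J)) (fun K x => ?_) (fun K x => ?_) J j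
  · exact sum_W_eq_zero_of_weak (lam := lam) K (fun j => wedgeSign j K) 1 (fun j => j)
      (f := fun j => reg lam ρ (u (K.erase j))) (fun j => hc _) (fun χ hχ =>
        sum_reg_eq_zero (lam := lam) K (fun j => wedgeSign j K) (by norm_num) (fun j => j)
          (fun j => hu2 _) (fun j => hum _) hρ (hu.dbar K) hχ) x
  · exact sum_W_eq_zero_of_weak (lam := lam) Kᶜ (fun j => wedgeSign j (insert j K)) (-1)
      (fun j => j) (f := fun j => reg lam ρ (u (insert j K))) (fun j => hc _) (fun χ hχ =>
        sum_reg_eq_zero (lam := lam) Kᶜ (fun j => wedgeSign j (insert j K)) (by norm_num)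
          (fun j => j) (fun j => hu2 _) (fun j => hum _) hρ (hu.dbarAdj K) hχ) x

/-- The components of a harmonic form satisfy `W u_J = 0` in the sense of distributions. -/
theorem WeakHarmonic.weakNull (hu : WeakHarmonic lam u) (hu2 : ∀ J, MemLp (u J) 2 (vol n))
    (hum : ∀ J, StronglyMeasurable (u J)) (J : Finset (Fin n)) (j : Fin n) :
    WeakNull lam (sgn J j) j (u J) := by
  intro χ hχ
  have hl := (hu2 J).locallyIntegrable (by norm_num)
  refine integral_mul_eq_zero_of_reg (lam := lam) hl (hχ.W lam _ j) fun ρ hρ => ?_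
  rw [← integral_reg_mul hρ (hu2 J) (hum J) (hχ.W lam _ j)]
  exact weakNull_of_tendsto (contDiff_reg hρ hl) (memLp_reg hρ (hu2 J) (hum J))
    (hu.tendsto hu2 hum hρ J j) χ hχ

theorem WeakHarmonic.ae_eq_zero (hu : WeakHarmonic lam u) (hu2 : ∀ J, MemLp (u J) 2 (vol n))
    (hum : ∀ J, StronglyMeasurable (u J)) {J : Finset (Fin n)} {j l : Fin n}
    (hj : 0 < sgn J j * lam j) (hl : sgn J l * lam l < 0) : ∀ᵐ x ∂(vol n), u J x = 0 := by
  have hloc := (hu2 J).locallyIntegrable (by norm_num)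
  refine ae_eq_zero_of_forall_test hloc fun χ hχ => ?_
  refine integral_mul_eq_zero_of_reg (lam := lam) hloc hχ fun ρ hρ => ?_
  rw [← integral_reg_mul hρ (hu2 J) (hum J) hχ]
  have h0 : ∀ x, reg lam ρ (u J) x = 0 := eq_zero_of_mixed_signs (sgn_sq J j) (sgn_sq J l) hj hl
    (contDiff_reg hρ hloc) (memLp_reg hρ (hu2 J) (hum J)) (hu.tendsto hu2 hum hρ J j)
    (hu.tendsto hu2 hum hρ J l)
  simp [h0]

end Harmonic

end Heisenberg

namespace Heisenberg

variable {n : ℕ}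

/-! ### Algebra of the Szegő and Poisson type kernels -/

section KernelAlgebra

/-- The quadratic form `∑ |λ_j| |z_j|²`. -/
noncomputable def quad (lam : Fin n → ℝ) (z : Fin n → ℂ) : ℝ := ∑ j, |lam j| * ‖z j‖ ^ 2

theorem quad_nonneg (lam : Fin n → ℝ) (z : Fin n → ℂ) : 0 ≤ quad lam z :=
  Finset.sum_nonneg fun _ _ => by positivity

/-- The function `ε + ∑ |λ_j| |z_j|² + i σ t`. -/
noncomputable def aker (lam : Fin n → ℝ) (σ ε : ℝ) (x : H n) : ℂ :=
  ((ε + quad lam x.1 : ℝ) : ℂ) + Complex.I * σ * x.2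

variable {lam : Fin n → ℝ} {σ ε : ℝ} {j : Fin n} {tau : Fin n → ℝ}

theorem aker_re (x : H n) : (aker lam σ ε x).re = ε + quad lam x.1 := by
  simp [aker]

theorem aker_im (x : H n) : (aker lam σ ε x).im = σ * x.2 := by
  simp [aker]

theorem aker_ne_zero (hε : 0 < ε) (x : H n) : aker lam σ ε x ≠ 0 := by
  intro h
  have := congrArg Complex.re h
  rw [aker_re, Complex.zero_re] at this
  linarith [quad_nonneg lam x.1]

theorem conj_aker (x : H n) : conj (aker lam σ ε x) = aker lam (-σ) ε x := by
  simp [aker]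

theorem norm_aker_neg (x : H n) : ‖aker lam (-σ) ε x‖ = ‖aker lam σ ε x‖ := by
  rw [← conj_aker, RCLike.norm_conj]

theorem aker_add_conj (x : H n) :
    aker lam σ ε x + aker lam (-σ) ε x = 2 * (ε + quad lam x.1 : ℝ) := by
  simp only [aker]
  push_cast
  ring

theorem le_norm_aker (x : H n) : ε + quad lam x.1 ≤ ‖aker lam σ ε x‖ := by
  rw [← aker_re (σ := σ)]
  exact Complex.re_le_norm _

theorem abs_snd_le_norm_aker (hσ : σ ^ 2 = 1) (x : H n) : |x.2| ≤ ‖aker lam σ ε x‖ := by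
  have h := Complex.abs_im_le_norm (aker lam σ ε x)
  rw [aker_im, abs_mul, show |σ| = 1 by rwa [← sq_eq_sq₀ (abs_nonneg σ) zero_le_one, sq_abs, one_pow], one_mul] at h
  exact h

theorem hasFDerivAt_quad (z : Fin n → ℂ) :
    HasFDerivAt (quad lam) (∑ j, |lam j| • (2 • (innerSL ℝ (z j)).comp
      (ContinuousLinearMap.proj (R := ℝ) (φ := fun _ : Fin n => ℂ) j))) z := by
  unfold quad
  refine HasFDerivAt.fun_sum fun j _ => ?_
  have h : HasFDerivAt (fun z : Fin n → ℂ => z j)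
      (ContinuousLinearMap.proj (R := ℝ) (φ := fun _ : Fin n => ℂ) j) z :=
    (ContinuousLinearMap.proj (R := ℝ) (φ := fun _ : Fin n => ℂ) j).hasFDerivAt
  exact (h.norm_sq).const_mul _

theorem hasFDerivAt_aker (x : H n) :
    HasFDerivAt (aker lam σ ε) (Complex.ofRealCLM.comp ((∑ j, |lam j| • (2 •
      (innerSL ℝ (x.1 j)).comp (ContinuousLinearMap.proj (R := ℝ) (φ := fun _ : Fin n => ℂ) j))).comp
        (ContinuousLinearMap.fst ℝ (Fin n → ℂ) ℝ)) +
      (Complex.I * σ) • Complex.ofRealCLM.comp (ContinuousLinearMap.snd ℝ (Fin n → ℂ) ℝ)) x := by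
  have h1 : HasFDerivAt (fun x : H n => ε + quad lam x.1) _ x :=
    ((hasFDerivAt_quad (lam := lam) x.1).comp x
      (ContinuousLinearMap.fst ℝ (Fin n → ℂ) ℝ).hasFDerivAt).const_add ε
  have h2 := (Complex.ofRealCLM.hasFDerivAt (x := ε + quad lam x.1)).comp x h1
  have h3 := (Complex.ofRealCLM.comp (ContinuousLinearMap.snd ℝ (Fin n → ℂ) ℝ)).hasFDerivAt
    (x := x) |>.const_mul (Complex.I * σ)
  exact h2.fun_add h3

theorem contDiff_aker : ContDiff ℝ ∞ (aker lam σ ε : H n → ℂ) := by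
  have hq : ContDiff ℝ ∞ (fun x : H n => quad lam x.1) := by
    unfold quad
    refine ContDiff.sum fun j _ => contDiff_const.mul ?_
    exact (((ContinuousLinearMap.proj (R := ℝ) (φ := fun _ : Fin n => ℂ) j).comp
      (ContinuousLinearMap.fst ℝ (Fin n → ℂ) ℝ)).contDiff).norm_sq ℝ
  exact (Complex.ofRealCLM.contDiff.comp (contDiff_const.add hq)).add
    (contDiff_const.mul (Complex.ofRealCLM.comp
      (ContinuousLinearMap.snd ℝ (Fin n → ℂ) ℝ)).contDiff)

theorem differentiable_aker : Differentiable ℝ (aker lam σ ε : H n → ℂ) :=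
  contDiff_aker.differentiable (by simp)

/-- The quadratic part contributes |λ_j| and the part iσt contributes -τσλ_j, times the same
coordinate. They cancel when στλ_j = |λ_j| and double for the opposite τ. -/
theorem W_aker (τ : ℝ) (x : H n) :
    W lam τ j (aker lam σ ε) x = (|lam j| - τ * σ * lam j : ℝ) * coord τ j x := by
  have h : ∀ c : ℂ, (∑ i, |lam i| • (2 • (innerSL ℝ (x.1 i)).comp
      (ContinuousLinearMap.proj (R := ℝ) (φ := fun _ : Fin n => ℂ) i))) (Pi.single j c) =
      |lam j| * (2 * inner ℝ (x.1 j) c) := by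
    intro c
    rw [FunLike.coe_sum, Finset.sum_apply, Finset.sum_eq_single j]
    · simp only [smul_apply, ContinuousLinearMap.comp_apply, ContinuousLinearMap.proj_apply,
        Pi.single_eq_same, innerSL_apply_apply, smul_eq_mul, nsmul_eq_mul]
      norm_num
    · intro b _ hb; simp [hb]
    · simp
  rw [W, (hasFDerivAt_aker x).fderiv, wsym, coord_apply]
  simp only [add_apply, ContinuousLinearMap.comp_apply, h, smul_apply,
    ContinuousLinearMap.coe_fst', ContinuousLinearMap.coe_snd', Complex.ofRealCLM_apply,
    smul_eq_mul, map_zero, Complex.inner]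
  simp
  linear_combination (σ * τ * lam j * ((x.1 j).re + Complex.I * τ * (x.1 j).im)) * Complex.I_sq

theorem W_aker_eq_zero {τ : ℝ} (h : σ * τ * lam j = |lam j|) (x : H n) :
    W lam τ j (aker lam σ ε) x = 0 := by
  rw [W_aker, ← h]
  simp [mul_comm σ τ]

theorem W_inv_pow {τ : ℝ} {f : H n → ℂ} {x : H n} (hf : DifferentiableAt ℝ f x) (h0 : f x ≠ 0)
    (m : ℕ) : W lam τ j (fun y => (f y ^ m)⁻¹) x = -(m * (f x ^ (m + 1))⁻¹ * W lam τ j f x) := by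
  rw [W_inv (hf.fun_pow m) (pow_ne_zero _ h0), W_pow hf]
  rcases m with _ | m
  · simp
  · simp only [Nat.add_sub_cancel]
    field_simp
    ring

theorem coord_neg_mul_coord {τ : ℝ} (hτ : τ ^ 2 = 1) (x : H n) :
    coord (-τ) j x * coord τ j x = ((‖x.1 j‖ ^ 2 : ℝ) : ℂ) := by
  have hτ' : (τ : ℂ) ^ 2 = 1 := by exact_mod_cast hτ
  rw [coord_apply, coord_apply, Complex.sq_norm, Complex.normSq_apply]
  push_cast
  linear_combination (x.1 j).im ^ 2 * hτ' - (τ : ℂ) ^ 2 * (x.1 j).im ^ 2 * Complex.I_sq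

theorem norm_coord_sq {τ : ℝ} (hτ : τ ^ 2 = 1) (x : H n) : ‖coord τ j x‖ ^ 2 = ‖x.1 j‖ ^ 2 := by
  rw [coord_apply, Complex.sq_norm, Complex.sq_norm, Complex.normSq_apply, Complex.normSq_apply]
  simp
  linear_combination (x.1 j).im ^ 2 * hτ

/-- The regularized Cauchy-Szegő kernel. -/
noncomputable def szegoKer (lam : Fin n → ℝ) (σ ε : ℝ) (x : H n) : ℂ :=
  (aker lam σ ε x ^ (n + 1))⁻¹

/-- A Poisson type kernel, which is an approximate identity as `ε → 0`. -/
noncomputable def poisKer (lam : Fin n → ℝ) (σ ε : ℝ) (x : H n) : ℂ :=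
  2 * ε * ((aker lam σ ε x ^ (n + 1))⁻¹ * (aker lam (-σ) ε x)⁻¹)

/-- The coefficients of a primitive of the difference of `poisKer` and `szegoKer`. -/
noncomputable def primKer (lam : Fin n → ℝ) (σ ε τ : ℝ) (j : Fin n) (x : H n) : ℂ :=
  coord τ j x * ((aker lam σ ε x ^ n)⁻¹ * (aker lam (-σ) ε x)⁻¹)

theorem contDiff_inv_pow_aker (hε : 0 < ε) (m : ℕ) :
    ContDiff ℝ ∞ (fun x : H n => (aker lam σ ε x ^ m)⁻¹) :=
  (contDiff_aker.pow m).inv fun x => pow_ne_zero _ (aker_ne_zero hε x)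

theorem contDiff_inv_aker (hε : 0 < ε) : ContDiff ℝ ∞ (fun x : H n => (aker lam σ ε x)⁻¹) :=
  contDiff_aker.inv fun x => aker_ne_zero hε x

theorem contDiff_szegoKer (hε : 0 < ε) : ContDiff ℝ ∞ (szegoKer lam σ ε : H n → ℂ) :=
  contDiff_inv_pow_aker hε _

theorem contDiff_poisKer (hε : 0 < ε) : ContDiff ℝ ∞ (poisKer lam σ ε : H n → ℂ) :=
  contDiff_const.mul ((contDiff_inv_pow_aker hε _).mul (contDiff_inv_aker hε))

theorem contDiff_primKer (hε : 0 < ε) (τ : ℝ) :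
    ContDiff ℝ ∞ (primKer lam σ ε τ j : H n → ℂ) :=
  (coord τ j).contDiff.mul ((contDiff_inv_pow_aker hε _).mul (contDiff_inv_aker hε))

theorem W_szegoKer_eq_zero (hε : 0 < ε) {τ : ℝ} (h : σ * τ * lam j = |lam j|) (x : H n) :
    W lam τ j (szegoKer lam σ ε) x = 0 := by
  have := W_inv_pow (lam := lam) (τ := τ) (j := j) (differentiable_aker x)
    (aker_ne_zero (lam := lam) (σ := σ) hε x) (n + 1)
  rw [W_aker_eq_zero h, mul_zero, neg_zero] at this
  exact this

/-- The field with sign -τ annihilates the conjugate factor ā^{-1}, so the derivative falls only on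
the coordinate, where it is 1, and on a^{-n}. -/
theorem W_primKer (hε : 0 < ε) {τ : ℝ} (hτ : τ ^ 2 = 1) (h : σ * τ * lam j = |lam j|) (x : H n) :
    W lam (-τ) j (primKer lam σ ε τ j) x =
      (aker lam σ ε x ^ n)⁻¹ * (aker lam (-σ) ε x)⁻¹ -
        2 * n * (|lam j| * ‖x.1 j‖ ^ 2 : ℝ) *
          ((aker lam σ ε x ^ (n + 1))⁻¹ * (aker lam (-σ) ε x)⁻¹) := by
  have hτ' : (τ : ℂ) ^ 2 = 1 := by exact_mod_cast hτ
  have d1 : DifferentiableAt ℝ (fun x : H n => (aker lam σ ε x ^ n)⁻¹) x :=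
    (contDiff_inv_pow_aker hε _).differentiable (by simp) x
  have d2 : DifferentiableAt ℝ (fun x : H n => (aker lam (-σ) ε x)⁻¹) x :=
    (contDiff_inv_aker hε).differentiable (by simp) x
  have e1 : W lam (-τ) j (coord τ j) x = 1 := by
    rw [W_coord, if_pos rfl]
    push_cast
    linear_combination hτ' / 2
  have e2 : W lam (-τ) j (fun x : H n => (aker lam (-σ) ε x)⁻¹) x = 0 := by
    rw [W_inv (differentiable_aker x) (aker_ne_zero hε x),
      W_aker_eq_zero (by rw [← h]; ring), mul_zero, neg_zero]
  have e3 : W lam (-τ) j (aker lam σ ε) x = 2 * |lam j| * coord (-τ) j x := by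
    rw [W_aker, ← h]
    push_cast
    ring
  have h0 : W lam (-τ) j (primKer lam σ ε τ j) x = _ :=
    W_mul (lam := lam) (τ := -τ) (j := j) ((coord τ j).differentiableAt) (d1.fun_mul d2)
  rw [h0, W_mul d1 d2, e1, e2, W_inv_pow (differentiable_aker x) (aker_ne_zero hε x), e3]
  have hc := coord_neg_mul_coord (j := j) hτ x
  push_cast at hc ⊢
  linear_combination (-2 * n * ((|lam j| : ℝ) : ℂ) * (aker lam σ ε x ^ (n + 1))⁻¹ *
    (aker lam (-σ) ε x)⁻¹) * hc

/-- The Poisson kernel and the Szegő kernel differ by a divergence. -/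
theorem szegoKer_eq (hε : 0 < ε) (htau : ∀ j, tau j ^ 2 = 1)
    (h : ∀ j, σ * tau j * lam j = |lam j|) (x : H n) :
    n * szegoKer lam σ ε x = n * poisKer lam σ ε x -
      ∑ j, W lam (-tau j) j (primKer lam σ ε (tau j) j) x := by
  simp only [W_primKer hε (htau _) (h _)]
  have hq : ∑ j, 2 * (n : ℂ) * (|lam j| * ‖x.1 j‖ ^ 2 : ℝ) *
      ((aker lam σ ε x ^ (n + 1))⁻¹ * (aker lam (-σ) ε x)⁻¹) = 2 * n * (quad lam x.1 : ℝ) *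
      ((aker lam σ ε x ^ (n + 1))⁻¹ * (aker lam (-σ) ε x)⁻¹) := by
    rw [← Finset.sum_mul, ← Finset.mul_sum, ← Complex.ofReal_sum]
    rfl
  rw [Finset.sum_sub_distrib, hq, szegoKer, poisKer]
  have ha := aker_ne_zero (lam := lam) (σ := σ) hε x
  have ha' := aker_ne_zero (lam := lam) (σ := -σ) hε x
  -- Over the common denominator a^{n+1} ā the claim becomes ā = 2ε - a + 2 Σ|λ_j||z_j|².
  have hs := aker_add_conj (lam := lam) (σ := σ) (ε := ε) x
  push_cast at hs
  simp only [Finset.sum_const, Finset.card_univ, Fintype.card_fin, nsmul_eq_mul]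
  rw [pow_succ]
  field_simp
  linear_combination n * hs

end KernelAlgebra

end Heisenberg

namespace Heisenberg

variable {n : ℕ}

/-! ### Integrability of the kernels -/

section Decay

variable {lam : Fin n → ℝ} {σ ε : ℝ} {j : Fin n} {tau : Fin n → ℝ}

theorem norm_sq_le_mul_quad (hlam : ∀ j, lam j ≠ 0) (z : Fin n → ℂ) :
    ‖z‖ ^ 2 ≤ (∑ j, |lam j|⁻¹) * quad lam z := by
  have h0 : 0 ≤ (∑ j, |lam j|⁻¹) * quad lam z :=
    mul_nonneg (Finset.sum_nonneg fun _ _ => by positivity) (quad_nonneg _ _)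
  suffices h : ‖z‖ ≤ √((∑ j, |lam j|⁻¹) * quad lam z) by
    calc ‖z‖ ^ 2 ≤ √((∑ j, |lam j|⁻¹) * quad lam z) ^ 2 := by gcongr
      _ = _ := Real.sq_sqrt h0
  rw [pi_norm_le_iff_of_nonneg (Real.sqrt_nonneg _)]
  intro j
  refine Real.le_sqrt_of_sq_le ?_
  have h1 : |lam j| * ‖z j‖ ^ 2 ≤ quad lam z :=
    Finset.single_le_sum (f := fun j => |lam j| * ‖z j‖ ^ 2) (fun _ _ => by positivity)
      (Finset.mem_univ j)
  have h2 : |lam j|⁻¹ ≤ ∑ j, |lam j|⁻¹ :=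
    Finset.single_le_sum (f := fun j => |lam j|⁻¹) (fun _ _ => by positivity) (Finset.mem_univ j)
  have h3 : 0 < |lam j| := abs_pos.2 (hlam j)
  calc ‖z j‖ ^ 2 = |lam j|⁻¹ * (|lam j| * ‖z j‖ ^ 2) := by field_simp
    _ ≤ (∑ j, |lam j|⁻¹) * quad lam z := by gcongr

theorem exists_le_mul_norm_aker (hlam : ∀ j, lam j ≠ 0) (hσ : σ ^ 2 = 1) (hε : 0 < ε) :
    ∃ C, 0 < C ∧ ∀ x : H n, (1 + ‖x.1‖) ^ 2 ≤ C * ‖aker lam σ ε x‖ ∧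
      1 + ‖x.2‖ ≤ C * ‖aker lam σ ε x‖ := by
  set L := ∑ j, |lam j|⁻¹
  have hL : 0 ≤ L := Finset.sum_nonneg fun _ _ => by positivity
  refine ⟨2 * ε⁻¹ + 2 * L + 1, by positivity, fun x => ?_⟩
  have h1 := le_norm_aker (lam := lam) (σ := σ) (ε := ε) x
  have h2 := abs_snd_le_norm_aker (lam := lam) (ε := ε) hσ x
  have h3 := norm_sq_le_mul_quad hlam x.1
  have hq := quad_nonneg lam x.1
  set A := ‖aker lam σ ε x‖
  have h4 : 1 ≤ ε⁻¹ * A := by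
    rw [inv_mul_eq_div, le_div_iff₀ hε]
    linarith
  have h5 : L * quad lam x.1 ≤ L * A := by gcongr; linarith
  rw [Real.norm_eq_abs]
  have hA : 0 ≤ A := norm_nonneg _
  constructor
  · nlinarith [sq_nonneg (1 - ‖x.1‖)]
  · nlinarith [mul_nonneg hL hA]

theorem continuous_aker : Continuous (aker lam σ ε : H n → ℂ) := contDiff_aker.continuous

theorem continuous_inv_norm_aker_pow (hε : 0 < ε) (m : ℕ) :
    Continuous fun x : H n => (‖aker lam σ ε x‖⁻¹) ^ m :=
  (continuous_aker.norm.inv₀ fun x => norm_ne_zero_iff.2 (aker_ne_zero hε x)).pow m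

/-- The homogeneous dimension is 2n + 2 and a grows with weight two, so exponents above n + 1 are
integrable. The Szegő kernel has the critical exponent n + 1; it is handled through its square. -/
theorem integrable_inv_norm_aker_pow (hlam : ∀ j, lam j ≠ 0) (hσ : σ ^ 2 = 1) (hε : 0 < ε) :
    Integrable (fun x : H n => (‖aker lam σ ε x‖⁻¹) ^ (n + 2)) (vol n) := by
  obtain ⟨C, hC, hb⟩ := exists_le_mul_norm_aker (lam := lam) hlam hσ hε
  -- The split n + 2 = (n + 1/2) + 3/2 yields exponent 2n + 1 > 2n in z and 3/2 > 1 in t.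
  have i1 : Integrable (fun z : Fin n → ℂ => (1 + ‖z‖) ^ (-(2 * n + 1 : ℝ))) volume := by
    refine integrable_one_add_norm ?_
    rw [Module.finrank_pi_fintype]
    simp [Complex.finrank_real_complex, mul_comm]
  have i2 : Integrable (fun t : ℝ => (1 + ‖t‖) ^ (-(3 / 2 : ℝ))) volume := by
    refine integrable_one_add_norm ?_
    norm_num
  have i3 := (i1.mul_prod i2).const_mul (C ^ (n + 2 : ℝ))
  have i4 : Integrable (fun x : H n => C ^ (n + 2 : ℝ) * ((1 + ‖x.1‖) ^ (-(2 * n + 1 : ℝ)) *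
      (1 + ‖x.2‖) ^ (-(3 / 2 : ℝ)))) (vol n) := i3.smul_measure (by simp)
  refine i4.mono' (continuous_inv_norm_aker_pow hε _).aestronglyMeasurable
    (Eventually.of_forall fun x => ?_)
  obtain ⟨h1, h2⟩ := hb x
  set A := ‖aker lam σ ε x‖
  have hA : 0 < A := norm_pos_iff.2 (aker_ne_zero hε x)
  rw [Real.norm_of_nonneg (by positivity)]
  have b1 : A⁻¹ ≤ C * (1 + ‖x.1‖) ^ (-2 : ℝ) := by
    rw [Real.rpow_neg (by positivity), ← div_eq_mul_inv, le_div_iff₀ (by positivity),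
      inv_mul_le_iff₀ hA]
    norm_cast
    linarith
  have b2 : A⁻¹ ≤ C * (1 + ‖x.2‖) ^ (-1 : ℝ) := by
    rw [Real.rpow_neg (by positivity), ← div_eq_mul_inv, le_div_iff₀ (by positivity),
      inv_mul_le_iff₀ hA, Real.rpow_one]
    linarith
  have hA' : 0 < A⁻¹ := inv_pos.2 hA
  calc A⁻¹ ^ (n + 2) = A⁻¹ ^ (n + 1 / 2 : ℝ) * A⁻¹ ^ (3 / 2 : ℝ) := by
        rw [← Real.rpow_add hA', ← Real.rpow_natCast]
        congr 1
        push_cast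
        ring
    _ ≤ (C * (1 + ‖x.1‖) ^ (-2 : ℝ)) ^ (n + 1 / 2 : ℝ) *
        (C * (1 + ‖x.2‖) ^ (-1 : ℝ)) ^ (3 / 2 : ℝ) := by gcongr
    _ = _ := by
        rw [Real.mul_rpow hC.le (by positivity), Real.mul_rpow hC.le (by positivity),
          ← Real.rpow_mul (by positivity), ← Real.rpow_mul (by positivity)]
        have hCC : C ^ (n + 2 : ℝ) = C ^ (n + 1 / 2 : ℝ) * C ^ (3 / 2 : ℝ) := by
          rw [← Real.rpow_add hC]
          congr 1
          ring
        rw [hCC]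
        rw [show (-2 : ℝ) * (n + 1 / 2) = -(2 * n + 1) by ring,
          show (-1 : ℝ) * (3 / 2) = -(3 / 2) by ring]
        ring

theorem memLp_of_norm_sq_le (hlam : ∀ j, lam j ≠ 0) (hσ : σ ^ 2 = 1) (hε : 0 < ε) {f : H n → ℂ}
    (hf : Continuous f) {C : ℝ} (h : ∀ x, ‖f x‖ ^ 2 ≤ C * (‖aker lam σ ε x‖⁻¹) ^ (n + 2)) :
    MemLp f 2 (vol n) := by
  rw [memLp_two_iff_integrable_sq_norm hf.aestronglyMeasurable]
  exact ((integrable_inv_norm_aker_pow hlam hσ hε).const_mul C).mono'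
    (hf.norm.pow 2).aestronglyMeasurable (Eventually.of_forall fun x => by
      rw [Real.norm_of_nonneg (by positivity)]
      exact h x)

theorem inv_norm_aker_le (hε : 0 < ε) (x : H n) : ‖aker lam σ ε x‖⁻¹ ≤ ε⁻¹ :=
  inv_anti₀ hε (by linarith [le_norm_aker (lam := lam) (σ := σ) (ε := ε) x, quad_nonneg lam x.1])

theorem inv_norm_aker_pow_le (hε : 0 < ε) (m : ℕ) (x : H n) :
    (‖aker lam σ ε x‖⁻¹) ^ (n + 2 + m) ≤ ε⁻¹ ^ m * (‖aker lam σ ε x‖⁻¹) ^ (n + 2) := by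
  rw [pow_add, mul_comm]
  exact mul_le_mul_of_nonneg_right
    (pow_le_pow_left₀ (by positivity) (inv_norm_aker_le hε x) m) (by positivity)

theorem memLp_szegoKer (hlam : ∀ j, lam j ≠ 0) (hσ : σ ^ 2 = 1) (hε : 0 < ε) :
    MemLp (szegoKer lam σ ε : H n → ℂ) 2 (vol n) := by
  refine memLp_of_norm_sq_le hlam hσ hε (contDiff_szegoKer hε).continuous (C := ε⁻¹ ^ n)
    fun x => ?_
  refine le_trans (le_of_eq ?_) (inv_norm_aker_pow_le hε n x)
  rw [szegoKer, norm_inv, norm_pow, ← inv_pow, ← pow_mul]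
  congr 1
  ring

theorem norm_poisKer (hε : 0 < ε) (x : H n) :
    ‖poisKer lam σ ε x‖ = 2 * ε * (‖aker lam σ ε x‖⁻¹) ^ (n + 2) := by
  rw [poisKer, norm_mul, norm_mul, norm_mul, norm_inv, norm_inv, norm_pow, norm_aker_neg,
    Complex.norm_real, Real.norm_of_nonneg hε.le, ← inv_pow, ← pow_succ]
  simp

theorem integrable_poisKer (hlam : ∀ j, lam j ≠ 0) (hσ : σ ^ 2 = 1) (hε : 0 < ε) :
    Integrable (poisKer lam σ ε : H n → ℂ) (vol n) :=
  ((integrable_inv_norm_aker_pow hlam hσ hε).const_mul (2 * ε)).mono'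
    (contDiff_poisKer hε).continuous.aestronglyMeasurable
    (Eventually.of_forall fun x => (norm_poisKer hε x).le)

theorem memLp_poisKer (hlam : ∀ j, lam j ≠ 0) (hσ : σ ^ 2 = 1) (hε : 0 < ε) :
    MemLp (poisKer lam σ ε : H n → ℂ) 2 (vol n) := by
  refine memLp_of_norm_sq_le hlam hσ hε (contDiff_poisKer hε).continuous
    (C := (2 * ε) ^ 2 * ε⁻¹ ^ (n + 2)) fun x => ?_
  rw [norm_poisKer hε, mul_pow, mul_assoc, ← pow_mul]
  refine mul_le_mul_of_nonneg_left (le_trans (le_of_eq ?_) (inv_norm_aker_pow_le hε (n + 2) x))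
    (by positivity)
  congr 1
  ring

theorem memLp_primKer (hn : 0 < n) (hlam : ∀ j, lam j ≠ 0) (hσ : σ ^ 2 = 1) (hε : 0 < ε)
    {τ : ℝ} (hτ : τ ^ 2 = 1) : MemLp (primKer lam σ ε τ j : H n → ℂ) 2 (vol n) := by
  -- The squared kernel is O(|a|^{-(2n+1)}), and 2n + 1 exceeds n + 2 by m = n - 1; this is where n
  -- ≥ 1 enters.
  obtain ⟨m, rfl⟩ : ∃ m, n = m + 1 := ⟨n - 1, by omega⟩
  refine memLp_of_norm_sq_le hlam hσ hε (contDiff_primKer hε τ).continuous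
    (C := |lam j|⁻¹ * ε⁻¹ ^ m) fun x => ?_
  have h1 := le_norm_aker (lam := lam) (σ := σ) (ε := ε) x
  have h2 : |lam j| * ‖x.1 j‖ ^ 2 ≤ quad lam x.1 :=
    Finset.single_le_sum (f := fun j => |lam j| * ‖x.1 j‖ ^ 2) (fun _ _ => by positivity)
      (Finset.mem_univ j)
  have hl : 0 < |lam j| := abs_pos.2 (hlam j)
  have hA : 0 < ‖aker lam σ ε x‖ := norm_pos_iff.2 (aker_ne_zero hε x)
  have h3 : ‖x.1 j‖ ^ 2 ≤ |lam j|⁻¹ * ‖aker lam σ ε x‖ := by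
    rw [inv_mul_eq_div, le_div_iff₀ hl]
    linarith
  rw [primKer, norm_mul, norm_mul, norm_inv, norm_inv, norm_pow, norm_aker_neg, mul_pow,
    norm_coord_sq hτ]
  calc _ ≤ (|lam j|⁻¹ * ‖aker lam σ ε x‖) *
        ((‖aker lam σ ε x‖ ^ (m + 1))⁻¹ * ‖aker lam σ ε x‖⁻¹) ^ 2 := by gcongr
    _ = |lam j|⁻¹ * ‖aker lam σ ε x‖⁻¹ ^ (m + 1 + 2 + m) := by
        rw [inv_pow]
        field_simp
        ring
    _ ≤ |lam j|⁻¹ * (ε⁻¹ ^ m * ‖aker lam σ ε x‖⁻¹ ^ (m + 1 + 2)) := by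
        gcongr
        exact inv_norm_aker_pow_le hε m x
    _ = _ := by ring

theorem memLp_W_primKer (hlam : ∀ j, lam j ≠ 0) (hσ : σ ^ 2 = 1) (hε : 0 < ε)
    {τ : ℝ} (hτ : τ ^ 2 = 1) (h : σ * τ * lam j = |lam j|) :
    MemLp (W lam (-τ) j (primKer lam σ ε τ j) : H n → ℂ) 2 (vol n) := by
  refine memLp_of_norm_sq_le hlam hσ hε (contDiff_W lam _ j (contDiff_primKer hε τ)).continuous
    (C := (1 + 2 * n) ^ 2 * ε⁻¹ ^ n) fun x => ?_
  have h1 := le_norm_aker (lam := lam) (σ := σ) (ε := ε) x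
  have h2 : |lam j| * ‖x.1 j‖ ^ 2 ≤ quad lam x.1 :=
    Finset.single_le_sum (f := fun j => |lam j| * ‖x.1 j‖ ^ 2) (fun _ _ => by positivity)
      (Finset.mem_univ j)
  have hA : 0 < ‖aker lam σ ε x‖ := norm_pos_iff.2 (aker_ne_zero hε x)
  have hb : ‖W lam (-τ) j (primKer lam σ ε τ j) x‖ ≤
      (1 + 2 * n) * ‖aker lam σ ε x‖⁻¹ ^ (n + 1) := by
    rw [W_primKer hε hτ h]
    refine (norm_sub_le _ _).trans ?_
    simp only [norm_mul, norm_inv, norm_pow, norm_aker_neg]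
    rw [Complex.norm_real, Real.norm_of_nonneg (by positivity)]
    simp only [RCLike.norm_ofNat, RCLike.norm_natCast]
    calc _ ≤ (‖aker lam σ ε x‖ ^ n)⁻¹ * ‖aker lam σ ε x‖⁻¹ + 2 * n * ‖aker lam σ ε x‖ *
          ((‖aker lam σ ε x‖ ^ (n + 1))⁻¹ * ‖aker lam σ ε x‖⁻¹) := by
          gcongr
          linarith
      _ = _ := by
          rw [inv_pow, pow_succ]
          field_simp
  calc _ ≤ ((1 + 2 * n) * ‖aker lam σ ε x‖⁻¹ ^ (n + 1)) ^ 2 := by gcongr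
    _ = (1 + 2 * n) ^ 2 * ‖aker lam σ ε x‖⁻¹ ^ (n + 2 + n) := by ring
    _ ≤ (1 + 2 * n) ^ 2 * (ε⁻¹ ^ n * ‖aker lam σ ε x‖⁻¹ ^ (n + 2)) := by
        gcongr
        exact inv_norm_aker_pow_le hε n x
    _ = _ := by ring

end Decay

/-! ### The mass of the Poisson type kernel -/

section Normalization

variable {σ b : ℝ}

/-- `b + i σ t`. -/
theorem norm_sq_add_I_mul (hσ : σ ^ 2 = 1) (t : ℝ) :
    ‖(b : ℂ) + Complex.I * σ * t‖ ^ 2 = b ^ 2 + t ^ 2 := by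
  rw [Complex.sq_norm, Complex.normSq_apply]
  simp
  linear_combination t ^ 2 * hσ

theorem add_I_mul_ne_zero (hb : 0 < b) (t : ℝ) : (b : ℂ) + Complex.I * σ * t ≠ 0 := by
  intro h
  have := congrArg Complex.re h
  simp at this
  exact hb.ne' this

theorem le_norm_add_I_mul (t : ℝ) : b ≤ ‖(b : ℂ) + Complex.I * σ * t‖ := by
  have := Complex.re_le_norm ((b : ℂ) + Complex.I * σ * t)
  simpa using this

theorem integrable_inv_sq_add_sq (hb : 0 < b) : Integrable fun t : ℝ => (b ^ 2 + t ^ 2)⁻¹ := by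
  have h := ((integrable_inv_one_add_sq).comp_div hb.ne').const_mul (b ^ 2)⁻¹
  refine h.congr (Eventually.of_forall fun t => ?_)
  beta_reduce
  field_simp

theorem integral_inv_sq_add_sq (hb : 0 < b) : ∫ t : ℝ, (b ^ 2 + t ^ 2)⁻¹ = Real.pi / b := by
  have h := Measure.integral_comp_div (fun t : ℝ => (1 + t ^ 2)⁻¹) b
  rw [integral_univ_inv_one_add_sq, abs_of_pos hb, smul_eq_mul] at h
  have e : ∀ t : ℝ, (b ^ 2 + t ^ 2)⁻¹ = (b ^ 2)⁻¹ * (1 + (t / b) ^ 2)⁻¹ := by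
    intro t
    field_simp
  simp only [e]
  rw [integral_const_mul, h]
  field_simp

theorem integrable_inv_pow_add_I_mul (hσ : σ ^ 2 = 1) (hb : 0 < b) (m : ℕ) :
    Integrable fun t : ℝ => (((b : ℂ) + Complex.I * σ * t) ^ (m + 2))⁻¹ := by
  refine ((integrable_inv_sq_add_sq hb).const_mul (b⁻¹ ^ m)).mono' ?_
    (Eventually.of_forall fun t => ?_)
  · exact (Continuous.inv₀ (by fun_prop)
      fun t => pow_ne_zero _ (add_I_mul_ne_zero hb t)).aestronglyMeasurable
  · rw [norm_inv, norm_pow, pow_add, mul_inv, norm_sq_add_I_mul hσ, inv_pow]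
    have := le_norm_add_I_mul (b := b) (σ := σ) t
    gcongr

/-- The integrand has a primitive that tends to 0 at both ends. -/
theorem integral_inv_pow_add_I_mul (hσ : σ ^ 2 = 1) (hb : 0 < b) (m : ℕ) :
    ∫ t : ℝ, (((b : ℂ) + Complex.I * σ * t) ^ (m + 2))⁻¹ = 0 := by
  have hσ0 : (σ : ℂ) ≠ 0 := by
    rintro h
    have : σ = 0 := by exact_mod_cast h
    simp [this] at hσ
  set c : ℂ := (-((m + 1 : ℕ) : ℂ) * (Complex.I * σ))⁻¹ with hc
  have hc0 : -((m + 1 : ℕ) : ℂ) * (Complex.I * σ) ≠ 0 :=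
    mul_ne_zero (neg_ne_zero.2 (Nat.cast_ne_zero.2 (Nat.succ_ne_zero m)))
      (mul_ne_zero Complex.I_ne_zero hσ0)
  have hd : ∀ t : ℝ, HasDerivAt (fun t : ℝ => c * (((b : ℂ) + Complex.I * σ * t) ^ (m + 1))⁻¹)
      (((b : ℂ) + Complex.I * σ * t) ^ (m + 2))⁻¹ t := by
    intro t
    have hne := add_I_mul_ne_zero (σ := σ) hb t
    have h1 : HasDerivAt (fun t : ℝ => (b : ℂ) + Complex.I * σ * t) (Complex.I * σ) t := by
      simpa using ((Complex.ofRealCLM.hasDerivAt (x := t)).const_mul (Complex.I * σ)).const_add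
        (b : ℂ)
    have h2 := ((h1.fun_pow (m + 1)).fun_inv (pow_ne_zero _ hne)).const_mul c
    refine h2.congr_deriv ?_
    rw [hc]
    field_simp
    simp only [Nat.add_sub_cancel]
    ring
  have hinf : Tendsto (fun t : ℝ => |t|) (atBot ⊔ atTop) atTop :=
    tendsto_sup.2 ⟨tendsto_abs_atBot_atTop, tendsto_abs_atTop_atTop⟩
  have hlim : Tendsto (fun t : ℝ => c * (((b : ℂ) + Complex.I * σ * t) ^ (m + 1))⁻¹)
      (atBot ⊔ atTop) (𝓝 0) := by
    rw [← mul_zero c]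
    refine Tendsto.const_mul c ?_
    rw [tendsto_zero_iff_norm_tendsto_zero]
    simp only [norm_inv, norm_pow]
    refine Tendsto.inv_tendsto_atTop (Tendsto.comp (tendsto_pow_atTop (Nat.succ_ne_zero m)) ?_)
    refine tendsto_atTop_mono (fun t => ?_) hinf
    refine abs_le_of_sq_le_sq ?_ (norm_nonneg _)
    rw [norm_sq_add_I_mul hσ]
    nlinarith [sq_nonneg b]
  have := integral_of_hasDerivAt_of_tendsto hd (integrable_inv_pow_add_I_mul hσ hb m)
    (hlim.mono_left le_sup_left) (hlim.mono_left le_sup_right)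
  simpa using this

/-- Let p and r be the two conjugate factors. Since p + r = 2b, 1/(p^{m+2} r) = (1/p^{m+2} +
1/(p^{m+1} r))/(2b), and the pure power integrates to 0: each step divides by 2b, starting from ∫
dt/(b² + t²) = π/b. -/
theorem integral_inv_pow_mul_inv (hσ : σ ^ 2 = 1) (hb : 0 < b) (m : ℕ) :
    Integrable (fun t : ℝ => (((b : ℂ) + Complex.I * σ * t) ^ (m + 1))⁻¹ *
      ((b : ℂ) + Complex.I * (-σ : ℝ) * t)⁻¹) ∧
    ∫ t : ℝ, (((b : ℂ) + Complex.I * σ * t) ^ (m + 1))⁻¹ *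
      ((b : ℂ) + Complex.I * (-σ : ℝ) * t)⁻¹ = 2 * Real.pi / (2 * b) ^ (m + 1) := by
  have hσ' : (σ : ℂ) ^ 2 = 1 := by exact_mod_cast hσ
  have hprod : ∀ t : ℝ, ((b : ℂ) + Complex.I * σ * t) * ((b : ℂ) + Complex.I * (-σ : ℝ) * t) =
      ((b ^ 2 + t ^ 2 : ℝ) : ℂ) := by
    intro t
    push_cast
    linear_combination (-(t : ℂ) ^ 2 * Complex.I ^ 2) * hσ' - (t : ℂ) ^ 2 * Complex.I_sq
  induction m with
  | zero =>
    have e : (fun t : ℝ => (((b : ℂ) + Complex.I * σ * t) ^ (0 + 1))⁻¹ *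
      ((b : ℂ) + Complex.I * (-σ : ℝ) * t)⁻¹) = fun t : ℝ => (((b ^ 2 + t ^ 2)⁻¹ : ℝ) : ℂ) := by
      funext t
      rw [zero_add, pow_one, ← mul_inv, hprod, Complex.ofReal_inv]
    rw [e]
    refine ⟨(integrable_inv_sq_add_sq hb).ofReal, ?_⟩
    rw [integral_complex_ofReal, integral_inv_sq_add_sq hb]
    push_cast
    have : (b : ℂ) ≠ 0 := by exact_mod_cast hb.ne'
    field_simp
  | succ m ih =>
    have hb0 : (b : ℂ) ≠ 0 := by exact_mod_cast hb.ne'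
    have e : (fun t : ℝ => (((b : ℂ) + Complex.I * σ * t) ^ (m + 1 + 1))⁻¹ *
        ((b : ℂ) + Complex.I * (-σ : ℝ) * t)⁻¹) = fun t : ℝ => (2 * b : ℂ)⁻¹ *
        ((((b : ℂ) + Complex.I * σ * t) ^ (m + 2))⁻¹ + (((b : ℂ) + Complex.I * σ * t) ^ (m + 1))⁻¹ *
        ((b : ℂ) + Complex.I * (-σ : ℝ) * t)⁻¹) := by
      funext t
      have h1 := add_I_mul_ne_zero (σ := σ) hb t
      have h2 := add_I_mul_ne_zero (σ := -σ) hb t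
      have h3 : ((b : ℂ) + Complex.I * σ * t) + ((b : ℂ) + Complex.I * (-σ : ℝ) * t) = 2 * b := by
        push_cast
        ring
      rw [← h3] 
      have h4 : ((b : ℂ) + Complex.I * σ * t) + ((b : ℂ) + Complex.I * (-σ : ℝ) * t) ≠ 0 := by
        rw [h3]; exact mul_ne_zero two_ne_zero hb0
      generalize (b : ℂ) + Complex.I * σ * t = p at *
      generalize (b : ℂ) + Complex.I * (-σ : ℝ) * t = r at *
      field_simp
      ring
    rw [e]
    have i1 := integrable_inv_pow_add_I_mul hσ hb m
    refine ⟨(i1.add ih.1).const_mul _, ?_⟩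
    rw [integral_const_mul, integral_add i1 ih.1, ih.2, integral_inv_pow_add_I_mul hσ hb, zero_add,
      pow_succ (2 * (b : ℂ)) (m + 1)]
    field_simp

end Normalization

end Heisenberg

namespace Heisenberg

variable {n : ℕ}

/-! ### Gaussian computation of the mass, and the approximate identity -/

section Total

variable {lam : Fin n → ℝ} {σ ε : ℝ}

theorem integral_exp_neg_mul_quad (hlam : ∀ j, lam j ≠ 0) {s : ℝ} (hs : 0 < s) :
    ∫ z : Fin n → ℂ, Real.exp (-s * quad lam z) = Real.pi ^ n / (s ^ n * ∏ j, |lam j|) := by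
  have e : ∀ z : Fin n → ℂ, Real.exp (-s * quad lam z) =
      ∏ j, Real.exp (-(s * |lam j|) * ‖z j‖ ^ 2) := by
    intro z
    rw [← Real.exp_sum, quad, Finset.mul_sum]
    congr 1
    exact Finset.sum_congr rfl fun j _ => by ring
  simp only [e]
  rw [integral_fintype_prod_volume_eq_prod (fun j (w : ℂ) => Real.exp (-(s * |lam j|) * ‖w‖ ^ 2))]
  have e2 : ∀ j, ∫ w : ℂ, Real.exp (-(s * |lam j|) * ‖w‖ ^ 2) = Real.pi / (s * |lam j|) := by
    intro j
    rw [GaussianFourier.integral_rexp_neg_mul_sq_norm (mul_pos hs (abs_pos.2 (hlam j))),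
      Complex.finrank_real_complex]
    norm_num
  simp only [e2]
  rw [Finset.prod_div_distrib, Finset.prod_mul_distrib]
  simp

theorem integral_pow_mul_exp_neg_mul {X : ℝ} (hX : 0 < X) (m : ℕ) :
    ∫ s in Set.Ioi (0 : ℝ), s ^ m * Real.exp (-(X * s)) = m.factorial * (X ^ (m + 1))⁻¹ := by
  have h := Real.integral_rpow_mul_exp_neg_mul_Ioi (a := m + 1) (by positivity) hX
  rw [Real.Gamma_nat_eq_factorial, add_sub_cancel_right] at h
  simp only [Real.rpow_natCast] at h
  rw [h, one_div, Real.inv_rpow hX.le, mul_comm]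
  norm_cast

/-- Write n! X^{-(n+1)} as the integral of s^n e^{-Xs} over s > 0. After Fubini the z-integral is
Gaussian, and its factor s^{-n} cancels the weight. -/
theorem integral_inv_pow_add_quad (hlam : ∀ j, lam j ≠ 0) (hε : 0 < ε) :
    ∫ z : Fin n → ℂ, ((ε + quad lam z) ^ (n + 1))⁻¹ =
      Real.pi ^ n / (n.factorial * ε * ∏ j, |lam j|) := by
  have hprod : 0 < ∏ j, |lam j| := Finset.prod_pos fun j _ => abs_pos.2 (hlam j)
  have hqc : Continuous (quad lam) := by unfold quad; fun_prop
  let F : ℝ → (Fin n → ℂ) → ℝ := fun s z => s ^ n * Real.exp (-((ε + quad lam z) * s))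
  have eF : ∀ s z, F s z = (s ^ n * Real.exp (-(ε * s))) * Real.exp (-s * quad lam z) := by
    intro s z
    simp only [F]
    rw [mul_assoc, ← Real.exp_add]
    ring_nf
  have h1 : ∀ s : ℝ, 0 < s → ∫ z, F s z = (Real.pi ^ n / ∏ j, |lam j|) * Real.exp (-(ε * s)) := by
    intro s hs
    simp only [eF]
    rw [integral_const_mul, integral_exp_neg_mul_quad hlam hs]
    field_simp
  have hexp : Integrable (fun s : ℝ => Real.exp (-(ε * s))) (volume.restrict (Set.Ioi 0)) := by
    have := integrableOn_exp_mul_Ioi (neg_lt_zero.2 hε) 0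
    simpa [IntegrableOn] using this
  have hint : Integrable (Function.uncurry F) ((volume.restrict (Set.Ioi 0)).prod volume) := by
    have hm : AEStronglyMeasurable (Function.uncurry F)
        ((volume.restrict (Set.Ioi (0 : ℝ))).prod (volume : Measure (Fin n → ℂ))) := by
      refine Continuous.aestronglyMeasurable ?_
      simp only [F, Function.uncurry_def]
      fun_prop
    rw [integrable_prod_iff hm]
    constructor
    · filter_upwards [ae_restrict_mem measurableSet_Ioi] with s hs
      -- The integral of a non-integrable function is 0 by convention, so a nonzero value certifies
      -- integrability.
      refine Integrable.of_integral_ne_zero ?_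
      change ∫ z, F s z ≠ 0
      rw [h1 s hs]
      positivity
    · refine (hexp.const_mul (Real.pi ^ n / ∏ j, |lam j|)).congr ?_
      filter_upwards [ae_restrict_mem measurableSet_Ioi] with s hs
      rw [← h1 s hs]
      refine integral_congr_ae (Eventually.of_forall fun z => ?_)
      have hs' : (0 : ℝ) < s := hs
      have : 0 ≤ F s z := by simp only [F]; positivity
      exact (Real.norm_of_nonneg this).symm
  have hswap := integral_integral_swap hint
  have h2 : ∀ z, ∫ s in Set.Ioi (0 : ℝ), F s z =
      n.factorial * ((ε + quad lam z) ^ (n + 1))⁻¹ := fun z =>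
    integral_pow_mul_exp_neg_mul (by linarith [quad_nonneg lam z]) n
  simp only [h2] at hswap
  rw [integral_const_mul, setIntegral_congr_fun measurableSet_Ioi (fun s hs => h1 s hs),
    integral_const_mul] at hswap
  have h3 := integral_pow_mul_exp_neg_mul hε 0
  simp only [pow_zero, one_mul, Nat.factorial_zero, Nat.cast_one, zero_add, pow_one] at h3
  rw [h3] at hswap
  have hf : (n.factorial : ℝ) ≠ 0 := Nat.cast_ne_zero.2 (Nat.factorial_ne_zero n)
  rw [eq_div_iff (by positivity)]
  set I := ∫ z : Fin n → ℂ, ((ε + quad lam z) ^ (n + 1))⁻¹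
  field_simp at hswap
  linear_combination -hswap

theorem integral_poisKer (hlam : ∀ j, lam j ≠ 0) (hσ : σ ^ 2 = 1) (hε : 0 < ε) :
    ∫ x, poisKer lam σ ε x ∂(vol n) =
      (((2 * Real.pi ^ (n + 1)) / ((∏ j, |lam j|) * n.factorial) : ℝ) : ℂ) := by
  have hprod : 0 < ∏ j, |lam j| := Finset.prod_pos fun j _ => abs_pos.2 (hlam j)
  have hi := integrable_poisKer hlam hσ hε
  rw [vol] at hi ⊢
  have hi' : Integrable (poisKer lam σ ε)
      ((volume : Measure (Fin n → ℂ)).prod (volume : Measure ℝ)) :=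
    (integrable_smul_measure (by simp) (by simp)).1 hi
  rw [integral_smul_measure]
  have h1 : ∫ x : H n, poisKer lam σ ε x = ∫ z : Fin n → ℂ, ∫ t : ℝ, poisKer lam σ ε (z, t) :=
    integral_prod _ hi'
  have h2 : ∀ z : Fin n → ℂ, ∫ t : ℝ, poisKer lam σ ε (z, t) =
      ((4 * Real.pi * ε / 2 ^ (n + 1) * ((ε + quad lam z) ^ (n + 1))⁻¹ : ℝ) : ℂ) := by
    intro z
    have hb : 0 < ε + quad lam z := by linarith [quad_nonneg lam z]
    simp only [poisKer, aker]
    rw [integral_const_mul, (integral_inv_pow_mul_inv hσ hb n).2]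
    push_cast
    rw [mul_pow]
    have : ((ε : ℂ) + quad lam z) ≠ 0 := by exact_mod_cast hb.ne'
    field_simp
    ring
  rw [h1]
  simp only [h2]
  rw [integral_complex_ofReal, integral_const_mul, integral_inv_pow_add_quad hlam hε]
  rw [ENNReal.toReal_pow, ENNReal.toReal_ofNat, Complex.real_smul, ← Complex.ofReal_mul]
  congr 1
  have hf : (n.factorial : ℝ) ≠ 0 := Nat.cast_ne_zero.2 (Nat.factorial_ne_zero n)
  rw [pow_succ, pow_succ]
  field_simp
  norm_num

theorem dil_inv_dil {r : ℝ} (hr : r ≠ 0) (x : H n) : dil r⁻¹ (dil r x) = x := by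
  ext1
  · simp [dil_apply, smul_smul, inv_mul_cancel₀ hr]
  · simp only [dil_apply]
    field_simp

/-- The Jacobian is left unspecified: `integral_poisKer_mul` recovers it from the mass of the
kernel. -/
theorem exists_integral_dil {r : ℝ} (hr : r ≠ 0) : ∃ c : ℝ, ∀ F : H n → ℂ,
    ∫ x, F (dil r x) ∂(vol n) = c * ∫ x, F x ∂(vol n) := by
  have hdet : LinearMap.det ((dil r : H n →L[ℝ] H n) : H n →ₗ[ℝ] H n) ≠ 0 := by
    have h : ((dil r⁻¹ : H n →L[ℝ] H n) : H n →ₗ[ℝ] H n) ∘ₗ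
        ((dil r : H n →L[ℝ] H n) : H n →ₗ[ℝ] H n) = LinearMap.id :=
      LinearMap.ext fun x => dil_inv_dil hr x
    have h2 := congrArg LinearMap.det h
    rw [LinearMap.det_comp, LinearMap.det_id] at h2
    exact right_ne_zero_of_mul_eq_one h2
  have hmap := Measure.map_linearMap_addHaar_eq_smul_addHaar (vol n) hdet
  have hemb : MeasurableEmbedding (dil r : H n → H n) :=
    (⟨⟨dil r, dil r⁻¹, dil_inv_dil hr, fun x => by
      simpa using dil_inv_dil (inv_ne_zero hr) x⟩, (dil _).continuous,
      (dil _).continuous⟩ : H n ≃ₜ H n).measurableEmbedding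
  refine ⟨|(LinearMap.det ((dil r : H n →L[ℝ] H n) : H n →ₗ[ℝ] H n))⁻¹|, fun F => ?_⟩
  rw [← hemb.integral_map]
  have hmap' : Measure.map (dil r) (vol n) = _ := hmap
  rw [hmap', integral_smul_measure, ENNReal.toReal_ofReal (abs_nonneg _), Complex.real_smul]

theorem quad_smul (r : ℝ) (z : Fin n → ℂ) : quad lam (r • z) = r ^ 2 * quad lam z := by
  rw [quad, quad, Finset.mul_sum]
  refine Finset.sum_congr rfl fun j _ => ?_
  rw [Pi.smul_apply, norm_smul, mul_pow, Real.norm_eq_abs, sq_abs]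
  ring

theorem aker_dil (hε : 0 ≤ ε) (x : H n) :
    aker lam σ ε (dil (√ε) x) = ε * aker lam σ 1 x := by
  rw [aker, aker, dil_apply, quad_smul, Real.sq_sqrt hε]
  push_cast
  ring

theorem poisKer_dil (hε : 0 < ε) (x : H n) :
    poisKer lam σ ε (dil (√ε) x) = ((ε ^ (n + 1))⁻¹ : ℝ) * poisKer lam σ 1 x := by
  have h0 : (ε : ℂ) ≠ 0 := by exact_mod_cast hε.ne'
  rw [poisKer, poisKer, aker_dil hε.le, aker_dil hε.le, mul_pow]
  push_cast
  field_simp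

theorem integral_poisKer_mul (hlam : ∀ j, lam j ≠ 0) (hσ : σ ^ 2 = 1) (hε : 0 < ε)
    (h : H n → ℂ) : ∫ x, poisKer lam σ ε x * h x ∂(vol n) =
      ∫ x, poisKer lam σ 1 x * h (dil (√ε) x) ∂(vol n) := by
  obtain ⟨c, hc⟩ := exists_integral_dil (n := n) (Real.sqrt_pos.2 hε).ne'
  have h1 := hc (poisKer lam σ ε)
  simp only [poisKer_dil hε] at h1
  rw [integral_const_mul, integral_poisKer hlam hσ hε, integral_poisKer hlam hσ one_pos] at h1
  have hprod : 0 < ∏ j, |lam j| := Finset.prod_pos fun j _ => abs_pos.2 (hlam j)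
  have hf : (n.factorial : ℝ) ≠ 0 := Nat.cast_ne_zero.2 (Nat.factorial_ne_zero n)
  have hne : (((2 * Real.pi ^ (n + 1)) / ((∏ j, |lam j|) * n.factorial) : ℝ) : ℂ) ≠ 0 := by
    rw [Complex.ofReal_ne_zero]
    positivity
  -- The mass does not depend on ε, which forces the Jacobian to be ε^{-(n+1)}.
  have hcε := mul_right_cancel₀ hne h1
  have h2 := hc (fun x => poisKer lam σ ε x * h x)
  simp only [poisKer_dil hε] at h2
  rw [← hcε] at h2
  have hε' : (((ε ^ (n + 1))⁻¹ : ℝ) : ℂ) ≠ 0 := by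
    rw [Complex.ofReal_ne_zero]
    positivity
  simp only [mul_assoc] at h2
  rw [integral_const_mul] at h2
  exact (mul_left_cancel₀ hε' h2).symm

theorem tendsto_integral_poisKer_mul (hlam : ∀ j, lam j ≠ 0) (hσ : σ ^ 2 = 1) {h : H n → ℂ}
    (hc : Continuous h) {M : ℝ} (hM : ∀ x, ‖h x‖ ≤ M) :
    Tendsto (fun ε => ∫ x, poisKer lam σ ε x * h x ∂(vol n)) (𝓝[>] 0)
      (𝓝 ((((2 * Real.pi ^ (n + 1)) / ((∏ j, |lam j|) * n.factorial) : ℝ) : ℂ) * h 0)) := by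
  have hint := integrable_poisKer hlam hσ one_pos (lam := lam)
  have h1 : Tendsto (fun ε => ∫ x, poisKer lam σ 1 x * h (dil (√ε) x) ∂(vol n)) (𝓝[>] 0)
      (𝓝 (∫ x, poisKer lam σ 1 x * h 0 ∂(vol n))) := by
    refine tendsto_integral_filter_of_dominated_convergence
      (fun x => ‖poisKer lam σ 1 x‖ * M) ?_ ?_ (hint.norm.mul_const M) ?_
    · exact Eventually.of_forall fun ε => ((contDiff_poisKer one_pos).continuous.mul
        (hc.comp (dil _).continuous)).aestronglyMeasurable
    · refine Eventually.of_forall fun ε => Eventually.of_forall fun x => ?_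
      rw [norm_mul]
      exact mul_le_mul_of_nonneg_left (hM _) (norm_nonneg _)
    · refine Eventually.of_forall fun x => Tendsto.const_mul _ ?_
      have hd : Continuous fun ε : ℝ => dil (√ε) x := by
        simp only [dil_apply]
        fun_prop
      have := (hc.comp hd).tendsto 0
      have h0 : dil (√0) x = 0 := by simp [dil_apply]
      rw [Function.comp_apply, h0] at this
      exact this.mono_left nhdsWithin_le_nhds
  rw [integral_mul_const, integral_poisKer hlam hσ one_pos] at h1
  refine h1.congr' ?_
  filter_upwards [self_mem_nhdsWithin] with ε hε
  exact (integral_poisKer_mul hlam hσ hε h).symm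

end Total

/-! ### Boundary values through a logarithmic potential -/

section LogKernel

variable {lam : Fin n → ℝ} {s ε : ℝ}

/-- A primitive of the logarithm. -/
noncomputable def logPrim (w : ℂ) : ℂ := w * Complex.log w - w

theorem measurable_logPrim : Measurable logPrim :=
  (measurable_id.mul Complex.measurable_log).sub measurable_id

theorem norm_logPrim_le (w : ℂ) : ‖logPrim w‖ ≤ 1 + ‖w‖ ^ 2 + (Real.pi + 1) * ‖w‖ := by
  have h1 : ‖Complex.log w‖ ≤ |Real.log ‖w‖| + Real.pi := by
    refine (Complex.norm_le_abs_re_add_abs_im _).trans (add_le_add (by rw [Complex.log_re]) ?_)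
    rw [Complex.log_im]
    exact Complex.abs_arg_le_pi w
  have h2 : ‖w‖ * |Real.log ‖w‖| ≤ 1 + ‖w‖ ^ 2 := by
    rcases eq_or_lt_of_le (norm_nonneg w) with h | h
    · rw [← h]; norm_num
    · rcases le_total ‖w‖ 1 with h1 | h1
      · have := (Real.abs_log_mul_self_lt ‖w‖ h h1).le
        rw [abs_mul, abs_of_pos h, mul_comm] at this
        nlinarith [sq_nonneg ‖w‖]
      · rw [abs_of_nonneg (Real.log_nonneg h1)]
        have := Real.log_le_sub_one_of_pos h
        nlinarith
  calc ‖logPrim w‖ ≤ ‖w‖ * ‖Complex.log w‖ + ‖w‖ := by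
        rw [logPrim, ← norm_mul]; exact norm_sub_le _ _
    _ ≤ ‖w‖ * (|Real.log ‖w‖| + Real.pi) + ‖w‖ := by gcongr
    _ ≤ _ := by linarith

theorem hasDerivAt_logPrim {w : ℂ} (hw : w ∈ Complex.slitPlane) :
    HasDerivAt logPrim (Complex.log w) w := by
  have h := ((hasDerivAt_id w).mul (Complex.hasDerivAt_log hw)).sub (hasDerivAt_id w)
  refine h.congr_deriv ?_
  have : w ≠ 0 := Complex.slitPlane_ne_zero hw
  simp [this]

theorem Dt_comp {Φ : ℂ → ℂ} {Φ' : ℂ} {f : H n → ℂ} {x : H n} (hΦ : HasDerivAt Φ Φ' (f x))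
    (hf : DifferentiableAt ℝ f x) : Dt (fun y => Φ (f y)) x = Φ' * Dt f x := by
  have h := (hΦ.hasFDerivAt.restrictScalars ℝ).comp x hf.hasFDerivAt
  have h2 : fderiv ℝ (fun y => Φ (f y)) x = _ := h.fderiv
  rw [Dt, h2]
  simp [Dt, mul_comm]

theorem Dt_aker (x : H n) : Dt (aker lam s ε) x = Complex.I * s := by
  rw [Dt, (hasFDerivAt_aker x).fderiv]
  simp

theorem aker_mem_slitPlane (hε : 0 < ε) (x : H n) : aker lam s ε x ∈ Complex.slitPlane := by
  left
  rw [aker_re]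
  linarith [quad_nonneg lam x.1]

theorem contDiff_log_aker (hε : 0 < ε) :
    ContDiff ℝ ∞ (fun x : H n => Complex.log (aker lam s ε x)) := by
  rw [contDiff_iff_contDiffAt]
  intro x
  exact ((Complex.contDiffAt_log (aker_mem_slitPlane hε x)).restrict_scalars ℝ).comp x
    contDiff_aker.contDiffAt

theorem contDiff_logPrim_aker (hε : 0 < ε) :
    ContDiff ℝ ∞ (fun x : H n => logPrim (aker lam s ε x)) :=
  (contDiff_aker.mul (contDiff_log_aker hε)).sub contDiff_aker

/-- `logPrim` is a second primitive of 1/w and a has t-derivative is, so two integrations by parts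
apply; the sign is (is)² = -1. -/
theorem integral_inv_aker_mul (hs : s ^ 2 = 1) (hε : 0 < ε) {ψ : H n → ℂ} (hψ : IsTest ψ) :
    ∫ x, (aker lam s ε x)⁻¹ * ψ x ∂(vol n) =
      -∫ x, logPrim (aker lam s ε x) * Dt (Dt ψ) x ∂(vol n) := by
  have hs' : (s : ℂ) ^ 2 = 1 := by exact_mod_cast hs
  have h1 := integral_Dt_mul hψ.Dt (contDiff_logPrim_aker (lam := lam) (s := s) hε)
  have h2 := integral_Dt_mul hψ (contDiff_log_aker (lam := lam) (s := s) hε)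
  have e1 : ∀ x : H n, Dt (fun x => logPrim (aker lam s ε x)) x =
      Complex.log (aker lam s ε x) * (Complex.I * s) := fun x => by
    rw [Dt_comp (hasDerivAt_logPrim (aker_mem_slitPlane hε x)) (differentiable_aker x), Dt_aker]
  have e2 : ∀ x : H n, Dt (fun x => Complex.log (aker lam s ε x)) x =
      (aker lam s ε x)⁻¹ * (Complex.I * s) := fun x => by
    rw [Dt_comp (Complex.hasDerivAt_log (aker_mem_slitPlane hε x)) (differentiable_aker x),
      Dt_aker]
  simp only [e1, e2, ← mul_assoc, integral_mul_const] at h1 h2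
  simp only [mul_comm _ (ψ _), mul_comm _ (Dt (Dt ψ) _)]
  rw [h1, h2]
  linear_combination (∫ x, ψ x * (aker lam s ε x)⁻¹ ∂(vol n)) * (s ^ 2 * Complex.I_sq - hs')

theorem integral_inv_pow_aker_mul (hs : s ^ 2 = 1) (hε : 0 < ε) {ψ : H n → ℂ} (hψ : IsTest ψ)
    (m : ℕ) : ∫ x, (aker lam s ε x ^ (m + 2))⁻¹ * ψ x ∂(vol n) =
      ((m + 1) * (Complex.I * s))⁻¹ *
        ∫ x, (aker lam s ε x ^ (m + 1))⁻¹ * Dt ψ x ∂(vol n) := by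
  have hs0 : (s : ℂ) ≠ 0 := by
    rintro h
    have : s = 0 := by exact_mod_cast h
    simp [this] at hs
  have hm : (m + 1 : ℂ) ≠ 0 := by exact_mod_cast Nat.succ_ne_zero m
  have h1 := integral_Dt_mul hψ (contDiff_inv_pow_aker (lam := lam) (σ := s) hε (m + 1))
  have e1 : ∀ x : H n, Dt (fun x => (aker lam s ε x ^ (m + 1))⁻¹) x =
      (aker lam s ε x ^ (m + 2))⁻¹ * (-((m + 1) * (Complex.I * s))) := fun x => by
    have hne := aker_ne_zero (lam := lam) (σ := s) hε x
    have hd : HasDerivAt (fun w : ℂ => (w ^ (m + 1))⁻¹)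
        (-(m + 1) * (aker lam s ε x ^ (m + 2))⁻¹) (aker lam s ε x) := by
      refine ((hasDerivAt_pow (m + 1) (aker lam s ε x)).fun_inv (pow_ne_zero _ hne)).congr_deriv ?_
      push_cast
      field_simp
      ring
    rw [Dt_comp hd (differentiable_aker x), Dt_aker]
    ring
  simp only [e1, ← mul_assoc, integral_mul_const] at h1
  simp only [mul_comm _ (ψ _), mul_comm _ (Dt ψ _)]
  rw [h1]
  field_simp

theorem IsTest.iterate_Dt {ψ : H n → ℂ} (hψ : IsTest ψ) (m : ℕ) : IsTest (Heisenberg.Dt^[m] ψ) := by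
  induction m with
  | zero => exact hψ
  | succ m ih =>
    rw [Function.iterate_succ_apply']
    exact ih.Dt

/-- The constant is independent of ε, so the limit ε → 0 concerns only `logPrim`, which stays
bounded near 0, unlike the negative powers. -/
theorem exists_integral_inv_pow_aker (hs : s ^ 2 = 1) (m : ℕ) : ∃ c : ℂ, ∀ ε : ℝ, 0 < ε →
    ∀ ψ : H n → ℂ, IsTest ψ → ∫ x, (aker lam s ε x ^ (m + 1))⁻¹ * ψ x ∂(vol n) =
      c * ∫ x, logPrim (aker lam s ε x) * Dt^[m + 2] ψ x ∂(vol n) := by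
  induction m with
  | zero =>
    refine ⟨-1, fun ε hε ψ hψ => ?_⟩
    simp only [zero_add, pow_one]
    rw [integral_inv_aker_mul hs hε hψ, neg_one_mul]
    rfl
  | succ m ih =>
    obtain ⟨c, hc⟩ := ih
    refine ⟨((m + 1) * (Complex.I * s))⁻¹ * c, fun ε hε ψ hψ => ?_⟩
    rw [integral_inv_pow_aker_mul hs hε hψ, hc ε hε _ hψ.Dt, mul_assoc]
    rfl

theorem iterate_Dt_gmul_left {f : H n → ℂ} (hf : IsTest f) (x : H n) (m : ℕ) :
    Dt^[m] (fun y => f (gmul lam x y)) = fun y => Dt^[m] f (gmul lam x y) := by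
  induction m with
  | zero => rfl
  | succ m ih =>
    funext y
    rw [Function.iterate_succ_apply', Function.iterate_succ_apply', ih,
      Dt_gmul_left _ _ ((hf.iterate_Dt m).1.differentiable (by simp) _)]

theorem exists_test_norm_le {g : H n → ℂ} (hg : IsTest g) :
    ∃ G : H n → ℝ, IsTest (fun x => (G x : ℂ)) ∧ ∀ x, ‖g x‖ ≤ G x := by
  obtain ⟨C, hC⟩ := hg.bounded
  obtain ⟨R, hR⟩ := hg.2.isCompact.isBounded.subset_closedBall (0 : H n)
  let B : ContDiffBump (0 : H n) := ⟨|R| + 1, |R| + 2, by positivity, by linarith⟩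
  refine ⟨fun x => C * B x, ?_, fun x => ?_⟩
  · have hB : IsTest (fun x => ((B x : ℝ) : ℂ)) := ⟨Complex.ofRealCLM.contDiff.comp B.contDiff,
      B.hasCompactSupport.comp_left (g := fun r : ℝ => (r : ℂ)) (by simp)⟩
    simpa using hB.mul_left (contDiff_const (c := (C : ℂ)))
  · by_cases hx : x ∈ tsupport g
    · have h1 : x ∈ Metric.closedBall (0 : H n) (|R| + 1) :=
        Metric.closedBall_subset_closedBall (by linarith [le_abs_self R]) (hR hx)
      simpa only [B.one_of_mem_closedBall h1, mul_one] using hC x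
    · rw [image_eq_zero_of_notMem_tsupport hx, norm_zero]
      exact mul_nonneg ((norm_nonneg _).trans (hC 0)) B.nonneg

theorem aker_eq_add (ε : ℝ) (x : H n) : aker lam s ε x = ε + aker lam s 0 x := by
  simp only [aker]
  push_cast
  ring

/-- A continuous majorant of the logarithmic kernels for `0 < ε ≤ 1`. -/
noncomputable def logBound (lam : Fin n → ℝ) (s : ℝ) (x : H n) : ℝ :=
  1 + (1 + ‖aker lam s 0 x‖) ^ 2 + (Real.pi + 1) * (1 + ‖aker lam s 0 x‖)

theorem continuous_logBound : Continuous (logBound lam s) := by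
  have := continuous_aker (lam := lam) (σ := s) (ε := 0)
  unfold logBound
  fun_prop

theorem norm_logPrim_aker_le (h0 : 0 ≤ ε) (h1 : ε ≤ 1) (x : H n) :
    ‖logPrim (aker lam s ε x)‖ ≤ logBound lam s x := by
  have h : ‖aker lam s ε x‖ ≤ 1 + ‖aker lam s 0 x‖ := by
    rw [aker_eq_add ε]
    refine (norm_add_le _ _).trans ?_
    rw [Complex.norm_real, Real.norm_of_nonneg h0]
    gcongr
  refine (norm_logPrim_le _).trans ?_
  unfold logBound
  have := Real.pi_pos
  gcongr

theorem measurable_logPrim_aker : Measurable fun x : H n => logPrim (aker lam s ε x) :=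
  measurable_logPrim.comp continuous_aker.measurable

theorem locallyIntegrable_logPrim_aker :
    LocallyIntegrable (fun x : H n => logPrim (aker lam s 0 x)) (vol n) :=
  (continuous_logBound (lam := lam) (s := s)).locallyIntegrable.mono
    measurable_logPrim_aker.aestronglyMeasurable (Eventually.of_forall fun x =>
      (norm_logPrim_aker_le le_rfl zero_le_one x).trans (le_abs_self _))

theorem tendsto_logPrim_aker (hlam : ∀ j, lam j ≠ 0) (hs : s ^ 2 = 1) {x : H n} (hx : x ≠ 0) :
    Tendsto (fun ε => logPrim (aker lam s ε x)) (𝓝[>] 0) (𝓝 (logPrim (aker lam s 0 x))) := by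
  -- Away from the identity the limit avoids the cut: t ≠ 0 makes the imaginary part nonzero, and z
  -- ≠ 0 makes the real part positive.
  have hmem : aker lam s 0 x ∈ Complex.slitPlane := by
    rcases eq_or_ne x.2 0 with h | h
    · left
      rw [aker_re, zero_add]
      have hz : x.1 ≠ 0 := fun hz => hx (Prod.ext hz h)
      have h1 := norm_sq_le_mul_quad hlam x.1
      have h2 : 0 < ‖x.1‖ ^ 2 := by positivity
      have h3 : 0 ≤ ∑ j, |lam j|⁻¹ := Finset.sum_nonneg fun _ _ => by positivity
      by_contra h4
      have h5 : quad lam x.1 = 0 := le_antisymm (not_lt.1 h4) (quad_nonneg _ _)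
      rw [h5, mul_zero] at h1
      linarith
    · right
      rw [aker_im]
      refine mul_ne_zero ?_ h
      rintro rfl
      simp at hs
  have h1 : Continuous fun ε : ℝ => aker lam s ε x := by
    unfold aker
    fun_prop
  exact ((hasDerivAt_logPrim hmem).continuousAt.tendsto.comp (h1.tendsto 0)).mono_left
    nhdsWithin_le_nhds

/-- The regularized Cauchy-Szegő integral. -/
noncomputable def szegoInt (lam : Fin n → ℝ) (σ ε : ℝ) (f : H n → ℂ) (x : H n) : ℂ :=
  ∫ y, szegoKer lam σ ε (gmul lam (-y) x) * f y ∂(vol n)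

theorem aker_neg (σ : ℝ) (x : H n) : aker lam σ ε (-x) = aker lam (-σ) ε x := by
  have : quad lam (-x.1) = quad lam x.1 := by simp [quad]
  simp [aker, this]

theorem szegoInt_eq (σ : ℝ) (f : H n → ℂ) (x : H n) :
    szegoInt lam σ ε f x =
      ∫ y, (aker lam (-σ) ε y ^ (n + 1))⁻¹ * f (gmul lam x y) ∂(vol n) := by
  rw [szegoInt, ← integral_gmul_left (lam := lam) x]
  refine integral_congr_ae (Eventually.of_forall fun y => ?_)
  beta_reduce
  rw [neg_gmul, gmul_assoc, neg_gmul_self, gmul_zero, szegoKer, aker_neg]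

/-- The boundary values of the Cauchy-Szegő integral of a test function. -/
theorem exists_tendsto_szegoInt (hlam : ∀ j, lam j ≠ 0) {σ : ℝ} (hσ : σ ^ 2 = 1) {f : H n → ℂ}
    (hf : IsTest f) : ∃ F : H n → ℂ, ContDiff ℝ ∞ F ∧
      (∀ x, Tendsto (fun ε => szegoInt lam σ ε f x) (𝓝[>] 0) (𝓝 (F x))) ∧
      ∀ χ, IsTest χ → Tendsto (fun ε => ∫ x, szegoInt lam σ ε f x * χ x ∂(vol n)) (𝓝[>] 0)
        (𝓝 (∫ x, F x * χ x ∂(vol n))) := by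
  have hs : (-σ) ^ 2 = 1 := by rw [neg_sq, hσ]
  obtain ⟨c, hc⟩ := exists_integral_inv_pow_aker (lam := lam) hs n
  set g := Dt^[n + 2] f with hg
  have hgt : IsTest g := hf.iterate_Dt _
  -- After translation x occurs only in the test function, and ∂/∂t is left invariant, so the
  -- derivatives land on f itself.
  have key : ∀ ε, 0 < ε → ∀ x, szegoInt lam σ ε f x =
      c * ∫ y, logPrim (aker lam (-σ) ε y) * g (gmul lam x y) ∂(vol n) := by
    intro ε hε x
    rw [szegoInt_eq, hc ε hε _ (hf.gmul_left x), iterate_Dt_gmul_left hf]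
  obtain ⟨G, hG, hgG⟩ := exists_test_norm_le hgt
  have hbl : LocallyIntegrable (fun x : H n => ((logBound lam (-σ) x : ℝ) : ℂ)) (vol n) :=
    (Complex.continuous_ofReal.comp continuous_logBound).locallyIntegrable
  have hbi : ∀ x, Integrable (fun y => logBound lam (-σ) y * G (gmul lam x y)) (vol n) := by
    intro x
    have h1 : Continuous fun y => ((logBound lam (-σ) y : ℝ) : ℂ) * (G (gmul lam x y) : ℂ) :=
      (Complex.continuous_ofReal.comp continuous_logBound).mul (hG.gmul_left x).1.continuous
    have h2 := (h1.integrable_of_hasCompactSupport (μ := vol n) (hG.gmul_left x).2.mul_left).re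
    refine h2.congr (Eventually.of_forall fun y => ?_)
    simp [← Complex.ofReal_mul]
  have hbd : ∀ ε, 0 ≤ ε → ε ≤ 1 → ∀ x y, ‖logPrim (aker lam (-σ) ε y) * g (gmul lam x y)‖ ≤
      logBound lam (-σ) y * G (gmul lam x y) := by
    intro ε h0 h1 x y
    rw [norm_mul]
    exact mul_le_mul (norm_logPrim_aker_le h0 h1 y) (hgG _) (norm_nonneg _)
      ((norm_nonneg _).trans (norm_logPrim_aker_le h0 h1 y))
  have hev : ∀ᶠ ε : ℝ in 𝓝[>] 0, 0 < ε ∧ ε ≤ 1 := by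
    filter_upwards [Ioc_mem_nhdsGT (zero_lt_one' ℝ)] with ε hε using hε
  have hF : ContDiff ℝ ∞ (fun x => c * ∫ y, logPrim (aker lam (-σ) 0 y) * g (gmul lam x y)
      ∂(vol n)) :=
    contDiff_const.mul (contDiff_integral_gmul locallyIntegrable_logPrim_aker hgt)
  have hlim : ∀ x, Tendsto (fun ε => szegoInt lam σ ε f x) (𝓝[>] 0)
      (𝓝 (c * ∫ y, logPrim (aker lam (-σ) 0 y) * g (gmul lam x y) ∂(vol n))) := by
    intro x
    have h1 : Tendsto (fun ε => ∫ y, logPrim (aker lam (-σ) ε y) * g (gmul lam x y) ∂(vol n))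
        (𝓝[>] 0) (𝓝 (∫ y, logPrim (aker lam (-σ) 0 y) * g (gmul lam x y) ∂(vol n))) := by
      refine tendsto_integral_filter_of_dominated_convergence _
        (Eventually.of_forall fun ε => measurable_logPrim_aker.aestronglyMeasurable.mul
          (hgt.gmul_left x).1.continuous.aestronglyMeasurable) ?_ (hbi x) ?_
      · filter_upwards [hev] with ε hε
        exact Eventually.of_forall fun y => hbd ε hε.1.le hε.2 x y
      · have hne : ∀ᵐ y ∂(vol n), y ≠ (0 : H n) := by
          simp [ae_iff]
        filter_upwards [hne] with y hy
        exact (tendsto_logPrim_aker hlam hs hy).mul_const _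
    refine (h1.const_mul c).congr' ?_
    filter_upwards [self_mem_nhdsWithin] with ε hε
    exact (key ε hε x).symm
  refine ⟨_, hF, hlim, fun χ hχ => ?_⟩
  -- A majorant of the regularized integrals that is continuous in x and independent of ε;
  -- multiplied by |χ| it dominates the pairing with χ.
  have hcG : Continuous fun x => ‖c‖ * (∫ y, ((logBound lam (-σ) y : ℝ) : ℂ) *
      (G (gmul lam x y) : ℂ) ∂(vol n)).re :=
    continuous_const.mul (Complex.continuous_re.comp (contDiff_integral_gmul hbl hG).continuous)
  refine tendsto_integral_filter_of_dominated_convergence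
    (fun x => (‖c‖ * (∫ y, ((logBound lam (-σ) y : ℝ) : ℂ) *
      (G (gmul lam x y) : ℂ) ∂(vol n)).re) * ‖χ x‖) ?_ ?_ ?_ ?_
  · filter_upwards [self_mem_nhdsWithin] with ε hε
    have : szegoInt lam σ ε f = fun x =>
        c * ∫ y, logPrim (aker lam (-σ) ε y) * g (gmul lam x y) ∂(vol n) := funext (key ε hε)
    rw [this]
    exact ((continuous_const.mul (contDiff_integral_gmul
      (contDiff_logPrim_aker hε).continuous.locallyIntegrable hgt).continuous).mul
      hχ.1.continuous).aestronglyMeasurable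
  · filter_upwards [hev] with ε hε
    refine Eventually.of_forall fun x => ?_
    rw [norm_mul, key ε hε.1, norm_mul]
    refine mul_le_mul_of_nonneg_right (mul_le_mul_of_nonneg_left ?_ (norm_nonneg _))
      (norm_nonneg _)
    have e : (∫ y, ((logBound lam (-σ) y : ℝ) : ℂ) * (G (gmul lam x y) : ℂ) ∂(vol n)) =
        ((∫ y, logBound lam (-σ) y * G (gmul lam x y) ∂(vol n) : ℝ) : ℂ) := by
      rw [← integral_complex_ofReal]
      simp
    rw [e, Complex.ofReal_re]
    exact (norm_integral_le_integral_norm _).trans (integral_mono_of_nonneg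
      (Eventually.of_forall fun y => norm_nonneg _) (hbi x)
      (Eventually.of_forall fun y => hbd ε hε.1.le hε.2 x y))
  · exact (hcG.mul hχ.1.continuous.norm).integrable_of_hasCompactSupport hχ.2.norm.mul_left
  · exact Eventually.of_forall fun x => (hlim x).mul_const _

end LogKernel

end Heisenberg

/-! ### The projection onto the joint null space -/

namespace Heisenberg
variable {n : ℕ}

theorem inner_Lp_eq (w k : Lp ℂ 2 (vol n)) :
    inner ℂ w k = ∫ x, k x * conj (w x) ∂(vol n) := by
  rw [L2.inner_def]
  rfl

/-- The span of the functions conjugate to `W χ`, with `χ` a test function. -/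
noncomputable def testSpan (lam tau : Fin n → ℝ) : Submodule ℂ (Lp ℂ 2 (vol n)) :=
  Submodule.span ℂ {w | ∃ j χ, IsTest χ ∧ w =ᵐ[vol n] fun x => conj (W lam (tau j) j χ x)}

/-- The square integrable functions annihilated by the vector fields `W lam (tau j) j`. -/
noncomputable abbrev solSpace (lam tau : Fin n → ℝ) : Submodule ℂ (Lp ℂ 2 (vol n)) :=
  (testSpan lam tau)ᗮ

variable {lam tau : Fin n → ℝ} {σ ε : ℝ}

/-- Taking an orthogonal complement makes the space closed, so it has a projection; the conjugates
in `testSpan` turn the inner product into the weak pairing. -/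
theorem mem_solSpace_iff {k : Lp ℂ 2 (vol n)} :
    k ∈ solSpace lam tau ↔ ∀ j, WeakNull lam (tau j) j k := by
  rw [solSpace, testSpan, Submodule.mem_orthogonal]
  constructor
  · intro h j χ hχ
    have hW : IsTest (fun x => conj (W lam (tau j) j χ x)) := (hχ.W lam (tau j) j).conj
    have h1 := h _ (Submodule.subset_span ⟨j, χ, hχ, (hW.memLp 2).coeFn_toLp⟩)
    rw [inner_Lp_eq] at h1
    rw [← h1]
    refine integral_congr_ae ?_
    filter_upwards [(hW.memLp 2).coeFn_toLp] with x hx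
    rw [hx, Complex.conj_conj]
  · intro h w hw
    induction hw using Submodule.span_induction with
    | mem w hw =>
      obtain ⟨j, χ, hχ, hw⟩ := hw
      rw [inner_Lp_eq, ← h j χ hχ]
      refine integral_congr_ae ?_
      filter_upwards [hw] with x hx
      rw [hx, Complex.conj_conj]
    | zero => exact inner_zero_left _
    | add v w _ _ hv hw => rw [inner_add_left, hv, hw, add_zero]
    | smul c v _ hv => rw [inner_smul_left, hv, mul_zero]

theorem contDiff_comp_gmul {f : H n → ℂ} (hf : ContDiff ℝ ∞ f) (y : H n) :
    ContDiff ℝ ∞ fun x => f (gmul lam y x) :=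
  hf.comp (ContDiff.gmul contDiff_const contDiff_id)

theorem memLp_conj {k : H n → ℂ} (hk : MemLp k 2 (vol n)) :
    MemLp (fun x => conj (k x)) 2 (vol n) :=
  hk.star

/-- By `szegoKer_eq` the two kernels differ by W_{-τ}-derivatives of L² functions. Conjugation makes
these W_τ-derivatives, and k is weakly orthogonal to them. -/
theorem WeakNull.integral_conj_mul_szegoKer (hn : 0 < n) (hlam : ∀ j, lam j ≠ 0)
    (hσ : σ ^ 2 = 1) (htau : ∀ j, tau j ^ 2 = 1) (h : ∀ j, σ * tau j * lam j = |lam j|)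
    (hε : 0 < ε) {k : H n → ℂ} (hw : ∀ j, WeakNull lam (tau j) j k) (hk : MemLp k 2 (vol n))
    (y : H n) :
    ∫ x, szegoKer lam σ ε (gmul lam y x) * conj (k x) ∂(vol n) =
      ∫ x, poisKer lam σ ε (gmul lam y x) * conj (k x) ∂(vol n) := by
  have hk' := memLp_conj hk
  have hp : Integrable (fun x => poisKer lam σ ε (gmul lam y x) * conj (k x)) (vol n) :=
    (MemLp.gmul_left (memLp_poisKer hlam hσ hε) y).integrable_mul hk'
  have hq : ∀ j, Integrable (fun x => W lam (-tau j) j (primKer lam σ ε (tau j) j) (gmul lam y x) *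
      conj (k x)) (vol n) := fun j =>
    (MemLp.gmul_left (memLp_W_primKer hlam hσ hε (htau j) (h j)) y).integrable_mul hk'
  have hz : ∀ j, ∫ x, W lam (-tau j) j (primKer lam σ ε (tau j) j) (gmul lam y x) *
      conj (k x) ∂(vol n) = 0 := by
    intro j
    have hs := contDiff_primKer (lam := lam) (σ := σ) (j := j) hε (tau j)
    have hneg : (-tau j) ^ 2 = 1 := by rw [neg_sq, htau j]
    have e1 : ∀ x, W lam (tau j) j
        (fun x => conj (primKer lam σ ε (tau j) j (gmul lam y x))) x =
        conj (W lam (-tau j) j (primKer lam σ ε (tau j) j) (gmul lam y x)) := fun x => by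
      rw [W_conj, W_gmul_left hneg _ _ _ (hs.differentiable (by simp) _)]
    have h0 := (hw j).integral_eq_zero hk
      (h := fun x => conj (primKer lam σ ε (tau j) j (gmul lam y x)))
      (Complex.conjCLE.contDiff.comp (contDiff_comp_gmul hs y))
      (memLp_conj (MemLp.gmul_left (memLp_primKer hn hlam hσ hε (htau j)) y)) (by
        simp_rw [funext e1]
        exact memLp_conj (MemLp.gmul_left (memLp_W_primKer hlam hσ hε (htau j) (h j)) y))
    simp_rw [e1] at h0
    rw [← map_eq_zero (starRingEnd ℂ), ← integral_conj, ← h0]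
    refine integral_congr_ae (Eventually.of_forall fun x => ?_)
    simp [mul_comm]
  have hn' : (n : ℂ) ≠ 0 := by exact_mod_cast hn.ne'
  refine mul_left_cancel₀ hn' ?_
  rw [← integral_const_mul, ← integral_const_mul]
  simp_rw [← mul_assoc, szegoKer_eq hε htau h, sub_mul, Finset.sum_mul]
  rw [integral_sub, integral_finsetSum _ fun j _ => hq j, Finset.sum_eq_zero fun j _ => hz j,
    sub_zero]
  · simpa only [mul_assoc] using hp.const_mul (n : ℂ)
  · exact integrable_finsetSum _ fun j _ => hq j

theorem szegoKer_translate_mem (htau : ∀ j, tau j ^ 2 = 1) (h : ∀ j, σ * tau j * lam j = |lam j|) (hε : 0 < ε) (y : H n)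
    {k : Lp ℂ 2 (vol n)} (hk : k =ᵐ[vol n] fun x => szegoKer lam σ ε (gmul lam y x)) :
    k ∈ solSpace lam tau := by
  rw [mem_solSpace_iff]
  intro j χ hχ
  have hs : ContDiff ℝ ∞ fun x => szegoKer lam σ ε (gmul lam y x) :=
    contDiff_comp_gmul (contDiff_szegoKer hε) y
  rw [← weakNull_of_forall_eq_zero (lam := lam) (τ := tau j) (j := j) hs (fun x => ?_) χ hχ]
  · refine integral_congr_ae ?_
    filter_upwards [hk] with x hx
    rw [hx]
  · rw [W_gmul_left (htau j) _ _ _ ((contDiff_szegoKer hε).differentiable (by simp) _),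
      W_szegoKer_eq_zero hε (h j)]

theorem memLp_comp_neg {k : H n → ℂ} (hk : MemLp k 2 (vol n)) :
    MemLp (fun x => k (-x)) 2 (vol n) :=
  hk.comp_measurePreserving (Measure.measurePreserving_neg (vol n))

theorem IsTest.comp_neg {f : H n → ℂ} (hf : IsTest f) : IsTest fun x => f (-x) :=
  ⟨hf.1.comp contDiff_neg, hf.2.comp_homeomorph (Homeomorph.neg (H n))⟩

theorem integral_gmul_neg_mul (f k : H n → ℂ) (x : H n) :
    ∫ g, f (-g) * k (gmul lam g x) ∂(vol n) = ∫ g, k g * f (gmul lam x (-g)) ∂(vol n) := by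
  rw [← integral_gmul_right (lam := lam) (-x)]
  refine integral_congr_ae (Eventually.of_forall fun g => ?_)
  beta_reduce
  rw [neg_gmul, neg_neg, gmul_assoc, neg_gmul_self, gmul_zero, mul_comm]

/-- The pairing of the regularized Cauchy-Szegő integral with `conj w`, in terms of the projection
`k` of `w`. -/
theorem integral_szegoInt_mul (hn : 0 < n) (hlam : ∀ j, lam j ≠ 0)
    (hσ : σ ^ 2 = 1) (htau : ∀ j, tau j ^ 2 = 1) (h : ∀ j, σ * tau j * lam j = |lam j|)
    (hε : 0 < ε) {f : H n → ℂ} (hf : IsTest f) (w : Lp ℂ 2 (vol n)) :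
    ∫ x, szegoInt lam σ ε f x * conj (w x) ∂(vol n) =
      ∫ g, poisKer lam σ ε g *
        ∫ x, conj ((solSpace lam tau).starProjection w x) * f (gmul lam x (-g)) ∂(vol n)
          ∂(vol n) := by
  set k := (solSpace lam tau).starProjection w with hk
  have hkN : k ∈ solSpace lam tau := Submodule.starProjection_apply_mem _ _
  -- Translates of the Szegő kernel lie in `solSpace`, so w can be replaced by its projection k;
  -- against k the Poisson type kernel may be used instead.
  have hproj : ∀ y : H n, ∫ x, szegoKer lam σ ε (gmul lam y x) * conj (w x) ∂(vol n) =
      ∫ x, poisKer lam σ ε (gmul lam y x) * conj (k x) ∂(vol n) := by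
    intro y
    rw [← WeakNull.integral_conj_mul_szegoKer hn hlam hσ htau h hε (mem_solSpace_iff.1 hkN)
      (Lp.memLp k) y]
    have hm := MemLp.gmul_left (lam := lam) (memLp_szegoKer hlam hσ hε) y
    have hmem := szegoKer_translate_mem htau h hε y hm.coeFn_toLp
    have e1 : ∀ v : Lp ℂ 2 (vol n), inner ℂ v (hm.toLp _) =
        ∫ x, szegoKer lam σ ε (gmul lam y x) * conj (v x) ∂(vol n) := by
      intro v
      rw [inner_Lp_eq]
      refine integral_congr_ae ?_
      filter_upwards [hm.coeFn_toLp] with x hx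
      rw [hx]
    rw [← e1, ← e1, hk, Submodule.inner_starProjection_left_eq_right,
      Submodule.starProjection_eq_self_iff.2 hmem]
  have hSm : StronglyMeasurable (szegoKer lam σ ε : H n → ℂ) :=
    (contDiff_szegoKer hε).continuous.stronglyMeasurable
  have hPm : StronglyMeasurable (poisKer lam σ ε : H n → ℂ) :=
    (contDiff_poisKer hε).continuous.stronglyMeasurable
  have hk' := memLp_conj (Lp.memLp k)
  have hint : ∀ x, szegoInt lam σ ε f x =
      ∫ g, f (-g) * szegoKer lam σ ε (gmul lam g x) ∂(vol n) := by
    intro x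
    rw [szegoInt, ← integral_neg_eq_self]
    simp only [neg_neg, mul_comm]
  simp_rw [hint]
  rw [integral_prod_gmul_swap hf.comp_neg.integrable (memLp_szegoKer hlam hσ hε) hSm
    (memLp_conj (Lp.memLp w))]
  simp_rw [hproj]
  rw [← integral_prod_gmul_swap hf.comp_neg.integrable (memLp_poisKer hlam hσ hε) hPm hk']
  -- The order of convolution is reversed so that the Poisson type kernel carries the outer
  -- variable; the inversion x ↦ -x only serves to bring the integrand into the form required by
  -- `integral_prod_gmul_swap`.
  simp_rw [integral_gmul_neg_mul]
  rw [← integral_neg_eq_self]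
  have e2 : ∀ x g : H n, f (gmul lam (-x) (-g)) = f (-(gmul lam g x)) := fun x g => by
    rw [neg_gmul]
  simp_rw [e2]
  rw [integral_prod_gmul_swap (f := poisKer lam σ ε) (k := fun x => f (-x))
    (d := fun x => conj (k (-x))) (integrable_poisKer hlam hσ hε) (hf.comp_neg.memLp 2)
    hf.comp_neg.1.continuous.stronglyMeasurable (memLp_comp_neg hk')]
  refine integral_congr_ae (Eventually.of_forall fun g => ?_)
  beta_reduce
  congr 1
  rw [← integral_neg_eq_self]
  refine integral_congr_ae (Eventually.of_forall fun x => ?_)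
  beta_reduce
  rw [neg_gmul, neg_neg, mul_comm]

/-- The Cauchy-Szegő integral represents the orthogonal projection onto `solSpace`. -/
theorem exists_szego_limit (hn : 0 < n) (hlam : ∀ j, lam j ≠ 0)
    (hσ : σ ^ 2 = 1) (htau : ∀ j, tau j ^ 2 = 1) (h : ∀ j, σ * tau j * lam j = |lam j|)
    {f : H n → ℂ} (hf : IsTest f) {u : Lp ℂ 2 (vol n)} (hu : u =ᵐ[vol n] f) :
    ∃ F : H n → ℂ, ContDiff ℝ ∞ F ∧
      (∀ x, Tendsto (fun ε => szegoInt lam σ ε f x) (𝓝[>] 0) (𝓝 (F x))) ∧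
      ((((2 * Real.pi ^ (n + 1)) / ((∏ j, |lam j|) * n.factorial) : ℝ) : ℂ) •
        (solSpace lam tau).starProjection u : Lp ℂ 2 (vol n)) =ᵐ[vol n] F := by
  obtain ⟨F, hF, hlim, hweak⟩ := exists_tendsto_szegoInt hlam hσ hf
  refine ⟨F, hF, hlim, ?_⟩
  set C : ℂ := (((2 * Real.pi ^ (n + 1)) / ((∏ j, |lam j|) * n.factorial) : ℝ) : ℂ) with hC
  set P := (solSpace lam tau).starProjection with hP
  have hFl : LocallyIntegrable F (vol n) := hF.continuous.locallyIntegrable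
  have hPl : LocallyIntegrable (C • P u : Lp ℂ 2 (vol n)) (vol n) :=
    (Lp.memLp _).locallyIntegrable (by norm_num)
  -- The pairing of the regularized integral with χ has two limits: ∫ F χ by the boundary value
  -- theorem, and C times the pairing of u with the projection of conj χ by the approximate
  -- identity. Self-adjointness moves the projection to u.
  have key : ∀ χ, IsTest χ → ∫ x, F x * χ x ∂(vol n) = ∫ x, (C • P u : Lp ℂ 2 (vol n)) x * χ x
      ∂(vol n) := by
    intro χ hχ
    have hw := (hχ.conj.memLp 2).coeFn_toLp
    set w := (hχ.conj.memLp 2).toLp _ with hwdef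
    have e1 : ∀ v : H n → ℂ, ∫ x, v x * χ x ∂(vol n) = ∫ x, v x * conj (w x) ∂(vol n) := by
      intro v
      refine integral_congr_ae ?_
      filter_upwards [hw] with x hx
      rw [hx, Complex.conj_conj]
    refine tendsto_nhds_unique (hweak χ hχ) ?_
    have hkl : LocallyIntegrable (fun x => conj (P w x)) (vol n) :=
      (memLp_conj (Lp.memLp (P w))).locallyIntegrable (by norm_num)
    have hc : Continuous fun g => ∫ x, conj (P w x) * f (gmul lam x (-g)) ∂(vol n) :=
      (contDiff_integral_gmul_neg hkl hf).continuous
    have hb : ∀ g, ‖∫ x, conj (P w x) * f (gmul lam x (-g)) ∂(vol n)‖ ≤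
        ∫ x, ‖conj (P w x)‖ ^ 2 ∂(vol n) + ∫ x, ‖f x‖ ^ 2 ∂(vol n) := by
      intro g
      rw [← integral_gmul_right (lam := lam) (-g) (fun x => ‖f x‖ ^ 2)]
      exact (norm_integral_le_integral_norm _).trans
        (integral_norm_mul_le (memLp_conj (Lp.memLp (P w)))
          ((hf.memLp 2).comp_measurePreserving (measurePreserving_gmul_right (-g))))
    have hT := tendsto_integral_poisKer_mul hlam hσ hc hb
    have e2 : ∫ x, (C • P u : Lp ℂ 2 (vol n)) x * χ x ∂(vol n) =
        C * ∫ x, conj (P w x) * f (gmul lam x (-0)) ∂(vol n) := by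
      rw [e1, ← inner_Lp_eq, inner_smul_right, hP, ← Submodule.inner_starProjection_left_eq_right,
        inner_Lp_eq]
      congr 1
      refine integral_congr_ae ?_
      filter_upwards [hu] with x hx
      rw [hx, neg_zero, gmul_zero, mul_comm]
    rw [e2]
    refine hT.congr' ?_
    filter_upwards [self_mem_nhdsWithin] with ε hε
    rw [e1, integral_szegoInt_mul hn hlam hσ htau h hε hf w]
  have h0 := ae_eq_zero_of_forall_test (hPl.sub hFl) (fun χ hχ => by
    simp only [Pi.sub_apply, sub_mul]
    rw [integral_sub, key χ hχ, sub_self]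
    · exact (Lp.memLp _).integrable_mul (hχ.memLp 2)
    · exact (hF.continuous.mul hχ.1.continuous).integrable_of_hasCompactSupport hχ.2.mul_left)
  filter_upwards [h0] with x hx
  exact sub_eq_zero.1 hx

end Heisenberg

namespace Heisenberg
variable {n : ℕ}

/-! ### Passing between forms and their coefficients -/

section Coefficients

/-- The coefficient `u_J` of `u = ∑ u_J dz̄^J`. -/
noncomputable def coeff (J : Finset (Fin n)) : L2Forms n →L[ℂ] Lp ℂ 2 (vol n) :=
  (EuclideanSpace.proj J : Fiber n →L[ℂ] ℂ).compLpL 2 (vol n)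

/-- The form `k dz̄^J`. -/
noncomputable def embed (J : Finset (Fin n)) : Lp ℂ 2 (vol n) →L[ℂ] L2Forms n :=
  (ContinuousLinearMap.toSpanSingleton ℂ
    (EuclideanSpace.single J (1 : ℂ) : Fiber n)).compLpL 2 (vol n)

theorem coeff_ae (J : Finset (Fin n)) (u : L2Forms n) :
    coeff J u =ᵐ[vol n] fun x => u x J :=
  ContinuousLinearMap.coeFn_compLpL _ u

theorem embed_ae (J : Finset (Fin n)) (k : Lp ℂ 2 (vol n)) :
    embed J k =ᵐ[vol n] fun x => EuclideanSpace.single J (k x) := by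
  filter_upwards [ContinuousLinearMap.coeFn_compLpL (p := 2) (μ := vol n)
    (ContinuousLinearMap.toSpanSingleton ℂ (EuclideanSpace.single J (1 : ℂ) : Fiber n)) k]
    with x hx
  rw [embed, hx]
  ext i
  simp

theorem ext_coeff {u v : L2Forms n} (h : ∀ J, coeff J u = coeff J v) : u = v := by
  refine Lp.ext ?_
  have h1 : ∀ᵐ x ∂(vol n), ∀ J, u x J = v x J := by
    rw [ae_all_iff]
    intro J
    filter_upwards [coeff_ae J u, coeff_ae J v] with x hx hy
    rw [← hx, ← hy, h J]
  filter_upwards [h1] with x hx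
  ext J
  exact hx J

theorem coeff_embed_self (J : Finset (Fin n)) (k : Lp ℂ 2 (vol n)) :
    coeff J (embed J k) = k := by
  refine Lp.ext ?_
  filter_upwards [coeff_ae J (embed J k), embed_ae J k] with x hx hy
  rw [hx, hy]
  simp

theorem coeff_embed_of_ne {J K : Finset (Fin n)} (h : K ≠ J) (k : Lp ℂ 2 (vol n)) :
    coeff K (embed J k) = 0 := by
  refine Lp.ext ?_
  filter_upwards [coeff_ae K (embed J k), embed_ae J k, Lp.coeFn_zero ℂ 2 (vol n)] with x hx hy hz
  rw [hx, hy, hz]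
  simp [h]

theorem component_eq (J : Finset (Fin n)) (u : L2Forms n) :
    component J u = embed J (coeff J u) := by
  refine Lp.ext ?_
  filter_upwards [ContinuousLinearMap.coeFn_compLpL (p := 2) (μ := vol n) (fiberComponent J) u,
    embed_ae J (coeff J u), coeff_ae J u] with x h1 h2 h3
  rw [component, h1, h2, h3]
  ext i
  simp [fiberComponent]

theorem sum_embed_coeff (u : L2Forms n) : ∑ J, embed J (coeff J u) = u := by
  refine ext_coeff fun K => ?_
  rw [map_sum, Finset.sum_eq_single K (fun J _ hJ => coeff_embed_of_ne hJ.symm _) (by simp),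
    coeff_embed_self]

theorem inner_embed (J : Finset (Fin n)) (k : Lp ℂ 2 (vol n)) (u : L2Forms n) :
    inner ℂ u (embed J k) = inner ℂ (coeff J u) k := by
  rw [inner_Lp_eq, L2.inner_def]
  refine integral_congr_ae ?_
  filter_upwards [embed_ae J k, coeff_ae J u] with x h1 h2
  rw [h1, h2, EuclideanSpace.inner_single_right]

theorem inner_eq_sum_coeff (u v : L2Forms n) :
    inner ℂ u v = ∑ J, inner ℂ (coeff J u) (coeff J v) := by
  conv_lhs => rw [← sum_embed_coeff v]
  rw [inner_sum]
  exact Finset.sum_congr rfl fun J _ => inner_embed J _ u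

theorem pairing_eq (u : L2Forms n) (J : Finset (Fin n)) (ψ : H n → ℂ) :
    pairing u J ψ = ∫ x, coeff J u x * ψ x ∂(vol n) := by
  refine integral_congr_ae ?_
  filter_upwards [coeff_ae J u] with x hx
  rw [hx]

theorem mem_L2q_iff {q : ℕ} {u : L2Forms n} :
    u ∈ L2q n q ↔ ∀ J : Finset (Fin n), J.card ≠ q → coeff J u = 0 := by
  constructor
  · intro h J hJ
    rw [← coeff_embed_self J (coeff J u), ← component_eq, h J hJ, map_zero]
  · intro h J hJ
    rw [component_eq, h J hJ, map_zero]

theorem embed_mem_L2q {q : ℕ} {J : Finset (Fin n)} (hJ : J.card = q) (k : Lp ℂ 2 (vol n)) :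
    embed J k ∈ L2q n q := by
  rw [mem_L2q_iff]
  intro K hK
  exact coeff_embed_of_ne (by rintro rfl; exact hK hJ) k

theorem dense_test : Dense {k : Lp ℂ 2 (vol n) | ∃ f, IsTest f ∧ k =ᵐ[vol n] f} := by
  refine (Lp.dense_hasCompactSupport_contDiff (p := 2) (μ := vol n) (F := ℂ) (by simp)).mono ?_
  rintro k ⟨f, h1, h2, h3⟩
  exact ⟨f, ⟨h3, h2⟩, h1⟩

/-- Two continuous linear maps on forms of degree `q` agree if they agree on the forms
`χ dz̄^J` with a test function `χ`. -/
theorem eq_of_forall_embed {q : ℕ} {E : Type*} [NormedAddCommGroup E] [NormedSpace ℂ E]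
    {A B : L2q n q →L[ℂ] E}
    (h : ∀ (J : Finset (Fin n)) (hJ : J.card = q) (k : Lp ℂ 2 (vol n)) (f : H n → ℂ), IsTest f →
      k =ᵐ[vol n] f → A ⟨embed J k, embed_mem_L2q hJ k⟩ = B ⟨embed J k, embed_mem_L2q hJ k⟩) :
    A = B := by
  have h1 : ∀ (J : Finset (Fin n)) (hJ : J.card = q) (k : Lp ℂ 2 (vol n)),
      A ⟨embed J k, embed_mem_L2q hJ k⟩ = B ⟨embed J k, embed_mem_L2q hJ k⟩ := by
    intro J hJ
    have hc : Continuous fun k : Lp ℂ 2 (vol n) =>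
        (⟨embed J k, embed_mem_L2q hJ k⟩ : L2q n q) := (embed J).continuous.subtype_mk _
    have := Continuous.ext_on dense_test (A.continuous.comp hc) (B.continuous.comp hc)
      (fun k ⟨f, hf, hk⟩ => h J hJ k f hf hk)
    exact congrFun this
  ext u
  have hu : u = ∑ J : Finset (Fin n), if hJ : J.card = q then
      (⟨embed J (coeff J (u : L2Forms n)), embed_mem_L2q hJ _⟩ : L2q n q) else 0 := by
    refine Subtype.ext ?_
    rw [AddSubmonoidClass.coe_finsetSum]
    conv_lhs => rw [← sum_embed_coeff (u : L2Forms n)]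
    refine Finset.sum_congr rfl fun J _ => ?_
    split_ifs with hJ
    · rfl
    · rw [mem_L2q_iff.1 u.2 J hJ, map_zero]
      rfl
  rw [hu, map_sum, map_sum]
  refine Finset.sum_congr rfl fun J _ => ?_
  split_ifs with hJ
  · exact h1 J hJ _
  · rw [map_zero, map_zero]

end Coefficients

/-! ### Existence and uniqueness of the operator I_φ -/

section Operator

variable {lam tau : Fin n → ℝ} {σ : ℝ} {φ : H n → H n → ℂ} {q : ℕ}

/-- The reciprocal of the constant in the formula for the Szegő projection. -/
noncomputable def szegoConst (lam : Fin n → ℝ) : ℂ :=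
  (((2 * Real.pi ^ (n + 1)) / ((∏ j, |lam j|) * n.factorial) : ℝ) : ℂ)

theorem iOp_mem (lam tau : Fin n → ℝ) (q : ℕ) (u : L2q n q) :
    szegoConst lam • ∑ J, embed J ((solSpace lam tau).starProjection (coeff J (u : L2Forms n))) ∈
      L2q n q := by
  refine (L2q n q).smul_mem _ ((L2q n q).sum_mem fun J _ => ?_)
  by_cases hJ : J.card = q
  · exact embed_mem_L2q hJ _
  · rw [mem_L2q_iff.1 u.2 J hJ, map_zero, map_zero]
    exact (L2q n q).zero_mem

/-- A multiple of the projection onto `solSpace`, acting on coefficients. -/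
noncomputable def iOp (lam tau : Fin n → ℝ) (q : ℕ) : L2q n q →L[ℂ] L2q n q :=
  ((szegoConst lam • ∑ J, (embed J).comp ((solSpace lam tau).starProjection.comp (coeff J))).comp
    (L2q n q).subtypeL).codRestrict (L2q n q) fun u => by
      simpa using iOp_mem lam tau q u

theorem coe_iOp (u : L2q n q) : (iOp lam tau q u : L2Forms n) =
    szegoConst lam • ∑ J, embed J
      ((solSpace lam tau).starProjection (coeff J (u : L2Forms n))) := by
  simp [iOp]

theorem coeff_iOp (u : L2q n q) (J : Finset (Fin n)) :
    coeff J (iOp lam tau q u : L2Forms n) =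
      szegoConst lam • (solSpace lam tau).starProjection (coeff J (u : L2Forms n)) := by
  rw [coe_iOp, map_smul, map_sum,
    Finset.sum_eq_single J (fun K _ hK => coeff_embed_of_ne hK.symm _) (by simp), coeff_embed_self]

/-- The bounded operator comes from the projection, and `exists_szego_limit`, applied to each
coefficient, recognizes it as the limit of the integrals. -/
theorem isIOperator_iOp (hn : 0 < n) (hlam : ∀ j, lam j ≠ 0)
    (hσ : σ ^ 2 = 1) (htau : ∀ j, tau j ^ 2 = 1) (h : ∀ j, σ * tau j * lam j = |lam j|)
    (hφ : ∀ x y (ε : ℝ), -Complex.I * (φ x y + Complex.I * (ε : ℂ)) =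
      aker lam σ ε (gmul lam (-y) x)) : IsIOperator φ q (iOp lam tau q) := by
  intro u f hf hfc hu
  have hft : ∀ J, IsTest fun x => f x J := fun J =>
    ⟨(contDiff_piLp 2).1 hf.1 J, hfc.comp_left (g := fun v : Fiber n => v J) rfl⟩
  have huJ : ∀ J, coeff J (u : L2Forms n) =ᵐ[vol n] fun x => f x J := fun J => by
    filter_upwards [coeff_ae J (u : L2Forms n), hu] with x h1 h2
    rw [h1, h2]
  choose F hF hlim hP using fun J => exists_szego_limit hn hlam hσ htau h (hft J) (huJ J)
  refine ⟨fun x => WithLp.toLp 2 fun J => F J x, ⟨(contDiff_piLp 2).2 hF, fun x J hJ => ?_⟩,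
    fun x => ?_, ?_⟩
  · have h1 := hlim J x
    simp only [szegoInt, hf.2 _ J hJ, mul_zero, integral_zero] at h1
    exact tendsto_nhds_unique h1 tendsto_const_nhds
  · have h1 : Tendsto (fun ε => WithLp.toLp 2 fun J => szegoInt lam σ ε (fun x => f x J) x)
        (𝓝[>] 0) (𝓝 (WithLp.toLp 2 fun J => F J x : Fiber n)) :=
      ((PiLp.continuous_toLp 2 _).tendsto _).comp (tendsto_pi_nhds.2 fun J => hlim J x)
    refine h1.congr' ?_
    filter_upwards [self_mem_nhdsWithin] with ε hε
    ext J
    have hc : Continuous fun y => szegoKer lam σ ε (gmul lam (-y) x) :=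
      (contDiff_szegoKer hε).continuous.comp (Continuous.gmul continuous_neg continuous_const)
    have hi : Integrable (fun y => szegoKer lam σ ε (gmul lam (-y) x) • f y) (vol n) :=
      (hc.smul hf.1.continuous).integrable_of_hasCompactSupport hfc.smul_left
    have h2 := (EuclideanSpace.proj J : Fiber n →L[ℂ] ℂ).integral_comp_comm hi
    simp only [hφ, one_div]
    exact h2
  · have h1 : ∀ᵐ x ∂(vol n), ∀ J, (iOp lam tau q u : L2Forms n) x J = F J x := by
      rw [ae_all_iff]
      intro J
      filter_upwards [coeff_ae J (iOp lam tau q u : L2Forms n), hP J] with x h1 h2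
      rw [← h1, ← h2, coeff_iOp]
      rfl
    filter_upwards [h1] with x hx
    ext J
    exact hx J

/-- The pointwise limits determine the operator on the forms χ dz̄^J, whose span is dense. -/
theorem IsIOperator.unique {A B : L2q n q →L[ℂ] L2q n q} (hA : IsIOperator φ q A)
    (hB : IsIOperator φ q B) : A = B := by
  refine eq_of_forall_embed fun J hJ k f hf hk => ?_
  have hs : IsSmoothForm q (fun x => (EuclideanSpace.single J (f x) : Fiber n)) := by
    refine ⟨(contDiff_piLp 2).2 fun K => ?_, fun x K hK => ?_⟩
    · by_cases h : K = J
      · simpa [h] using hf.1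
      · simpa [h] using contDiff_const
    · have h : K ≠ J := by rintro rfl; exact hK hJ
      simp [h]
  have hc : HasCompactSupport (fun x => (EuclideanSpace.single J (f x) : Fiber n)) :=
    hf.2.comp_left (g := fun c => (EuclideanSpace.single J c : Fiber n)) (by simp)
  have he : ((⟨embed J k, embed_mem_L2q hJ k⟩ : L2q n q) : L2Forms n) =ᵐ[vol n]
      fun x => (EuclideanSpace.single J (f x) : Fiber n) := by
    filter_upwards [embed_ae J k, hk] with x h1 h2
    rw [h1, h2]
  obtain ⟨g, -, hg, hAg⟩ := hA _ _ hs hc he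
  obtain ⟨g', -, hg', hBg⟩ := hB _ _ hs hc he
  refine Subtype.ext (Lp.ext ?_)
  filter_upwards [hAg, hBg] with x h1 h2
  rw [h1, h2, tendsto_nhds_unique (hg x) (hg' x)]

end Operator

end Heisenberg

namespace Heisenberg
variable {n : ℕ}

/-! ### The kernel of □_b and the Szegő projection -/

section Kernel

variable {lam : Fin n → ℝ} {σ : ℝ} {q : ℕ} {J : Finset (Fin n)}

theorem pairing_embed_self (J : Finset (Fin n)) (k : Lp ℂ 2 (vol n)) (ψ : H n → ℂ) :
    pairing (embed J k) J ψ = ∫ x, k x * ψ x ∂(vol n) := by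
  rw [pairing_eq, coeff_embed_self]

theorem pairing_embed_of_ne {J K : Finset (Fin n)} (h : K ≠ J) (k : Lp ℂ 2 (vol n))
    (ψ : H n → ℂ) : pairing (embed J k) K ψ = 0 := by
  rw [pairing_eq, coeff_embed_of_ne h]
  refine (integral_congr_ae ?_).trans (integral_zero _ _)
  filter_upwards [Lp.coeFn_zero ℂ 2 (vol n)] with x hx
  rw [hx, Pi.zero_apply, zero_mul]

theorem pairing_sum_smul {ι : Type*} (s : Finset ι) (c : ι → ℂ) (u : ι → L2Forms n)
    (K : Finset (Fin n)) {ψ : H n → ℂ} (hψ : IsTest ψ) :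
    pairing (∑ i ∈ s, c i • u i) K ψ = ∑ i ∈ s, c i * pairing (u i) K ψ := by
  classical
  induction s using Finset.induction_on with
  | empty => simpa using pairing_zero K hψ.1.continuous hψ.2
  | insert i s hi ih =>
    rw [Finset.sum_insert hi, Finset.sum_insert hi, pairing_add _ _ _ hψ.1.continuous hψ.2,
      pairing_smul _ _ _ hψ.1.continuous hψ.2, ih]

/-- The tangential Cauchy-Riemann operator on `ψ dz̄^J`, with a test function `ψ`. -/
theorem isDbar_embed (J : Finset (Fin n)) {ψ : H n → ℂ} (hψ : IsTest ψ) :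
    IsDbar lam (embed J ((hψ.memLp 2).toLp ψ))
      (∑ j ∈ Jᶜ, wedgeSign j (insert j J) •
        embed (insert j J) (((hψ.W lam 1 j).memLp 2).toLp (W lam 1 j ψ))) := by
  intro K χ hχ
  rw [pairing_sum_smul _ _ _ _ hχ]
  have e1 : ∀ j ∈ Jᶜ, wedgeSign j (insert j J) *
      pairing (embed (insert j J) (((hψ.W lam 1 j).memLp 2).toLp (W lam 1 j ψ))) K χ =
      if insert j J = K then wedgeSign j K * ∫ x, W lam 1 j ψ x * χ x ∂(vol n) else 0 := by
    intro j _
    split_ifs with h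
    · rw [h, pairing_embed_self]
      congr 1
      refine integral_congr_ae ?_
      filter_upwards [((hψ.W lam 1 j).memLp 2).coeFn_toLp] with x hx
      rw [hx]
    · rw [pairing_embed_of_ne (Ne.symm h), mul_zero]
  have e2 : ∀ j ∈ K, wedgeSign j K *
      pairing (embed J ((hψ.memLp 2).toLp ψ)) (K.erase j) (Zbar lam j χ) =
      if K.erase j = J then -(wedgeSign j K * ∫ x, W lam 1 j ψ x * χ x ∂(vol n)) else 0 := by
    intro j _
    split_ifs with h
    · rw [h, pairing_embed_self, integral_W_mul lam 1 j hψ hχ.1, mul_neg, neg_neg, Zbar_eq_W]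
      congr 1
      refine integral_congr_ae ?_
      filter_upwards [(hψ.memLp 2).coeFn_toLp] with x hx
      rw [hx]
    · rw [pairing_embed_of_ne h, mul_zero]
  rw [Finset.sum_congr rfl e1, Finset.sum_congr rfl e2, ← Finset.sum_filter, ← Finset.sum_filter,
    Finset.sum_neg_distrib, neg_neg]
  refine Finset.sum_congr ?_ fun _ _ => rfl
  ext j
  simp only [Finset.mem_filter, Finset.mem_compl]
  constructor
  · rintro ⟨h1, rfl⟩
    exact ⟨Finset.mem_insert_self _ _, Finset.erase_insert h1⟩
  · rintro ⟨h1, rfl⟩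
    exact ⟨Finset.notMem_erase _ _, Finset.insert_erase h1⟩

theorem weakHarmonic_coeff {u : L2Forms n} (hu : u ∈ kerBox lam q) :
    WeakHarmonic lam (fun J => coeff J u) := by
  obtain ⟨h1, h2⟩ := isBox_zero_iff.1 hu.2
  refine ⟨fun K χ hχ => ?_, fun J χ hχ => ?_⟩
  · have h3 := h1 K χ hχ
    rw [pairing_zero _ hχ.1.continuous hχ.2, eq_comm, neg_eq_zero] at h3
    rw [← h3]
    refine Finset.sum_congr rfl fun j _ => ?_
    rw [pairing_eq, Zbar_eq_W]
  -- The adjoint equation is tested on the form conj χ dz̄^J, whose ∂̄_b is explicit.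
  · have h3 := h2 _ _ (isDbar_embed (lam := lam) J hχ.conj)
    rw [inner_zero_right, sum_inner] at h3
    rw [← h3]
    refine Finset.sum_congr rfl fun j _ => ?_
    rw [inner_smul_left, conj_wedgeSign, ← inner_conj_symm, inner_embed, inner_conj_symm,
      inner_Lp_eq]
    congr 1
    refine integral_congr_ae ?_
    filter_upwards [((hχ.conj.W lam 1 j).memLp 2).coeFn_toLp] with x hx
    rw [hx, W_conj, Complex.conj_conj]

theorem coeff_mem_solSpace {u : L2Forms n} (hu : u ∈ kerBox lam q) (J : Finset (Fin n)) :
    coeff J u ∈ solSpace lam (sgn J) :=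
  mem_solSpace_iff.2 ((weakHarmonic_coeff hu).weakNull (fun J => Lp.memLp (coeff J u))
    (fun J => Lp.stronglyMeasurable (coeff J u)) J)

theorem coeff_eq_zero_of_mem_kerBox {u : L2Forms n} (hu : u ∈ kerBox lam q) {j l : Fin n}
    (hj : 0 < sgn J j * lam j) (hl : sgn J l * lam l < 0) : coeff J u = 0 :=
  Lp.eq_zero_iff_ae_eq_zero.2 ((weakHarmonic_coeff hu).ae_eq_zero
    (fun J => Lp.memLp (coeff J u)) (fun J => Lp.stronglyMeasurable (coeff J u)) hj hl)

/-- ∂̄_b differentiates the coefficient of dz̄^J only along Z̄_j with j ∉ J, and for these j the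
sign is 1. -/
theorem isDbar_embed_zero {k : Lp ℂ 2 (vol n)} (hk : k ∈ solSpace lam (sgn J)) :
    IsDbar lam (embed J k) 0 := by
  intro K χ hχ
  rw [pairing_zero _ hχ.1.continuous hχ.2, eq_comm, neg_eq_zero]
  refine Finset.sum_eq_zero fun j hj => ?_
  by_cases h : K.erase j = J
  · have hs : sgn J j = 1 := by
      rw [sgn, if_neg]
      rw [← h]
      exact Finset.notMem_erase _ _
    have := mem_solSpace_iff.1 hk j χ hχ
    rw [hs] at this
    rw [h, pairing_embed_self, Zbar_eq_W, this, mul_zero]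
  · rw [pairing_embed_of_ne h, mul_zero]

/-- Integration by parts against a smooth square integrable solution. -/
theorem IsDbar.integral_mul_conj_eq_zero {v f : L2Forms n} (hvf : IsDbar lam v f) {h : H n → ℂ}
    (hs : ContDiff ℝ ∞ h) (h2 : MemLp h 2 (vol n))
    (hW : ∀ j ∈ J, ∀ x, W lam (-1) j h x = 0) :
    ∫ x, coeff J f x * conj (h x) ∂(vol n) = 0 := by
  have hsc : ContDiff ℝ ∞ fun x => conj (h x) := Complex.conjCLE.contDiff.comp hs
  have hWc : ∀ j ∈ J, ∀ x, W lam 1 j (fun x => conj (h x)) x = 0 := fun j hj x => by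
    rw [W_conj, hW j hj, map_zero]
  have h2c := memLp_conj h2
  have hi : Integrable (fun x => coeff J f x * conj (h x)) (vol n) :=
    (Lp.memLp (coeff J f)).integrable_mul h2c
  have hlim : Tendsto (fun m => pairing f J fun x => cut m x * conj (h x)) atTop
      (𝓝 (∫ x, coeff J f x * conj (h x) ∂(vol n))) := by
    simp_rw [pairing_eq, mul_left_comm]
    exact tendsto_integral_cut_mul hi
  -- Z̄_j annihilates conj h, so only the cutoff is differentiated, at cost C/(m + 1).
  have hterm : ∀ j ∈ J, Tendsto (fun m => wedgeSign j J *
      pairing v (J.erase j) (Zbar lam j fun x => cut m x * conj (h x))) atTop (𝓝 0) := by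
    intro j hj
    obtain ⟨C, hC0, hC⟩ := exists_norm_W_cut_le lam 1 j
    set a := coeff (J.erase j) v with ha
    have hai : Integrable (fun x => a x * conj (h x)) (vol n) :=
      (Lp.memLp a).integrable_mul h2c
    have e : ∀ m, pairing v (J.erase j) (Zbar lam j fun x => cut m x * conj (h x)) =
        ∫ x, W lam 1 j (cut m) x * (a x * conj (h x)) ∂(vol n) := by
      intro m
      rw [pairing_eq, Zbar_eq_W, ← ha]
      refine integral_congr_ae (Eventually.of_forall fun x => ?_)
      beta_reduce
      rw [W_cut_mul hsc, hWc j hj]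
      ring
    rw [← mul_zero (wedgeSign j J)]
    refine Tendsto.const_mul _ ?_
    simp_rw [e]
    refine squeeze_zero_norm (a := fun m : ℕ => C * (1 / ((m : ℝ) + 1)) *
      ∫ x, ‖a x * conj (h x)‖ ∂(vol n)) (fun m => ?_) ?_
    · rw [← integral_const_mul]
      refine norm_integral_le_of_norm_le (hai.norm.const_mul _) (Eventually.of_forall fun x => ?_)
      rw [norm_mul]
      refine mul_le_mul_of_nonneg_right ?_ (norm_nonneg _)
      rw [mul_one_div]
      exact hC m x
    · simpa using (tendsto_inv_nat.const_mul C).mul_const (∫ x, ‖a x * conj (h x)‖ ∂(vol n))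
  have hzero := (tendsto_finsetSum J hterm).neg
  rw [Finset.sum_const_zero, neg_zero] at hzero
  refine tendsto_nhds_unique hlim (hzero.congr fun m => ?_)
  exact (hvf J _ (isTest_cut_mul hsc m)).symm

/-- The adjoint must be tested on the maximal domain of ∂̄_b, where a merely weak solution k cannot
be integrated by parts directly. Projections of test functions are smooth by `exists_szego_limit`,
so the cutoff argument applies to them; by density and continuity it extends to all projections, and
k is its own projection. -/
theorem isDbarStar_embed_zero (hn : 0 < n) (hlam : ∀ j, lam j ≠ 0)
    (hσ : σ ^ 2 = 1) (h : ∀ j, σ * sgn J j * lam j = |lam j|)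
    {k : Lp ℂ 2 (vol n)} (hk : k ∈ solSpace lam (sgn J)) : IsDbarStar lam (embed J k) 0 := by
  intro v f hvf
  set P := (solSpace lam (sgn J)).starProjection with hP
  have h1 : (fun w : Lp ℂ 2 (vol n) => inner ℂ (coeff J f) (P w)) = fun _ => (0 : ℂ) := by
    refine Continuous.ext_on dense_test (by fun_prop) continuous_const ?_
    rintro w ⟨χ, hχ, hw⟩
    obtain ⟨F, hF, -, hPF⟩ := exists_szego_limit hn hlam hσ (sgn_sq J) h hχ hw
    set C : ℂ := (((2 * Real.pi ^ (n + 1)) / ((∏ j, |lam j|) * n.factorial) : ℝ) : ℂ) with hC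
    have hC0 : C ≠ 0 := by
      rw [hC]
      have := Finset.prod_pos fun j (_ : j ∈ Finset.univ) => abs_pos.2 (hlam j)
      exact_mod_cast (by positivity :
        (2 * Real.pi ^ (n + 1)) / ((∏ j, |lam j|) * n.factorial) ≠ 0)
    have hmem : C • P w ∈ solSpace lam (sgn J) :=
      Submodule.smul_mem _ _ (Submodule.starProjection_apply_mem _ _)
    have hFn : ∀ j, WeakNull lam (sgn J j) j F := by
      intro j χ hχ
      rw [← mem_solSpace_iff.1 hmem j χ hχ]
      refine integral_congr_ae ?_
      filter_upwards [hPF] with x hx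
      rw [hx]
    have hF2 : MemLp F 2 (vol n) := (memLp_congr_ae hPF).1 (Lp.memLp _)
    have h0 := hvf.integral_mul_conj_eq_zero (J := J) hF hF2 fun j hj x => by
      have := (hFn j).eq_zero hF x
      rwa [sgn, if_pos hj] at this
    beta_reduce
    have h3 : inner ℂ (C • P w) (coeff J f) = 0 := by
      rw [inner_Lp_eq, ← h0]
      refine integral_congr_ae ?_
      filter_upwards [hPF] with x hx
      rw [hx]
    rw [inner_smul_left, mul_eq_zero] at h3
    exact inner_eq_zero_symm.1 (h3.resolve_left ((map_ne_zero _).2 hC0))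
  rw [inner_zero_right, inner_embed, ← congrFun h1 k, hP,
    Submodule.starProjection_eq_self_iff.2 hk]

theorem embed_mem_kerBox (hn : 0 < n) (hlam : ∀ j, lam j ≠ 0)
    (hσ : σ ^ 2 = 1) (h : ∀ j, σ * sgn J j * lam j = |lam j|)
    {k : Lp ℂ 2 (vol n)} (hk : k ∈ solSpace lam (sgn J)) (hJ : J.card = q) :
    embed J k ∈ kerBox lam q :=
  ⟨embed_mem_L2q hJ k,
    isBox_zero_iff.2 ⟨isDbar_embed_zero hk, isDbarStar_embed_zero hn hlam hσ h hk⟩⟩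

/-- The orthogonal projection onto `Ker □_b` in terms of the coefficients `J` and `K`, if all the
other coefficients of the elements of `Ker □_b` vanish. -/
theorem szego_eq {K : Finset (Fin n)} {σ' : ℝ} (hn : 0 < n) (hlam : ∀ j, lam j ≠ 0)
    (hσ : σ ^ 2 = 1) (hσ' : σ' ^ 2 = 1) (h : ∀ j, σ * sgn J j * lam j = |lam j|)
    (h' : ∀ j, σ' * sgn K j * lam j = |lam j|) (hJK : J ≠ K)
    (hne : ∀ u ∈ kerBox lam q, ∀ L, L ≠ J → L ≠ K → coeff L u = 0) (u : L2q n q) :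
    szego lam q u =
      embed J ((solSpace lam (sgn J)).starProjection (coeff J (u : L2Forms n))) +
      embed K ((solSpace lam (sgn K)).starProjection (coeff K (u : L2Forms n))) := by
  have hmem : ∀ (L : Finset (Fin n)) (s : ℝ), s ^ 2 = 1 →
      (∀ j, s * sgn L j * lam j = |lam j|) →
      embed L ((solSpace lam (sgn L)).starProjection (coeff L (u : L2Forms n))) ∈
        kerBox lam q := by
    intro L s hs hL
    -- If q is the length of only one of the two multi-indices, the other term is 0, since that
    -- coefficient of u vanishes; the same formula thus covers n_- = n_+ and n_- ≠ n_+.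
    by_cases hq : L.card = q
    · exact embed_mem_kerBox hn hlam hs hL (Submodule.starProjection_apply_mem _ _) hq
    · rw [mem_L2q_iff.1 u.2 L hq, map_zero, map_zero]
      exact Submodule.zero_mem _
  change (kerBox lam q).starProjection (u : L2Forms n) = _
  refine Submodule.eq_starProjection_of_mem_of_inner_eq_zero
    (Submodule.add_mem _ (hmem J σ hσ h) (hmem K σ' hσ' h')) fun w hw => ?_
  rw [inner_eq_sum_coeff]
  refine Finset.sum_eq_zero fun L _ => ?_
  by_cases hLJ : L = J
  · subst hLJ
    rw [map_sub, map_add, coeff_embed_self, coeff_embed_of_ne hJK, add_zero]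
    exact Submodule.starProjection_inner_eq_zero _ _ (coeff_mem_solSpace hw L)
  by_cases hLK : L = K
  · subst hLK
    rw [map_sub, map_add, coeff_embed_self, coeff_embed_of_ne hLJ, zero_add]
    exact Submodule.starProjection_inner_eq_zero _ _ (coeff_mem_solSpace hw L)
  · rw [hne w hw L hLJ hLK, inner_zero_right]

end Kernel

/-! ### Sign patterns, phases and constants -/

section Signature

variable {lam : Fin n → ℝ}

/-- The first n_- indices lie among the negative ones, and the two sets have the same cardinality.
-/
theorem neg_iff_lt_nMinus (hord : ∀ j : Fin n, (j : ℕ) < nMinus lam → lam j < 0) (j : Fin n) :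
    lam j < 0 ↔ (j : ℕ) < nMinus lam := by
  have h1 : JMinus lam ⊆ Finset.univ.filter fun j => lam j < 0 := fun j hj => by
    simp only [JMinus, Finset.mem_filter, Finset.mem_univ, true_and] at hj ⊢
    exact hord j hj
  have h2 := Finset.eq_of_subset_of_card_le h1 (card_JMinus lam).ge
  have h3 := congrArg (fun s => j ∈ s) h2
  simp only [JMinus, Finset.mem_filter, Finset.mem_univ, true_and] at h3
  exact h3.symm.to_iff

theorem sgn_JMinus_mul (hord : ∀ j : Fin n, (j : ℕ) < nMinus lam → lam j < 0) (j : Fin n) :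
    1 * sgn (JMinus lam) j * lam j = |lam j| := by
  have h := neg_iff_lt_nMinus hord j
  by_cases hj : lam j < 0
  · rw [sgn, if_pos (by simpa [JMinus] using h.1 hj), abs_of_neg hj]
    ring
  · rw [sgn, if_neg (by simpa [JMinus] using (not_congr h).1 hj), abs_of_nonneg (not_lt.1 hj)]
    ring

theorem sgn_JPlus_mul (hord : ∀ j : Fin n, (j : ℕ) < nMinus lam → lam j < 0) (j : Fin n) :
    -1 * sgn (JPlus lam) j * lam j = |lam j| := by
  have h := neg_iff_lt_nMinus hord j
  by_cases hj : lam j < 0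
  · rw [sgn, if_neg (by simpa [JPlus] using h.1 hj), abs_of_neg hj]
    ring
  · rw [sgn, if_pos (by simpa [JPlus] using (not_congr h).1 hj), abs_of_nonneg (not_lt.1 hj)]
    ring

theorem sgn_injective : Function.Injective (sgn : Finset (Fin n) → Fin n → ℝ) := by
  intro J K h
  ext j
  have := congrFun h j
  unfold sgn at this
  split_ifs at this with h1 h2 h2
  · simp [h1, h2]
  · norm_num at this
  · norm_num at this
  · simp [h1, h2]

/-- The numbers `sgn J j * lam j` have absolute value |λ_j|. If all are positive, `sgn J` agrees
with the pattern of J_{n_-}, and if all are negative with that of J_{n_+}; the pattern determines J.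
-/
theorem exists_sign_change (hlam : ∀ j, lam j ≠ 0)
    (hord : ∀ j : Fin n, (j : ℕ) < nMinus lam → lam j < 0) {J : Finset (Fin n)}
    (hJ : J ≠ JMinus lam) (hJ' : J ≠ JPlus lam) :
    ∃ j l, 0 < sgn J j * lam j ∧ sgn J l * lam l < 0 := by
  have hne : ∀ j, sgn J j * lam j ≠ 0 := fun j => by
    refine mul_ne_zero (fun h => ?_) (hlam j)
    have := sgn_sq J j
    simp [h] at this
  have habs : ∀ j, |sgn J j * lam j| = |lam j| := fun j => by
    rw [abs_mul, sgn]
    split_ifs <;> simp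
  by_contra! hcon
  by_cases hp : ∃ j, 0 < sgn J j * lam j
  · obtain ⟨j, hj⟩ := hp
    refine hJ (sgn_injective (funext fun l => mul_right_cancel₀ (hlam l) ?_))
    have h1 := sgn_JMinus_mul hord l
    rw [one_mul] at h1
    rw [h1, ← habs, abs_of_nonneg (hcon j l hj)]
  · push Not at hp
    refine hJ' (sgn_injective (funext fun l => mul_right_cancel₀ (hlam l) ?_))
    have h1 := sgn_JPlus_mul hord l
    rw [← habs, abs_of_nonpos (hp l)] at h1
    linarith

theorem JMinus_ne_JPlus (hpos : 0 < nMinus lam) : JMinus lam ≠ JPlus lam := by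
  intro h
  have hn : 0 < n := hpos.trans_le ((Finset.card_filter_le _ _).trans (by simp))
  have h1 := congrArg (fun s => (⟨0, hn⟩ : Fin n) ∈ s) h
  simp [JMinus, JPlus, hpos, hpos.ne'] at h1

theorem aker_neg_gmul (lam : Fin n → ℝ) (σ ε : ℝ) (x y : H n) :
    aker lam σ ε (gmul lam (-y) x) = ε + ∑ j, ((|lam j| * ‖x.1 j - y.1 j‖ ^ 2 : ℝ) : ℂ) +
      σ * (Complex.I * (x.2 - y.2) + ∑ j, (lam j : ℂ) *
        (conj (x.1 j) * y.1 j - x.1 j * conj (y.1 j))) := by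
  have h1 : quad lam (gmul lam (-y) x).1 = ∑ j, |lam j| * ‖x.1 j - y.1 j‖ ^ 2 := by
    refine Finset.sum_congr rfl fun j _ => ?_
    simp [gmul, neg_add_eq_sub]
  have h2 : ∑ j, (lam j : ℂ) * (conj (x.1 j) * y.1 j - x.1 j * conj (y.1 j)) =
      Complex.I * (twist lam (-y.1) x.1 : ℝ) := by
    rw [twist_apply, Complex.ofReal_sum, Finset.mul_sum]
    refine Finset.sum_congr rfl fun j _ => ?_
    apply Complex.ext <;> simp
    ring
  rw [aker, h1, h2]
  simp only [gmul, Prod.fst_neg, Prod.snd_neg]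
  push_cast
  ring

theorem neg_I_mul_phaseMinus (lam : Fin n → ℝ) (x y : H n) (ε : ℝ) :
    -Complex.I * (phaseMinus lam x y + Complex.I * (ε : ℂ)) = aker lam 1 ε (gmul lam (-y) x) := by
  rw [aker_neg_gmul, phaseMinus]
  push_cast
  linear_combination -((∑ j, ((|lam j| : ℝ) : ℂ) * (‖x.1 j - y.1 j‖ : ℂ) ^ 2) + (∑ j, (lam j : ℂ) *
    (conj (x.1 j) * y.1 j - x.1 j * conj (y.1 j))) + ε) * Complex.I_sq

theorem neg_I_mul_phasePlus (lam : Fin n → ℝ) (x y : H n) (ε : ℝ) :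
    -Complex.I * (phasePlus lam x y + Complex.I * (ε : ℂ)) =
      aker lam (-1) ε (gmul lam (-y) x) := by
  have h : ∑ j, (lam j : ℂ) * (x.1 j * conj (y.1 j) - conj (x.1 j) * y.1 j) =
      -∑ j, (lam j : ℂ) * (conj (x.1 j) * y.1 j - x.1 j * conj (y.1 j)) := by
    rw [← Finset.sum_neg_distrib]
    exact Finset.sum_congr rfl fun j _ => by ring
  rw [aker_neg_gmul, phasePlus, h]
  push_cast
  linear_combination -((∑ j, ((|lam j| : ℝ) : ℂ) * (‖x.1 j - y.1 j‖ : ℂ) ^ 2) - (∑ j, (lam j : ℂ) *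
    (conj (x.1 j) * y.1 j - x.1 j * conj (y.1 j))) + ε) * Complex.I_sq

theorem smul_iOp_tau (hlam : ∀ j, lam j ≠ 0) {J : Finset (Fin n)} {q : ℕ} (hJ : J.card = q)
    (τ : Fin n → ℝ) (u : L2Forms n) :
    (((∏ j, |lam j|) / (2 * Real.pi ^ (n + 1)) * (n.factorial : ℝ) : ℝ) : ℂ) •
      (iOp lam τ q (tau J hJ u) : L2Forms n) =
      embed J ((solSpace lam τ).starProjection (coeff J u)) := by
  have hc : (((∏ j, |lam j|) / (2 * Real.pi ^ (n + 1)) * (n.factorial : ℝ) : ℝ) : ℂ) *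
      szegoConst lam = 1 := by
    have := Finset.prod_pos fun j (_ : j ∈ Finset.univ) => abs_pos.2 (hlam j)
    rw [szegoConst, ← Complex.ofReal_mul, ← Complex.ofReal_one]
    congr 1
    field_simp
  have ht : (tau J hJ u : L2Forms n) = embed J (coeff J u) := component_eq J u
  rw [coe_iOp, smul_smul, hc, one_smul, ht, Finset.sum_eq_single J, coeff_embed_self]
  · intro K _ hK
    rw [coeff_embed_of_ne hK, map_zero, map_zero]
  · simp

end Signature

end Heisenberg

theorem theorem1p3 {n : ℕ} (lam : Fin n → ℝ) (hlam : ∀ j, lam j ≠ 0)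
    (hpos : 0 < Heisenberg.nMinus lam)
    (hord : ∀ j : Fin n, (j : ℕ) < Heisenberg.nMinus lam → lam j < 0)
    (q : ℕ) (hq : q = Heisenberg.nMinus lam ∨ q = Heisenberg.nPlus lam) :
    (∃! A : Heisenberg.L2q n (Heisenberg.nMinus lam) →L[ℂ]
        Heisenberg.L2q n (Heisenberg.nMinus lam),
      Heisenberg.IsIOperator (Heisenberg.phaseMinus lam) (Heisenberg.nMinus lam) A) ∧
    (∃! B : Heisenberg.L2q n (Heisenberg.nPlus lam) →L[ℂ]
        Heisenberg.L2q n (Heisenberg.nPlus lam),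
      Heisenberg.IsIOperator (Heisenberg.phasePlus lam) (Heisenberg.nPlus lam) B) ∧
    ∀ (A : Heisenberg.L2q n (Heisenberg.nMinus lam) →L[ℂ]
        Heisenberg.L2q n (Heisenberg.nMinus lam))
      (B : Heisenberg.L2q n (Heisenberg.nPlus lam) →L[ℂ]
        Heisenberg.L2q n (Heisenberg.nPlus lam)),
      Heisenberg.IsIOperator (Heisenberg.phaseMinus lam) (Heisenberg.nMinus lam) A →
      Heisenberg.IsIOperator (Heisenberg.phasePlus lam) (Heisenberg.nPlus lam) B →
      ∀ u : Heisenberg.L2q n q,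
        Heisenberg.szego lam q u =
          (((∏ j, |lam j|) / (2 * Real.pi ^ (n + 1)) * (n.factorial : ℝ) : ℝ) : ℂ) •
            (A (Heisenberg.tauMinus lam (u : Heisenberg.L2Forms n)) : Heisenberg.L2Forms n) +
          (((∏ j, |lam j|) / (2 * Real.pi ^ (n + 1)) * (n.factorial : ℝ) : ℝ) : ℂ) •
            (B (Heisenberg.tauPlus lam (u : Heisenberg.L2Forms n)) : Heisenberg.L2Forms n) := by
  have hn : 0 < n := hpos.trans_le ((Finset.card_filter_le _ _).trans (by simp))
  have hm := Heisenberg.sgn_JMinus_mul hord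
  have hp := Heisenberg.sgn_JPlus_mul hord
  have hA := Heisenberg.isIOperator_iOp (q := Heisenberg.nMinus lam) hn hlam (one_pow 2)
    (Heisenberg.sgn_sq (Heisenberg.JMinus lam)) hm (Heisenberg.neg_I_mul_phaseMinus lam)
  have hB := Heisenberg.isIOperator_iOp (q := Heisenberg.nPlus lam) hn hlam (by norm_num)
    (Heisenberg.sgn_sq (Heisenberg.JPlus lam)) hp (Heisenberg.neg_I_mul_phasePlus lam)
  refine ⟨⟨_, hA, fun _ h => h.unique hA⟩, ⟨_, hB, fun _ h => h.unique hB⟩, ?_⟩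
  intro A B hA' hB' u
  -- By uniqueness A and B are the constructed multiples of projections, and the constant of the
  -- theorem cancels the multiple.
  rw [hA'.unique hA, hB'.unique hB, Heisenberg.tauMinus, Heisenberg.tauPlus,
    Heisenberg.smul_iOp_tau hlam, Heisenberg.smul_iOp_tau hlam]
  refine Heisenberg.szego_eq hn hlam (one_pow 2) (by norm_num) hm hp
    (Heisenberg.JMinus_ne_JPlus hpos) (fun v hv L hL hL' => ?_) u
  obtain ⟨j, l, hj, hl⟩ := Heisenberg.exists_sign_change hlam hord hL hL'
  exact Heisenberg.coeff_eq_zero_of_mem_kerBox hv hj hl
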